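/- **Theorem.** There are absolute constants $c>0$ and $p>0$ such that the following holds. Let $G=(V,E)$ be a finite simple graph on $n\ge 2$ vertices, let $S$ be an integer with $1\le S\le n$, and let $M_{\rm OPT}$ be an arbitrary maximum matching in $G$. With probability at least $p$, the randomized algorithm ParallelAlg$(G,S)$ described below constructs a matching of $G$ of size at least $c\,|M_{\rm OPT}|$. **Notation and parameters.** $G[W]$ is the subgraph induced by $W\subseteq V$, $N(v)$ is the set of neighbors of $v$ in $G$, and $[m]=\{1,\dots,m\}$. Let $\alpha=96\ln n$ and $\mu_R=(10^6\log n)^{-1}$, where $\log$ may be either the natural or the binary logarithm (the statement holds for both, with the same $c$ and $p$). Let $\mu_H(r)=\frac12\exp(\frac{\alpha}{2}(r-\frac12))$ for $r\le\frac12$ and $\mu_H(r)=1-\frac12\exp(-\frac{\alpha}{2}(r-\frac12))$ for $r>\frac12$. Let $\mu_F(r)=\max\{r/4,0\}$ for $r\le4$ and $\mu_F(r)=1$ for $r>4$. All random choices below are independent unless stated otherwise. "Select each $v\in W$ with probability $q_v$" means independently for the different $v$, given the sets that were constructed before. **LocalPhase$(G[W],\Delta_\star)$.** Construct $R\subseteq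 W$ by selecting each $v\in W$ with probability $\mu_R$, then $H\subseteq W$ by selecting each $v\in W$ with probability $\mu_H\big(|N(v)\cap R|/(\mu_R\Delta_\star)\big)$, then $F\subseteq W$ by selecting each $v\in W$ with probability $\mu_F\big(|N(v)\cap H|/\Delta_\star\big)$. Compute a maximal matching $M$ in $G[H\cup F]$, by any fixed, possibly randomized, subroutine with input $G[H\cup F]$. Return $(W\setminus(R\cup H\cup F),\,M)$. **MatchHeavy$(H,F)$.** Every $v\in F$ picks a uniformly random $v_\star\in N(v)\cap H$. Color each vertex of $H\cup F$ red or blue independently with probability $\frac12$ each. Let $E_\star$ be the set of the edges $(v,v_\star)$ with $v\in F$ red and $v_\star\in H$ blue. For every blue vertex incident to an edge of $E_\star$ select one such edge, by any fixed, possibly randomized, rule with input $E_\star$. Return the set of the selected edges. **GlobalAlg$(G[W],\widetilde\Delta)$.** Start with $\Delta=\widetilde\Delta$ and $M=\emptyset$. While $\Delta\ge1$: let $H$ be the set of vertices of degree at least $\Delta/2$ in $G[W]$; construct $F\subseteq W$ by selecting each $v\in W$ with probability $|N(v)\cap H|/(4\Delta)$; add the edges returned by MatchHeavy$(H,F)$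 to $M$; replace $W$ by $W\setminus(H\cup F)$ and $\Delta$ by $\Delta/2$. Return $M$. **ParallelAlg$(G,S)$.** Start with $\Delta=n$, $V'=V$ and $M=\emptyset$. While $\Delta\ge\frac nS(200\ln n)^{32}$, do the following. 1. Let $m=\lfloor\sqrt{n\Delta/S}\rfloor$ and $\tau=\lceil\frac1{16}\log_{120\alpha}(\Delta/m)\rceil$. 2. Partition $V'$ into $V_1,\dots,V_m$ by assigning each vertex independently and uniformly at random. 3. For each $i\in[m]$, independently of the others: if $G[V_i]$ has more than $8S$ edges, replace $V_i$ by $\emptyset$; then, for $j=1,\dots,\tau$ in turn, set $(V_i,M_{i,j})$ to the output of LocalPhase$\big(G[V_i],\Delta/(2^{j-1}m)\big)$. 4. Replace $V'$ by $\bigcup_iV_i$, $M$ by $M\cup\bigcup_{i,j}M_{i,j}$, and $\Delta$ by $\Delta/2^\tau$. When the loop has ended, remove from $V'$ all vertices of degree at least $2\Delta$ in $G[V']$, let $M'$ be the output of GlobalAlg$(G[V'],2\Delta)$, and return $M\cup M'$. -/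

import Mathlib

open scoped ENNReal BigOperators

namespace RoundCompression

/-! ### Graphs and matchings -/

section Graph

variable {V : Type*}

/-- The induced subgraph `G[W]`, as a graph on the same vertex type whose edges are the edges of `G`
with both endpoints in `W`. -/
def inducedOn (G : SimpleGraph V) (W : Finset V) : SimpleGraph V :=
  (G.induce (W : Set V)).spanningCoe

/-- A finite set `M` of edges of `G`, no two different ones of which share an endpoint. -/
def IsMatching (G : SimpleGraph V) (M : Finset (Sym2 V)) : Prop :=
  (∀ e ∈ M, e ∈ G.edgeSet) ∧ ∀ e ∈ M, ∀ e' ∈ M, ∀ v, v ∈ e → v ∈ e' → e = e'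

/-- A matching that is maximal with respect to inclusion. -/
def IsMaximalMatching (G : SimpleGraph V) (M : Finset (Sym2 V)) : Prop :=
  Maximal (IsMatching G) M

/-- A matching of the largest possible size. -/
def IsMaximumMatching (G : SimpleGraph V) (M : Finset (Sym2 V)) : Prop :=
  IsMatching G M ∧ ∀ M', IsMatching G M' → M'.card ≤ M.card

open Classical in
/-- `N(v) ∩ W`. -/
noncomputable def nbrs (G : SimpleGraph V) (W : Finset V) (v : V) : Finset V :=
  W.filter fun u => G.Adj v u

end Graph

/-! ### Finite random experiments -/

/-- The law of a family of independent random variables with laws `p i`. -/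
noncomputable def indep {ι α : Type*} [Fintype ι] [DecidableEq ι] [Fintype α]
    (p : ι → PMF α) : PMF (ι → α) :=
  PMF.ofFintype (fun f => ∏ i, p i (f i)) (by
    classical
    have h : ∀ i, ∑ a, p i a = 1 := fun i => by
      rw [← tsum_fintype (L := .unconditional _)]; exact (p i).tsum_coe
    have h2 := Finset.prod_univ_sum (fun _ : ι => (Finset.univ : Finset α)) (fun i a => p i a)
    rw [Fintype.piFinset_univ] at h2
    rw [← h2]
    simp [h])

/-- A coin that comes up `true` with probability `p` (clipped to `[0, 1]`). -/
noncomputable def coin (p : ℝ) : PMF Bool :=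
  PMF.ofFintype (fun x => cond x (ENNReal.ofReal (min p 1)) (1 - ENNReal.ofReal (min p 1))) (by
    simp)

/-- A random subset of `W` to which each `v ∈ W` belongs independently with probability `p v`. -/
noncomputable def randomSubset {V : Type*} [Fintype V] [DecidableEq V]
    (W : Finset V) (p : V → ℝ) : PMF (Finset V) :=
  (indep fun v => coin (p v)).map fun x => W.filter fun v => x v = true

open Classical in
/-- A uniformly random element of `W`; the value `d` if `W` is empty. -/
noncomputable def uniformOr {V : Type*} (W : Finset V) (d : V) : PMF V :=
  if h : W.Nonempty then PMF.uniformOfFinset W h else PMF.pure d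

/-! ### Parameters; `n` is the number of vertices of the input graph, and `b` is the base of the
logarithm in `μ_R`. -/

/-- `α = 96 ln n`. -/
noncomputable def alpha (n : ℕ) : ℝ := 96 * Real.log n

/-- `μ_R = (10⁶ log n)⁻¹`. -/
noncomputable def muR (b : ℝ) (n : ℕ) : ℝ := (10 ^ 6 * Real.logb b n)⁻¹

/-- The probability `μ_H` of the selection for a heavy set. -/
noncomputable def muH (n : ℕ) (r : ℝ) : ℝ :=
  if r ≤ 1 / 2 then 1 / 2 * Real.exp (alpha n / 2 * (r - 1 / 2))
  else 1 - 1 / 2 * Real.exp (-(alpha n / 2 * (r - 1 / 2)))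

/-- The probability `μ_F` of the selection for a set of friends. -/
noncomputable def muF (r : ℝ) : ℝ :=
  if r ≤ 4 then max (r / 4) 0 else 1

/-- `m = ⌊√(n Δ / S)⌋`. -/
noncomputable def numMachines (n S : ℕ) (Δ : ℝ) : ℕ :=
  ⌊Real.sqrt (n * Δ / S)⌋₊

/-- `τ = ⌈(1/16) log_{120 α} (Δ / m)⌉`. -/
noncomputable def numPhases (n S : ℕ) (Δ : ℝ) : ℕ :=
  ⌈1 / 16 * Real.logb (120 * alpha n) (Δ / numMachines n S Δ)⌉₊

/-- The condition `Δ ≥ (n / S) (200 ln n)^32` of the main loop. -/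
def LoopCond (n S : ℕ) (Δ : ℝ) : Prop :=
  (n : ℝ) / S * (200 * Real.log n) ^ 32 ≤ Δ

/-- The value of `Δ` after `k` iterations of the main loop. It starts at `n`, and an iteration divides
it by `2^τ`; it does not depend on the random choices. -/
noncomputable def threshold (n S : ℕ) : ℕ → ℝ
  | 0 => n
  | k + 1 => threshold n S k / 2 ^ numPhases n S (threshold n S k)

/-- The number of iterations of the main loop: the loop stops as soon as its condition fails. -/
noncomputable def numIterations (n S : ℕ) : ℕ :=
  sInf {k | ¬ LoopCond n S (threshold n S k)}

/-- For `n ≥ 2` the main loop terminates. -/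
theorem exists_not_loopCond {n S : ℕ} (hn : 2 ≤ n) (hS : 1 ≤ S) (hSn : S ≤ n) :
    ∃ k, ¬ LoopCond n S (threshold n S k) := by
  by_contra! hcon
  have hn' : (2 : ℝ) ≤ n := by exact_mod_cast hn
  have hS' : (1 : ℝ) ≤ S := by exact_mod_cast hS
  have hSn' : (S : ℝ) ≤ n := by exact_mod_cast hSn
  have hlog : (1 / 2 : ℝ) < Real.log n :=
    (by linarith [Real.log_two_gt_d9] : (1 / 2 : ℝ) < Real.log 2).trans_le
      (Real.log_le_log (by norm_num) hn')
  have hL : (1 : ℝ) < 200 * Real.log n := by linarith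
  have hL32 : (1 : ℝ) < (200 * Real.log n) ^ 32 := one_lt_pow₀ hL (by norm_num)
  have hq : (1 : ℝ) ≤ (n : ℝ) / S := by rw [le_div_iff₀ (by linarith)]; linarith
  have hone : ∀ Δ, LoopCond n S Δ → 1 ≤ numPhases n S Δ ∧ 1 < Δ := by
    intro Δ hΔ
    unfold LoopCond at hΔ
    have hgt : (n : ℝ) / S < Δ := by nlinarith
    have hΔ1 : 1 < Δ := by linarith
    have hx : (n : ℝ) * Δ / S = n / S * Δ := by ring
    have hx1 : (1 : ℝ) ≤ n * Δ / S := by rw [hx]; nlinarith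
    have hm1 : 1 ≤ numMachines n S Δ := by
      unfold numMachines
      exact Nat.le_floor (by simpa using Real.one_le_sqrt.mpr hx1)
    have hm2 : (numMachines n S Δ : ℝ) < Δ := by
      refine (Nat.floor_le (Real.sqrt_nonneg _)).trans_lt ?_
      rw [Real.sqrt_lt' (by linarith), hx]
      nlinarith
    have hm1' : (0 : ℝ) < numMachines n S Δ := by exact_mod_cast hm1
    refine ⟨Nat.one_le_ceil_iff.mpr ?_, hΔ1⟩
    have : 0 < Real.logb (120 * alpha n) (Δ / numMachines n S Δ) := by
      apply Real.logb_pos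
      · unfold alpha; linarith
      · rwa [one_lt_div hm1']
    positivity
  have hle : ∀ k, threshold n S k ≤ n / 2 ^ k := by
    intro k
    induction k with
    | zero => simp [threshold]
    | succ k ih =>
      obtain ⟨h1, h2⟩ := hone _ (hcon k)
      have hp : (2 : ℝ) ≤ 2 ^ numPhases n S (threshold n S k) :=
        le_self_pow₀ (by norm_num) (by omega)
      calc threshold n S (k + 1) = threshold n S k / 2 ^ numPhases n S (threshold n S k) := rfl
        _ ≤ threshold n S k / 2 := div_le_div_of_nonneg_left (by linarith) (by norm_num) hp
        _ ≤ n / 2 ^ k / 2 := by linarith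
        _ = n / 2 ^ (k + 1) := by rw [pow_succ, div_div]
  have h1 := (hone _ (hcon n)).2.trans_le (hle n)
  have h2 : (n : ℝ) < 2 ^ n := by exact_mod_cast Nat.lt_two_pow_self
  rw [lt_div_iff₀ (by positivity)] at h1
  linarith

/-- The number of phases of the global algorithm: `Δ` starts at `D`, is halved in every phase, and
the algorithm stops as soon as `Δ < 1`. -/
noncomputable def numGlobalPhases (D : ℝ) : ℕ :=
  sInf {k : ℕ | D / 2 ^ k < 1}

/-! ### The algorithms

A state consists of the set of the remaining vertices and of the edges collected so far. -/

section Algorithms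

variable {V : Type*} [Fintype V] [DecidableEq V]

/-- `MatchHeavy(H, F)`. Every `v` picks a uniformly random neighbour `v⋆ = star v` in `H` (only
`v ∈ F` matter; if there is none, then `star v = v`, which never yields an edge, as `v` would have to
be both red and blue), and vertices are coloured independently, with `red v = false` meaning blue.
The set `A w` consists of the `v` for which `(v, w)` is in `E⋆`, and `pick` selects one of them for
every `w` that has any. -/
noncomputable def matchHeavy (G : SimpleGraph V) (pick : (V → Finset V) → PMF (V → V))
    (H F : Finset V) : PMF (Finset (Sym2 V)) :=
  (indep fun v => uniformOr (nbrs G H v) v).bind fun star =>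
  (indep fun _ : V => coin (1 / 2)).bind fun red =>
  let A : V → Finset V := fun w =>
    F.filter fun v => red v = true ∧ star v = w ∧ w ∈ H ∧ red w = false
  (pick A).map fun f =>
    (Finset.univ.filter fun w => (A w).Nonempty).image fun w => s(f w, w)

/-- One phase of the global algorithm on `G[W]` with threshold `Δ`. -/
noncomputable def globalPhase (G : SimpleGraph V) (pick : (V → Finset V) → PMF (V → V))
    (Δ : ℝ) (W : Finset V) : PMF (Finset V × Finset (Sym2 V)) :=
  let H : Finset V := W.filter fun v => Δ / 2 ≤ ((nbrs G W v).card : ℝ)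
  (randomSubset W fun v => ((nbrs G H v).card : ℝ) / (4 * Δ)).bind fun F =>
  (matchHeavy G pick H F).map fun M => (W \ (H ∪ F), M)

/-- The state of the global algorithm on `G[W]` after `k` phases, where `Δ` starts at `D`. -/
noncomputable def globalState (G : SimpleGraph V) (pick : (V → Finset V) → PMF (V → V))
    (D : ℝ) (W : Finset V) : ℕ → PMF (Finset V × Finset (Sym2 V))
  | 0 => PMF.pure (W, ∅)
  | k + 1 => (globalState G pick D W k).bind fun s =>
      (globalPhase G pick (D / 2 ^ k) s.1).map fun t => (t.1, s.2 ∪ t.2)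

/-- `GlobalAlg(G[W], D)`. -/
noncomputable def globalAlg (G : SimpleGraph V) (pick : (V → Finset V) → PMF (V → V))
    (D : ℝ) (W : Finset V) : PMF (Finset (Sym2 V)) :=
  (globalState G pick D W (numGlobalPhases D)).map Prod.snd

/-- `LocalPhase` on `G[W]` with threshold `Δ`; the subroutine `mm` computes a maximal matching in
the subgraph induced by the set that it is given. -/
noncomputable def localPhase (b : ℝ) (G : SimpleGraph V) (mm : Finset V → PMF (Finset (Sym2 V)))
    (Δ : ℝ) (W : Finset V) : PMF (Finset V × Finset (Sym2 V)) :=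
  (randomSubset W fun _ => muR b (Fintype.card V)).bind fun R =>
  (randomSubset W fun v =>
    muH (Fintype.card V) ((nbrs G R v).card / muR b (Fintype.card V) / Δ)).bind fun H =>
  (randomSubset W fun v => muF ((nbrs G H v).card / Δ)).bind fun F =>
  (mm (H ∪ F)).map fun M => (W \ (R ∪ H ∪ F), M)

/-- `j` consecutive executions of `LocalPhase` on one machine, starting from the vertex set `W`, with
thresholds `Δ / m`, `Δ / (2 m)`, …, `Δ / (2^(j-1) m)`. -/
noncomputable def localRun (b : ℝ) (G : SimpleGraph V) (mm : Finset V → PMF (Finset (Sym2 V)))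
    (m : ℕ) (Δ : ℝ) (W : Finset V) : ℕ → PMF (Finset V × Finset (Sym2 V))
  | 0 => PMF.pure (W, ∅)
  | j + 1 => (localRun b G mm m Δ W j).bind fun s =>
      (localPhase b G mm (Δ / (2 ^ j * m)) s.1).map fun t => (t.1, s.2 ∪ t.2)

open Classical in
/-- The check whether the subgraph fits onto a machine: `W` is replaced by `∅` if `G[W]` has more
than `8 S` edges. -/
noncomputable def sizeCheck (G : SimpleGraph V) (S : ℕ) (W : Finset V) : Finset V :=
  if 8 * S < (inducedOn G W).edgeSet.ncard then ∅ else W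

/-- One iteration of the main loop, with the current threshold `Δ`: the remaining vertices are
assigned to `m` machines independently and uniformly at random, and the machines work independently
of each other. (The number `m` is positive whenever the loop is entered.) -/
noncomputable def mainIteration (b : ℝ) (G : SimpleGraph V)
    (mm : Finset V → PMF (Finset (Sym2 V))) (S : ℕ) (Δ : ℝ)
    (s : Finset V × Finset (Sym2 V)) : PMF (Finset V × Finset (Sym2 V)) :=
  let m := numMachines (Fintype.card V) S Δ
  let τ := numPhases (Fintype.card V) S Δ
  if hm : 0 < m then
    haveI : Nonempty (Fin m) := ⟨⟨0, hm⟩⟩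
    (indep fun _ : V => PMF.uniformOfFintype (Fin m)).bind fun φ =>
    (indep fun i : Fin m =>
      localRun b G mm m Δ (sizeCheck G S (s.1.filter fun v => φ v = i)) τ).map fun r =>
    (Finset.univ.biUnion fun i => (r i).1, s.2 ∪ Finset.univ.biUnion fun i => (r i).2)
  else PMF.pure s

/-- The state after `k` iterations of the main loop. -/
noncomputable def mainState (b : ℝ) (G : SimpleGraph V)
    (mm : Finset V → PMF (Finset (Sym2 V))) (S : ℕ) : ℕ → PMF (Finset V × Finset (Sym2 V))
  | 0 => PMF.pure (Finset.univ, ∅)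
  | k + 1 => (mainState b G mm S k).bind
      (mainIteration b G mm S (threshold (Fintype.card V) S k))

/-- `ParallelAlg(G, S)`: the law of the returned set of edges. -/
noncomputable def parallelAlg (b : ℝ) (G : SimpleGraph V)
    (mm : Finset V → PMF (Finset (Sym2 V))) (pick : (V → Finset V) → PMF (V → V))
    (S : ℕ) : PMF (Finset (Sym2 V)) :=
  let K := numIterations (Fintype.card V) S
  let Δ := threshold (Fintype.card V) S K
  (mainState b G mm S K).bind fun s =>
  (globalAlg G pick (2 * Δ)
    (s.1.filter fun v => ((nbrs G s.1 v).card : ℝ) < 2 * Δ)).map fun M' => s.2 ∪ M'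

end Algorithms

end RoundCompression

/-! The proof bounds the expected size of the output and then reverses Markov's inequality. Let N be
a maximum matching and T the set of its 2|N| endpoints. The potential of a state is the number of
collected edges plus |T ∩ W| / 200, where W is the set of the remaining vertices.

Consider a phase in a graph of maximum degree at most 2Δ that removes a set H of vertices of degree
at least Δ/4, and friends F selected with probabilities |N(v) ∩ H| / (4Δ). MatchHeavy finds at least
|H|/66 edges in expectation (`le_ev_friends_matchHeavy_card`), while E|H ∪ F| ≤ 3|H|/2
(`ev_friends_card_le`). A maximal matching of G[H ∪ F] has at least half the size of any matching
there, so a local phase gains at least |H|/132 ≥ (3|H|/2)/200, and the potential does not drop. Only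
the reference sets R are lost without return. Each costs a fraction μ_R of T, and the main loop has
at most log₂ n phases, so at most |T|/8 is lost in this way. The global algorithm ends with an
edgeless set, which holds at most |N| of the 2|N| points of T. This gives an expected size of at
least |N|/400 (`le_ev_parallelAlg`); as the output never exceeds |N|, it is at least |N|/800 with
probability at least 1/800.

The heart of the proof is that local phases satisfy the degree hypotheses with high probability. The
partition is drawn only once for many phases, so the later vertex sets on a machine are not fresh
random samples. They are compared with a deterministic recursion on the whole vertex set
(`MeanField`) for the probabilities s, h and f of surviving, of being heavy and of being a friend.
The invariant `MeanField.Tracked` looks ahead: for every current or future phase k, the neighbours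
of v on the machine, weighted by their mean-field probability of surviving until phase k, add up to
about 1/m of the mean-field total. Taking k to be the current phase shows that the actual selection
probabilities are close to h and f, because μ_H and μ_F are Lipschitz. Taking later k and removing
R, H and F in turn, with a Chernoff bound for each, gives the invariant for the next phase
(`MeanField.Tracked.succ`). The relative error is allowed to grow by the factor 120α per phase, and
τ is so small that it stays below 1/64.

Vertices whose mean-field degree exceeds 3/4 of the threshold almost surely enter H. Hence the
survivors have mean-field degree at most 3/2 of the halved threshold, and summing over the machines
restores the degree bound for the next iteration (`MeanField.degreeBound`). -/

namespace RoundCompression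

/-! ### Expectations and probabilities in finite random experiments -/

section Expectation

variable {α β γ : Type*} [Fintype α] [Fintype β] [Fintype γ]

/-- The expectation of `f` under `p`. -/
noncomputable def ev (p : PMF α) (f : α → ℝ) : ℝ := ∑ a, (p a).toReal * f a

open Classical in
/-- The probability of the event `P` under `p`. -/
noncomputable def pr (p : PMF α) (P : α → Prop) : ℝ := ev p fun a => if P a then 1 else 0

theorem pr_eq_ev (p : PMF α) (P : α → Prop) [DecidablePred P] :
    pr p P = ev p fun a => if P a then 1 else 0 := by
  refine Finset.sum_congr rfl fun a _ => ?_
  by_cases h : P a <;> simp [h]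

theorem sum_toReal_eq_one (p : PMF α) : ∑ a, (p a).toReal = 1 := by
  rw [← ENNReal.toReal_sum fun a _ => p.apply_ne_top a,
    ← tsum_fintype (L := .unconditional _), p.tsum_coe, ENNReal.toReal_one]

theorem ev_const (p : PMF α) (c : ℝ) : ev p (fun _ => c) = c := by
  rw [ev, ← Finset.sum_mul, sum_toReal_eq_one, one_mul]

theorem ev_add (p : PMF α) (f g : α → ℝ) : ev p (fun a => f a + g a) = ev p f + ev p g := by
  simp only [ev, mul_add, Finset.sum_add_distrib]

theorem ev_sub (p : PMF α) (f g : α → ℝ) : ev p (fun a => f a - g a) = ev p f - ev p g := by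
  simp only [ev, mul_sub, Finset.sum_sub_distrib]

theorem ev_const_add (p : PMF α) (c : ℝ) (f : α → ℝ) : ev p (fun a => c + f a) = c + ev p f := by
  rw [ev_add, ev_const]

theorem ev_add_const (p : PMF α) (f : α → ℝ) (c : ℝ) : ev p (fun a => f a + c) = ev p f + c := by
  rw [ev_add, ev_const]

theorem ev_const_mul (p : PMF α) (c : ℝ) (f : α → ℝ) : ev p (fun a => c * f a) = c * ev p f := by
  simp only [ev, Finset.mul_sum]
  exact Finset.sum_congr rfl fun _ _ => by ring

theorem ev_sum {ι : Type*} (p : PMF α) (s : Finset ι) (f : ι → α → ℝ) :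
    ev p (fun a => ∑ i ∈ s, f i a) = ∑ i ∈ s, ev p (f i) := by
  simp only [ev, Finset.mul_sum]
  exact Finset.sum_comm

/-- Comparing only on the support is how facts that hold with certainty, such as the disjointness of
collected edges, enter expectations. -/
theorem ev_mono_support (p : PMF α) {f g : α → ℝ} (h : ∀ a ∈ p.support, f a ≤ g a) :
    ev p f ≤ ev p g := by
  refine Finset.sum_le_sum fun a _ => ?_
  by_cases ha : a ∈ p.support
  · exact mul_le_mul_of_nonneg_left (h a ha) ENNReal.toReal_nonneg
  · rw [PMF.mem_support_iff, not_not] at ha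
    simp [ha]

theorem ev_congr_support (p : PMF α) {f g : α → ℝ} (h : ∀ a ∈ p.support, f a = g a) :
    ev p f = ev p g :=
  (ev_mono_support p fun a ha => (h a ha).le).antisymm
    (ev_mono_support p fun a ha => (h a ha).ge)

theorem ev_mono (p : PMF α) {f g : α → ℝ} (h : ∀ a, f a ≤ g a) : ev p f ≤ ev p g :=
  ev_mono_support p fun a _ => h a

theorem ev_nonneg (p : PMF α) {f : α → ℝ} (h : ∀ a, 0 ≤ f a) : 0 ≤ ev p f :=
  Finset.sum_nonneg fun a _ => mul_nonneg ENNReal.toReal_nonneg (h a)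

theorem ev_pure (a : α) (f : α → ℝ) : ev (PMF.pure a) f = f a := by
  classical
  rw [ev, Finset.sum_eq_single a]
  · simp
  · intro b _ hb
    simp [PMF.pure_apply, hb]
  · simp

theorem ev_bind (p : PMF α) (q : α → PMF β) (f : β → ℝ) :
    ev (p.bind q) f = ev p fun a => ev (q a) f := by
  have h : ∀ b, ((p.bind q) b).toReal = ∑ a, (p a).toReal * (q a b).toReal := by
    intro b
    rw [PMF.bind_apply, tsum_fintype, ENNReal.toReal_sum]
    · simp only [ENNReal.toReal_mul]
    · exact fun a _ => ENNReal.mul_ne_top (p.apply_ne_top a) ((q a).apply_ne_top b)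
  simp only [ev, h, Finset.sum_mul, Finset.mul_sum]
  rw [Finset.sum_comm]
  exact Finset.sum_congr rfl fun _ _ => Finset.sum_congr rfl fun _ _ => by ring

theorem ev_map (p : PMF α) (g : α → β) (f : β → ℝ) : ev (p.map g) f = ev p fun a => f (g a) := by
  rw [← PMF.bind_pure_comp, ev_bind]
  simp only [Function.comp_apply, ev_pure]

theorem pr_nonneg (p : PMF α) (P : α → Prop) : 0 ≤ pr p P :=
  ev_nonneg p fun a => by split_ifs <;> norm_num

theorem pr_mono_support (p : PMF α) {P Q : α → Prop} (h : ∀ a ∈ p.support, P a → Q a) :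
    pr p P ≤ pr p Q := by
  refine ev_mono_support p fun a ha => ?_
  by_cases hP : P a
  · simp [hP, h a ha hP]
  · rw [if_neg hP]
    split_ifs <;> norm_num

theorem pr_mono (p : PMF α) {P Q : α → Prop} (h : ∀ a, P a → Q a) : pr p P ≤ pr p Q :=
  pr_mono_support p fun a _ => h a

theorem pr_le_one (p : PMF α) (P : α → Prop) : pr p P ≤ 1 :=
  (ev_mono p fun a => by split_ifs <;> norm_num).trans_eq (ev_const p 1)

theorem pr_or_le (p : PMF α) (P Q : α → Prop) : pr p (fun a => P a ∨ Q a) ≤ pr p P + pr p Q := by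
  rw [pr, pr, pr, ← ev_add]
  refine ev_mono p fun a => ?_
  by_cases hP : P a <;> by_cases hQ : Q a <;> simp [hP, hQ]

theorem pr_exists_le {ι : Type*} (p : PMF α) (s : Finset ι) (P : ι → α → Prop) :
    pr p (fun a => ∃ i ∈ s, P i a) ≤ ∑ i ∈ s, pr p (P i) := by
  classical
  simp only [pr_eq_ev]
  rw [← ev_sum]
  refine ev_mono p fun a => ?_
  split_ifs with h
  · obtain ⟨i, hi, hP⟩ := h
    have := Finset.single_le_sum (f := fun i => if P i a then (1 : ℝ) else 0)
      (fun i _ => by split_ifs <;> norm_num) hi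
    simpa [hP] using this
  · exact Finset.sum_nonneg fun i _ => by split_ifs <;> norm_num

/-- A union bound over the elements of a finite type. -/
theorem pr_exists_fintype_le {ι : Type*} [Fintype ι] (p : PMF α) (P : ι → α → Prop) {ε : ℝ}
    (h : ∀ i, pr p (P i) ≤ ε) : pr p (fun a => ∃ i, P i a) ≤ Fintype.card ι * ε := by
  calc pr p (fun a => ∃ i, P i a) ≤ pr p (fun a => ∃ i ∈ Finset.univ, P i a) :=
        pr_mono p fun a ⟨i, hi⟩ => ⟨i, Finset.mem_univ i, hi⟩
    _ ≤ ∑ i, pr p (P i) := pr_exists_le p _ P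
    _ ≤ ∑ _i : ι, ε := Finset.sum_le_sum fun i _ => h i
    _ = Fintype.card ι * ε := by simp [Finset.card_univ]

/-- A union bound for the failure of one of finitely many properties. -/
theorem pr_not_forall_le {ι : Type*} [Fintype ι] (p : PMF α) (C : ι → Prop) (E : ι → α → Prop)
    {ε : ℝ} (hε : 0 ≤ ε) (h : ∀ i, C i → pr p (fun a => ¬ E i a) ≤ ε) :
    pr p (fun a => ¬ ∀ i, C i → E i a) ≤ Fintype.card ι * ε := by
  refine (pr_mono p (Q := fun a => ∃ i, C i ∧ ¬ E i a) fun a ha => by push Not at ha; exact ha).trans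
    (pr_exists_fintype_le p _ fun i => ?_)
  by_cases hC : C i
  · exact (pr_mono p fun a ha => ha.2).trans (h i hC)
  · exact (pr_mono_support p (Q := fun _ => False) fun a _ ha => hC ha.1).trans
      (by rw [pr]; simp [ev_const, hε])

theorem pr_not_and_le (p : PMF α) (P Q : α → Prop) :
    pr p (fun a => ¬ (P a ∧ Q a)) ≤ pr p (fun a => ¬ P a) + pr p (fun a => ¬ Q a) :=
  (pr_mono p fun _ h => not_and_or.1 h).trans (pr_or_le p _ _)

theorem pr_map (p : PMF α) (g : α → β) (P : β → Prop) :
    pr (p.map g) P = pr p fun a => P (g a) := by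
  rw [pr, ev_map, pr]

theorem pr_eq_zero (p : PMF α) {P : α → Prop} (h : ∀ a ∈ p.support, ¬ P a) : pr p P = 0 := by
  refine le_antisymm ?_ (pr_nonneg p P)
  calc pr p P ≤ ev p (fun _ => 0) := ev_mono_support p fun a ha => by simp [h a ha]
    _ = 0 := ev_const p 0

/-- The probability of failure of a two-stage experiment. -/
theorem pr_bind_le (p : PMF α) (q : α → PMF β) (P : α → Prop) (Q : β → Prop) {δ ε : ℝ}
    (hε : 0 ≤ ε) (hP : pr p (fun a => ¬ P a) ≤ δ)
    (hQ : ∀ a ∈ p.support, P a → pr (q a) (fun b => ¬ Q b) ≤ ε) :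
    pr (p.bind q) (fun b => ¬ Q b) ≤ δ + ε := by
  classical
  rw [pr, ev_bind]
  calc _ ≤ ev p (fun a => (if ¬ P a then 1 else 0) + ε) := by
        refine ev_mono_support p fun a ha => ?_
        change pr (q a) (fun b => ¬ Q b) ≤ _
        by_cases h : P a
        · simpa [h] using hQ a ha h
        · have := pr_le_one (q a) fun b => ¬ Q b
          rw [if_pos h]
          linarith
    _ ≤ δ + ε := by
        rw [ev_add, ev_const, ← pr_eq_ev]
        exact add_le_add_left hP ε

/-- Markov's inequality. -/
theorem pr_lt_le (p : PMF α) {f : α → ℝ} (hf : ∀ a, 0 ≤ f a) {c : ℝ} (hc : 0 < c) :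
    pr p (fun a => c < f a) ≤ ev p f / c := by
  rw [le_div_iff₀' hc, pr, ← ev_const_mul]
  refine ev_mono p fun a => ?_
  split_ifs with h
  · linarith
  · simpa using hf a

theorem ofReal_pr (p : PMF α) (P : α → Prop) :
    ENNReal.ofReal (pr p P) = p.toOuterMeasure {a | P a} := by
  classical
  rw [PMF.toOuterMeasure_apply_fintype, pr, ev, ENNReal.ofReal_sum_of_nonneg]
  · refine Finset.sum_congr rfl fun a _ => ?_
    by_cases h : P a
    · simp [h, ENNReal.ofReal_toReal (p.apply_ne_top a)]
    · simp [h]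
  · exact fun a _ => mul_nonneg ENNReal.toReal_nonneg (by split_ifs <;> norm_num)

/-- A nonnegative quantity bounded by `B` with large expectation is often large. -/
theorem le_pr_of_le_ev (p : PMF α) {f : α → ℝ} {P : α → Prop} {a B : ℝ} (ha : 0 ≤ a)
    (hB : ∀ x ∈ p.support, f x ≤ B) (hP : ∀ x ∈ p.support, a ≤ f x → P x) :
    ev p f ≤ B * pr p P + a := by
  classical
  have hb : ev p f ≤ ev p (fun x => B * (if P x then 1 else 0) + a) := by
    refine ev_mono_support p fun x hx => ?_
    by_cases h : P x
    · have := hB x hx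
      simp only [h, if_true]
      linarith
    · have : f x < a := not_le.1 fun h' => h (hP x hx h')
      simp only [h, if_false]
      linarith
  rwa [ev_add, ev_const, ev_const_mul, ← pr_eq_ev] at hb

end Expectation

/-! ### Independent families -/

section Independence

variable {ι α : Type*} [Fintype ι] [DecidableEq ι] [Fintype α]

theorem indep_apply_toReal (p : ι → PMF α) (x : ι → α) :
    (indep p x).toReal = ∏ i, (p i (x i)).toReal := by
  rw [← ENNReal.toReal_prod]
  rfl

theorem ev_indep_prod (p : ι → PMF α) (f : ι → α → ℝ) :
    ev (indep p) (fun x => ∏ i, f i (x i)) = ∏ i, ev (p i) (f i) := by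
  simp only [ev, indep_apply_toReal, ← Finset.prod_mul_distrib]
  rw [Finset.prod_univ_sum, Fintype.piFinset_univ]

theorem ev_indep_prod_finset (p : ι → PMF α) (s : Finset ι) (f : ι → α → ℝ) :
    ev (indep p) (fun x => ∏ i ∈ s, f i (x i)) = ∏ i ∈ s, ev (p i) (f i) := by
  have h := ev_indep_prod p fun i a => if i ∈ s then f i a else 1
  have h1 : ∀ i, ev (p i) (fun a => if i ∈ s then f i a else 1)
      = if i ∈ s then ev (p i) (f i) else 1 := by
    intro i
    by_cases hi : i ∈ s
    · simp [hi]
    · simp [hi, ev_const]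
  simpa only [h1, Finset.prod_ite_mem, Finset.univ_inter] using h

theorem ev_indep_coord (p : ι → PMF α) (i : ι) (f : α → ℝ) :
    ev (indep p) (fun x => f (x i)) = ev (p i) f := by
  simpa using ev_indep_prod_finset p {i} fun _ => f

theorem pr_indep_coord (p : ι → PMF α) (i : ι) (P : α → Prop) :
    pr (indep p) (fun x => P (x i)) = pr (p i) P := by
  classical
  simp only [pr_eq_ev]
  exact ev_indep_coord p i fun a => if P a then 1 else 0

theorem mem_support_of_mem_support_indep {p : ι → PMF α} {x : ι → α}
    (hx : x ∈ (indep p).support) (i : ι) : x i ∈ (p i).support := by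
  rw [PMF.mem_support_iff] at hx ⊢
  intro h
  exact hx (Finset.prod_eq_zero (Finset.mem_univ i) h)

end Independence

/-! ### Concentration -/

section Chernoff

-- By 1 + x ≤ exp x and exp z - 1 - z ≤ z² for |z| ≤ 1. The exponent is proportional to the mean and
-- not to the number of trials, which is what makes the bound useful for sets as sparse as R.
open Classical in
theorem ev_exp_indicator_le {α : Type*} [Fintype α] (p : PMF α) (A : α → Prop) {z : ℝ}
    (hz : |z| ≤ 1) :
    ev p (fun a => Real.exp (z * ((if A a then 1 else 0) - pr p A)))
      ≤ Real.exp (z ^ 2 * pr p A) := by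
  set q := pr p A with hq
  have h1 : ∀ a, Real.exp (z * ((if A a then 1 else 0) - q))
      = Real.exp (-(z * q)) * (1 + (Real.exp z - 1) * (if A a then 1 else 0)) := by
    intro a
    split_ifs
    · rw [show z * (1 - q) = -(z * q) + z by ring, Real.exp_add]
      ring
    · rw [show z * (0 - q) = -(z * q) by ring]
      ring
  have h2 : ev p (fun a => Real.exp (z * ((if A a then 1 else 0) - q)))
      = Real.exp (-(z * q)) * (1 + (Real.exp z - 1) * q) := by
    simp only [h1]
    rw [ev_const_mul, ev_add, ev_const, ev_const_mul]
    rfl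
  rw [h2]
  have h3 : 1 + (Real.exp z - 1) * q ≤ Real.exp ((Real.exp z - 1) * q) := by
    rw [add_comm]
    exact Real.add_one_le_exp _
  calc _ ≤ Real.exp (-(z * q)) * Real.exp ((Real.exp z - 1) * q) :=
        mul_le_mul_of_nonneg_left h3 (Real.exp_nonneg _)
    _ = Real.exp ((Real.exp z - 1 - z) * q) := by
        rw [← Real.exp_add]
        ring_nf
    _ ≤ Real.exp (z ^ 2 * q) := by
        apply Real.exp_le_exp.2
        apply mul_le_mul_of_nonneg_right _ (pr_nonneg p A)
        exact (le_abs_self _).trans (Real.abs_exp_sub_one_sub_id_le hz)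

variable {ι α : Type*} [Fintype ι] [DecidableEq ι] [Fintype α]

-- Independence turns the exponential into a product, and g² ≤ g absorbs the weights into the mean,
-- so any upper bound M of the mean may stand in the exponent.
open Classical in
theorem ev_exp_sum_le (p : ι → PMF α) (A : ι → α → Prop) (Y : Finset ι) {g : ι → ℝ}
    (hg : ∀ i ∈ Y, 0 ≤ g i ∧ g i ≤ 1) {M l : ℝ} (hM : ∑ i ∈ Y, pr (p i) (A i) * g i ≤ M)
    (hl : |l| ≤ 1) :
    ev (indep p) (fun x => Real.exp (l * (∑ i ∈ Y, (if A i (x i) then g i else 0)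
      - ∑ i ∈ Y, pr (p i) (A i) * g i))) ≤ Real.exp (l ^ 2 * M) := by
  have h1 : ∀ x : ι → α, Real.exp (l * (∑ i ∈ Y, (if A i (x i) then g i else 0)
      - ∑ i ∈ Y, pr (p i) (A i) * g i))
      = ∏ i ∈ Y, Real.exp (l * g i * ((if A i (x i) then 1 else 0) - pr (p i) (A i))) := by
    intro x
    rw [← Real.exp_sum, ← Finset.sum_sub_distrib, Finset.mul_sum]
    congr 1
    refine Finset.sum_congr rfl fun i _ => ?_
    split_ifs <;> ring
  simp only [h1]
  rw [ev_indep_prod_finset p Y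
    fun i a => Real.exp (l * g i * ((if A i a then 1 else 0) - pr (p i) (A i)))]
  calc _ ≤ ∏ i ∈ Y, Real.exp (l ^ 2 * (pr (p i) (A i) * g i)) := by
        refine Finset.prod_le_prod (fun i _ => ev_nonneg _ fun a => Real.exp_nonneg _) fun i hi => ?_
        obtain ⟨h0, h1⟩ := hg i hi
        refine (ev_exp_indicator_le (p i) (A i) ?_).trans (Real.exp_le_exp.2 ?_)
        · rw [abs_mul, abs_of_nonneg h0]
          exact mul_le_one₀ hl h0 h1
        · have := pr_nonneg (p i) (A i)
          have h2 : g i ^ 2 ≤ g i := by nlinarith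
          have h3 := mul_le_mul_of_nonneg_left h2 (mul_nonneg (sq_nonneg l) this)
          linarith [h3, mul_pow l (g i) 2]
    _ = Real.exp (l ^ 2 * ∑ i ∈ Y, pr (p i) (A i) * g i) := by
        rw [← Real.exp_sum, Finset.mul_sum]
    _ ≤ _ := Real.exp_le_exp.2 (mul_le_mul_of_nonneg_left hM (sq_nonneg l))

open Classical in
/-- A Chernoff bound for weighted sums of independent indicators. -/
theorem chernoff (p : ι → PMF α) (A : ι → α → Prop) (Y : Finset ι) {g : ι → ℝ}
    (hg : ∀ i ∈ Y, 0 ≤ g i ∧ g i ≤ 1) {M l : ℝ} (hM : ∑ i ∈ Y, pr (p i) (A i) * g i ≤ M)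
    (hl : 0 ≤ l) (hl1 : l ≤ 1) :
    pr (indep p) (fun x => ¬ |∑ i ∈ Y, (if A i (x i) then g i else 0)
      - ∑ i ∈ Y, pr (p i) (A i) * g i| ≤ 2 * l * M) ≤ 2 * Real.exp (-(l ^ 2 * M)) := by
  set D : (ι → α) → ℝ := fun x => ∑ i ∈ Y, (if A i (x i) then g i else 0)
      - ∑ i ∈ Y, pr (p i) (A i) * g i with hD
  -- Markov's inequality for the exponential at level 2l²M leaves the exponent l²M - 2l²M. Only the
  -- square of l' matters, so l' = l and l' = -l give the two tails.
  have tail : ∀ l' : ℝ, |l'| ≤ 1 → l' ^ 2 = l ^ 2 →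
      pr (indep p) (fun x => 2 * l ^ 2 * M < l' * D x) ≤ Real.exp (-(l ^ 2 * M)) := by
    intro l' h1 h2
    have h3 := ev_exp_sum_le p A Y hg hM h1
    calc _ ≤ pr (indep p) (fun x => Real.exp (2 * l ^ 2 * M) < Real.exp (l' * D x)) :=
          pr_mono _ fun x hx => Real.exp_lt_exp.2 hx
      _ ≤ ev (indep p) (fun x => Real.exp (l' * D x)) / Real.exp (2 * l ^ 2 * M) :=
          pr_lt_le _ (fun _ => Real.exp_nonneg _) (Real.exp_pos _)
      _ ≤ Real.exp (l' ^ 2 * M) / Real.exp (2 * l ^ 2 * M) := by gcongr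
      _ = Real.exp (-(l ^ 2 * M)) := by
          rw [← Real.exp_sub, h2]
          ring_nf
  -- For l = 0 the bound is 2. Otherwise the deviation may be multiplied by l to match the form of
  -- the tails.
  rcases hl.eq_or_lt with rfl | hpos
  · refine (pr_le_one _ _).trans ?_
    simp
  calc _ ≤ pr (indep p) (fun x => 2 * l ^ 2 * M < l * D x ∨ 2 * l ^ 2 * M < (-l) * D x) := by
        refine pr_mono _ fun x hx => ?_
        rw [not_le, lt_abs] at hx
        rcases hx with hx | hx
        · left
          nlinarith [mul_lt_mul_of_pos_left hx hpos]
        · right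
          nlinarith [mul_lt_mul_of_pos_left hx hpos]
    _ ≤ Real.exp (-(l ^ 2 * M)) + Real.exp (-(l ^ 2 * M)) :=
        (pr_or_le _ _ _).trans (add_le_add
          (tail l (by rw [abs_of_pos hpos]; exact hl1) rfl)
          (tail (-l) (by rw [abs_neg, abs_of_pos hpos]; exact hl1) (by ring)))
    _ = _ := by ring

end Chernoff

/-! ### Random subsets -/

section RandomSubset

theorem coin_true_toReal {q : ℝ} (h0 : 0 ≤ q) (h1 : q ≤ 1) : (coin q true).toReal = q := by
  change (ENNReal.ofReal (min q 1)).toReal = q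
  rw [min_eq_left h1, ENNReal.toReal_ofReal h0]

theorem ev_coin {q : ℝ} (h0 : 0 ≤ q) (h1 : q ≤ 1) (f : Bool → ℝ) :
    ev (coin q) f = q * f true + (1 - q) * f false := by
  have h := sum_toReal_eq_one (coin q)
  rw [Fintype.sum_bool, coin_true_toReal h0 h1] at h
  rw [ev, Fintype.sum_bool, coin_true_toReal h0 h1, ← h]
  ring

theorem pr_coin {q : ℝ} (h0 : 0 ≤ q) (h1 : q ≤ 1) : pr (coin q) (fun x => x = true) = q := by
  rw [pr, ev_coin h0 h1]
  simp

variable {V : Type*} [Fintype V] [DecidableEq V]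

theorem randomSubset_subset {W : Finset V} {p : V → ℝ} {X : Finset V}
    (hX : X ∈ (randomSubset W p).support) : X ⊆ W := by
  rw [randomSubset, PMF.support_map] at hX
  obtain ⟨x, -, rfl⟩ := hX
  exact Finset.filter_subset _ _

theorem ev_randomSubset (W : Finset V) (p : V → ℝ) (f : Finset V → ℝ) :
    ev (randomSubset W p) f
      = ev (indep fun v => coin (p v)) fun x => f (W.filter fun v => x v = true) := by
  rw [randomSubset, ev_map]

theorem pr_randomSubset (W : Finset V) (p : V → ℝ) (P : Finset V → Prop) :
    pr (randomSubset W p) P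
      = pr (indep fun v => coin (p v)) fun x => P (W.filter fun v => x v = true) := by
  rw [randomSubset, pr_map]

theorem pr_mem_randomSubset {W : Finset V} {p : V → ℝ} {v : V} (hv : v ∈ W) (h0 : 0 ≤ p v)
    (h1 : p v ≤ 1) : pr (randomSubset W p) (fun X => v ∈ X) = p v := by
  rw [pr_randomSubset]
  simp only [Finset.mem_filter, hv, true_and]
  rw [pr_indep_coord (fun v => coin (p v)) v fun x => x = true, pr_coin h0 h1]

theorem pr_notMem_randomSubset {W : Finset V} {p : V → ℝ} {v : V} (hv : v ∈ W) (h0 : 0 ≤ p v)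
    (h1 : p v ≤ 1) : pr (randomSubset W p) (fun X => v ∉ X) = 1 - p v := by
  rw [pr_randomSubset]
  simp only [Finset.mem_filter, hv, true_and]
  rw [pr_indep_coord (fun v => coin (p v)) v fun x => ¬ x = true, pr, ev_coin h0 h1]
  simp

theorem ev_card_inter_randomSubset {W Y : Finset V} {p : V → ℝ} (hY : Y ⊆ W)
    (h0 : ∀ v ∈ W, 0 ≤ p v) (h1 : ∀ v ∈ W, p v ≤ 1) :
    ev (randomSubset W p) (fun X => ((Y ∩ X).card : ℝ)) = ∑ v ∈ Y, p v := by
  classical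
  have h : ∀ X : Finset V, ((Y ∩ X).card : ℝ) = ∑ v ∈ Y, if v ∈ X then 1 else 0 := by
    intro X
    simp
  simp only [h]
  rw [ev_sum]
  refine Finset.sum_congr rfl fun v hv => ?_
  rw [← pr_mem_randomSubset (hY hv) (h0 v (hY hv)) (h1 v (hY hv)), pr_eq_ev]

/-- Concentration of the weight of the part of `Y` that is selected. -/
theorem pr_randomSubset_inter {W Y : Finset V} {p g : V → ℝ} (hY : Y ⊆ W)
    (h0 : ∀ v ∈ W, 0 ≤ p v) (h1 : ∀ v ∈ W, p v ≤ 1) (hg : ∀ v, 0 ≤ g v ∧ g v ≤ 1) {M l : ℝ}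
    (hM : ∑ v ∈ Y, p v * g v ≤ M) (hl : 0 ≤ l) (hl1 : l ≤ 1) :
    pr (randomSubset W p) (fun X => ¬ |∑ v ∈ Y ∩ X, g v - ∑ v ∈ Y, p v * g v| ≤ 2 * l * M)
      ≤ 2 * Real.exp (-(l ^ 2 * M)) := by
  rw [pr_randomSubset]
  have hc : ∑ v ∈ Y, pr (coin (p v)) (fun x => x = true) * g v = ∑ v ∈ Y, p v * g v :=
    Finset.sum_congr rfl fun v hv => by rw [pr_coin (h0 v (hY hv)) (h1 v (hY hv))]
  have h := chernoff (fun v => coin (p v)) (fun _ x => x = true) Y (g := g) (fun v _ => hg v)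
    (hc.trans_le hM) hl hl1
  rw [hc] at h
  refine le_trans (pr_mono _ fun x hx => ?_) h
  have he : Y ∩ W.filter (fun v => x v = true) = Y.filter fun v => x v = true := by
    ext v
    simp only [Finset.mem_filter, Finset.mem_inter]
    exact ⟨fun h => ⟨h.1, h.2.2⟩, fun h => ⟨h.1, hY h.1, h.2⟩⟩
  rw [he, Finset.sum_filter] at hx
  convert hx

/-- Concentration of the weight of the part of `Y` that is not selected. -/
theorem pr_randomSubset_sdiff {W Y : Finset V} {p g : V → ℝ} (hY : Y ⊆ W)
    (h0 : ∀ v ∈ W, 0 ≤ p v) (h1 : ∀ v ∈ W, p v ≤ 1) (hg : ∀ v, 0 ≤ g v ∧ g v ≤ 1) {M l : ℝ}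
    (hM : (Y.card : ℝ) ≤ M) (hl : 0 ≤ l) (hl1 : l ≤ 1) :
    pr (randomSubset W p) (fun X => ¬ |∑ v ∈ Y \ X, g v - ∑ v ∈ Y, (1 - p v) * g v| ≤ 2 * l * M)
      ≤ 2 * Real.exp (-(l ^ 2 * M)) := by
  have hM' : ∑ v ∈ Y, p v * g v ≤ M := by
    refine le_trans (Finset.sum_le_sum fun v hv => ?_)
      ((show ∑ v ∈ Y, (1 : ℝ) = Y.card by simp).trans_le hM)
    exact mul_le_one₀ (h1 v (hY hv)) (hg v).1 (hg v).2
  -- The selected and the unselected weights have a fixed sum, so their deviations are opposite to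
  -- each other.
  refine le_trans (pr_mono _ fun X hX => ?_) (pr_randomSubset_inter hY h0 h1 hg hM' hl hl1)
  have e1 : ∑ v ∈ Y ∩ X, g v + ∑ v ∈ Y \ X, g v = ∑ v ∈ Y, g v :=
    Finset.sum_inter_add_sum_sdiff Y X g
  have e2 : ∑ v ∈ Y, (1 - p v) * g v = ∑ v ∈ Y, g v - ∑ v ∈ Y, p v * g v := by
    rw [← Finset.sum_sub_distrib]
    exact Finset.sum_congr rfl fun v _ => by ring
  rwa [show ∑ v ∈ Y ∩ X, g v - ∑ v ∈ Y, p v * g v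
    = -(∑ v ∈ Y \ X, g v - ∑ v ∈ Y, (1 - p v) * g v) by rw [e2]; linarith, abs_neg]

end RandomSubset

/-! ### Neighbourhoods and matchings -/

section Matching

variable {V : Type*} {G : SimpleGraph V}

theorem mem_nbrs {W : Finset V} {u v : V} : u ∈ nbrs G W v ↔ u ∈ W ∧ G.Adj v u := by
  simp [nbrs]

theorem nbrs_subset (G : SimpleGraph V) (W : Finset V) (v : V) : nbrs G W v ⊆ W :=
  fun _ hu => (mem_nbrs.1 hu).1

theorem nbrs_mono {W W' : Finset V} (h : W ⊆ W') (v : V) : nbrs G W v ⊆ nbrs G W' v :=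
  fun _ hu => mem_nbrs.2 ⟨h (mem_nbrs.1 hu).1, (mem_nbrs.1 hu).2⟩

theorem nbrs_sdiff [DecidableEq V] (W X : Finset V) (v : V) :
    nbrs G (W \ X) v = nbrs G W v \ X := by
  ext u
  simp only [mem_nbrs, Finset.mem_sdiff]
  tauto

theorem nbrs_eq_inter [DecidableEq V] {W X : Finset V} (h : X ⊆ W) (v : V) :
    nbrs G X v = nbrs G W v ∩ X := by
  ext u
  simp only [mem_nbrs, Finset.mem_inter]
  exact ⟨fun hu => ⟨⟨h hu.1, hu.2⟩, hu.1⟩, fun hu => ⟨hu.2, hu.1.2⟩⟩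

theorem inducedOn_adj {W : Finset V} {u v : V} :
    (inducedOn G W).Adj u v ↔ G.Adj u v ∧ u ∈ W ∧ v ∈ W := by
  simp [inducedOn]

theorem isMatching_inducedOn {W : Finset V} {M : Finset (Sym2 V)} :
    IsMatching (inducedOn G W) M ↔ IsMatching G M ∧ ∀ e ∈ M, ∀ v ∈ e, v ∈ W := by
  have key : ∀ e : Sym2 V, e ∈ (inducedOn G W).edgeSet ↔ e ∈ G.edgeSet ∧ ∀ v ∈ e, v ∈ W := by
    intro e
    induction e with
    | _ a b => simp [inducedOn_adj]
  constructor
  · rintro ⟨h1, h2⟩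
    exact ⟨⟨fun e he => ((key e).1 (h1 e he)).1, h2⟩, fun e he => ((key e).1 (h1 e he)).2⟩
  · rintro ⟨⟨h1, h2⟩, h3⟩
    exact ⟨fun e he => (key e).2 ⟨h1 e he, h3 e he⟩, h2⟩

theorem Sym2.exists_mem (e : Sym2 V) : ∃ v, v ∈ e := by
  induction e with
  | _ a b => exact ⟨a, by simp⟩

theorem IsMatching.union [DecidableEq V] {M M' : Finset (Sym2 V)} (h : IsMatching G M)
    (h' : IsMatching G M') (hd : ∀ e ∈ M, ∀ e' ∈ M', ∀ v ∈ e, v ∉ e') : IsMatching G (M ∪ M') := by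
  refine ⟨fun e he => ?_, fun e he e' he' v hv hv' => ?_⟩
  · rcases Finset.mem_union.1 he with he | he
    exacts [h.1 e he, h'.1 e he]
  · rcases Finset.mem_union.1 he with he | he <;> rcases Finset.mem_union.1 he' with he' | he'
    exacts [h.2 e he e' he' v hv hv', (hd e he e' he' v hv hv').elim,
      (hd e' he' e he v hv' hv).elim, h'.2 e he e' he' v hv hv']

theorem isMatching_empty : IsMatching G ∅ := by
  simp [IsMatching]

/-- A maximal matching has at least half of the size of any matching. -/
theorem IsMaximalMatching.card_le [DecidableEq V] {M M' : Finset (Sym2 V)}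
    (hM : IsMaximalMatching G M) (hM' : IsMatching G M') : M'.card ≤ 2 * M.card := by
  -- Every edge of M' is charged to one of its endpoints that M covers. Different edges of M' are
  -- charged to different vertices, and M covers at most 2|M| vertices.
  have hex : ∀ e' ∈ M', ∃ v ∈ e', ∃ e ∈ M, v ∈ e := by
    intro e' he'
    by_contra! hcon
    have h1 : IsMatching G (M ∪ {e'}) := by
      refine hM.prop.union ⟨fun e he => ?_, fun e he e₂ he₂ _ _ _ => ?_⟩ fun e he e₂ he₂ v hv hv' => ?_
      · rw [Finset.mem_singleton.1 he]
        exact hM'.1 e' he'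
      · rw [Finset.mem_singleton.1 he, Finset.mem_singleton.1 he₂]
      · rw [Finset.mem_singleton.1 he₂] at hv'
        exact hcon v hv' e he hv
    have h2 : e' ∈ M := hM.le_of_ge h1 Finset.subset_union_left
      (Finset.mem_union_right _ (Finset.mem_singleton_self e'))
    obtain ⟨v, hv⟩ := Sym2.exists_mem e'
    exact hcon v hv e' h2 hv
  obtain rfl | ⟨e, -⟩ := M'.eq_empty_or_nonempty
  · simp
  have : Nonempty V := ⟨(Sym2.exists_mem e).choose⟩
  choose! f hf using hex
  calc M'.card ≤ (M.biUnion Sym2.toFinset).card := by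
        refine Finset.card_le_card_of_injOn f (fun e he => ?_) fun e he e' he' hee' => ?_
        · obtain ⟨-, e₂, he₂, hv⟩ := hf e he
          exact Finset.mem_biUnion.2 ⟨e₂, he₂, Sym2.mem_toFinset.2 hv⟩
        · exact hM'.2 e he e' he' (f e) (hf e he).1 (hee' ▸ (hf e' he').1)
    _ ≤ M.card * 2 := Finset.card_biUnion_le_card_mul _ _ _ fun e _ => by
        rw [Sym2.card_toFinset]
        split_ifs <;> norm_num
    _ = 2 * M.card := mul_comm _ _

theorem IsMatching.card_biUnion_inter [DecidableEq V] {M : Finset (Sym2 V)} (hM : IsMatching G M)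
    (W : Finset V) :
    (M.biUnion Sym2.toFinset ∩ W).card = ∑ e ∈ M, (e.toFinset ∩ W).card := by
  rw [Finset.biUnion_inter, Finset.card_biUnion]
  intro e he e' he' hne
  refine Finset.disjoint_left.2 fun v hv hv' => hne ?_
  rw [Finset.mem_inter, Sym2.mem_toFinset] at hv hv'
  exact hM.2 e he e' he' v hv.1 hv'.1

theorem IsMatching.card_biUnion [Fintype V] [DecidableEq V] {M : Finset (Sym2 V)}
    (hM : IsMatching G M) : (M.biUnion Sym2.toFinset).card = 2 * M.card := by
  have h := hM.card_biUnion_inter Finset.univ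
  simp only [Finset.inter_univ] at h
  rw [h, Finset.sum_congr rfl (g := fun _ => 2), Finset.sum_const, smul_eq_mul, mul_comm]
  intro e he
  exact Sym2.card_toFinset_of_not_isDiag e (G.not_isDiag_of_mem_edgeSet (hM.1 e he))

/-- A set that contains no edge contains at most one endpoint of every edge of a matching. -/
theorem IsMatching.card_biUnion_inter_le [DecidableEq V] {M : Finset (Sym2 V)}
    (hM : IsMatching G M) {W : Finset V} (hW : ∀ v ∈ W, nbrs G W v = ∅) :
    (M.biUnion Sym2.toFinset ∩ W).card ≤ M.card := by
  rw [hM.card_biUnion_inter, Finset.card_eq_sum_ones]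
  refine Finset.sum_le_sum fun e he => Finset.card_le_one.2 fun a ha b hb => ?_
  rw [Finset.mem_inter, Sym2.mem_toFinset] at ha hb
  by_contra hne
  have hadj : G.Adj a b := by
    have := hM.1 e he
    rwa [(Sym2.mem_and_mem_iff hne).1 ⟨ha.1, hb.1⟩, SimpleGraph.mem_edgeSet] at this
  have : b ∈ nbrs G W a := mem_nbrs.2 ⟨hb.2, hadj⟩
  rw [hW a ha.2] at this
  simp at this

/-- The state `s` is reached from the vertex set `W` by removing vertices and matching only removed
vertices. -/
def ReachedFrom (G : SimpleGraph V) (W : Finset V) (s : Finset V × Finset (Sym2 V)) : Prop :=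
  s.1 ⊆ W ∧ IsMatching G s.2 ∧ ∀ e ∈ s.2, ∀ v ∈ e, v ∈ W ∧ v ∉ s.1

theorem ReachedFrom.refl (W : Finset V) : ReachedFrom G W (W, ∅) :=
  ⟨subset_rfl, isMatching_empty, by simp⟩

theorem ReachedFrom.mono {W W' : Finset V} {s : Finset V × Finset (Sym2 V)}
    (h : ReachedFrom G W s) (hW : W ⊆ W') : ReachedFrom G W' s :=
  ⟨h.1.trans hW, h.2.1, fun e he v hv => ⟨hW (h.2.2 e he v hv).1, (h.2.2 e he v hv).2⟩⟩

/-- The earlier edges avoid the vertices that remain in s, whereas the later ones use only these, so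
no endpoint is shared. -/
theorem ReachedFrom.trans [DecidableEq V] {W : Finset V} {s t : Finset V × Finset (Sym2 V)}
    (hs : ReachedFrom G W s) (ht : ReachedFrom G s.1 t) : ReachedFrom G W (t.1, s.2 ∪ t.2) := by
  refine ⟨ht.1.trans hs.1, hs.2.1.union ht.2.1 fun e he e' he' v hv hv' =>
    (hs.2.2 e he v hv).2 (ht.2.2 e' he' v hv').1, fun e he v hv => ?_⟩
  rcases Finset.mem_union.1 he with he | he
  · exact ⟨(hs.2.2 e he v hv).1, fun h => (hs.2.2 e he v hv).2 (ht.1 h)⟩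
  · exact ⟨hs.1 (ht.2.2 e he v hv).1, (ht.2.2 e he v hv).2⟩

theorem ReachedFrom.card_union [DecidableEq V] {W : Finset V} {s t : Finset V × Finset (Sym2 V)}
    (hs : ReachedFrom G W s) (ht : ReachedFrom G s.1 t) :
    (s.2 ∪ t.2).card = s.2.card + t.2.card := by
  refine Finset.card_union_of_disjoint (Finset.disjoint_left.2 fun e he he' => ?_)
  obtain ⟨v, hv⟩ := Sym2.exists_mem e
  exact (hs.2.2 e he v hv).2 (ht.2.2 e he' v hv).1

/-! ### Machines that work on disjoint vertex sets -/

section Family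

variable [DecidableEq V] {ι : Type*} [Fintype ι] {U : Finset V} {W : ι → Finset V}
  {r : ι → Finset V × Finset (Sym2 V)}

theorem ReachedFrom.biUnion (hW : ∀ i j, i ≠ j → Disjoint (W i) (W j)) (hU : ∀ i, W i ⊆ U)
    (hr : ∀ i, ReachedFrom G (W i) (r i)) :
    ReachedFrom G U (Finset.univ.biUnion fun i => (r i).1, Finset.univ.biUnion fun i => (r i).2) := by
  have sep : ∀ i j v, v ∈ W i → v ∈ W j → i = j := fun i j v hi hj => by
    by_contra h
    exact Finset.disjoint_left.1 (hW i j h) hi hj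
  refine ⟨Finset.biUnion_subset.2 fun i _ => (hr i).1.trans (hU i), ⟨fun e he => ?_,
    fun e he e' he' v hv hv' => ?_⟩, fun e he v hv => ?_⟩
  · obtain ⟨i, -, hi⟩ := Finset.mem_biUnion.1 he
    exact (hr i).2.1.1 e hi
  · obtain ⟨i, -, hi⟩ := Finset.mem_biUnion.1 he
    obtain ⟨j, -, hj⟩ := Finset.mem_biUnion.1 he'
    obtain rfl := sep i j v ((hr i).2.2 e hi v hv).1 ((hr j).2.2 e' hj v hv').1
    exact (hr i).2.1.2 e hi e' hj v hv hv'
  · obtain ⟨i, -, hi⟩ := Finset.mem_biUnion.1 he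
    refine ⟨hU i ((hr i).2.2 e hi v hv).1, fun h => ?_⟩
    obtain ⟨j, -, hj⟩ := Finset.mem_biUnion.1 h
    obtain rfl := sep i j v ((hr i).2.2 e hi v hv).1 ((hr j).1 hj)
    exact ((hr i).2.2 e hi v hv).2 hj

theorem ReachedFrom.card_biUnion (hW : ∀ i j, i ≠ j → Disjoint (W i) (W j))
    (hr : ∀ i, ReachedFrom G (W i) (r i)) :
    (Finset.univ.biUnion fun i => (r i).2).card = ∑ i, (r i).2.card := by
  refine Finset.card_biUnion fun i _ j _ hij => Finset.disjoint_left.2 fun e he he' => ?_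
  obtain ⟨v, hv⟩ := Sym2.exists_mem e
  exact Finset.disjoint_left.1 (hW i j hij) ((hr i).2.2 e he v hv).1 ((hr j).2.2 e he' v hv).1

theorem ReachedFrom.card_inter_biUnion (hW : ∀ i j, i ≠ j → Disjoint (W i) (W j))
    (hr : ∀ i, ReachedFrom G (W i) (r i)) (T : Finset V) :
    (T ∩ Finset.univ.biUnion fun i => (r i).1).card = ∑ i, (T ∩ (r i).1).card := by
  rw [Finset.inter_biUnion]
  refine Finset.card_biUnion fun i _ j _ hij => ?_
  exact (hW i j hij).mono (Finset.inter_subset_right.trans (hr i).1)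
    (Finset.inter_subset_right.trans (hr j).1)

end Family

end Matching

/-! ### The matching found by `MatchHeavy` -/

section MatchHeavy

theorem mem_support_uniformOr {V : Type*} {W : Finset V} {d v : V}
    (h : v ∈ (uniformOr W d).support) : v ∈ W ∨ v = d := by
  unfold uniformOr at h
  split_ifs at h with hW
  · left
    simpa using h
  · right
    simpa using h

variable {V : Type*} [DecidableEq V] {G : SimpleGraph V}

/-- The red vertices `v` with `v⋆ = w` for a blue vertex `w`. -/
def redPreimage (H F : Finset V) (star : V → V) (red : V → Bool) (w : V) : Finset V :=
  F.filter fun v => red v = true ∧ star v = w ∧ w ∈ H ∧ red w = false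

variable [Fintype V]

/-- A chosen edge joins a red vertex v to the blue vertex `star v`. Its blue end determines it
through f, and its red end determines it because v has a single `star v`. The colours prevent a
vertex from playing both roles. -/
theorem isMatching_image_redPreimage {H F : Finset V} {star : V → V} {red : V → Bool} {f : V → V}
    (hstar : ∀ v, star v ∈ nbrs G H v ∨ star v = v)
    (hf : ∀ w, (redPreimage H F star red w).Nonempty → f w ∈ redPreimage H F star red w) :
    IsMatching (inducedOn G (H ∪ F))
      ((Finset.univ.filter fun w => (redPreimage H F star red w).Nonempty).image fun w => s(f w, w)) ∧
    ((Finset.univ.filter fun w => (redPreimage H F star red w).Nonempty).image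
      fun w => s(f w, w)).card
      = (Finset.univ.filter fun w => (redPreimage H F star red w).Nonempty).card := by
  have key : ∀ w, (redPreimage H F star red w).Nonempty →
      f w ∈ F ∧ red (f w) = true ∧ star (f w) = w ∧ w ∈ H ∧ red w = false := by
    intro w hw
    simpa [redPreimage] using hf w hw
  have share : ∀ w w', (redPreimage H F star red w).Nonempty →
      (redPreimage H F star red w').Nonempty → ∀ v, v ∈ s(f w, w) → v ∈ s(f w', w') → w = w' := by
    intro w w' hw hw' v hv hv'
    obtain ⟨-, h2, h3, -, h5⟩ := key w hw
    obtain ⟨-, h2', h3', -, h5'⟩ := key w' hw'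
    rw [Sym2.mem_iff] at hv hv'
    rcases hv with rfl | rfl <;> rcases hv' with hv' | hv'
    · rw [← h3, ← h3', hv']
    · rw [hv', h5'] at h2
      cases h2
    · rw [← hv', h5] at h2'
      cases h2'
    · exact hv'
  refine ⟨⟨fun e he => ?_, fun e he e' he' v hv hv' => ?_⟩, Finset.card_image_of_injOn ?_⟩
  · obtain ⟨w, hw, rfl⟩ := Finset.mem_image.1 he
    obtain ⟨h1, h2, h3, h4, h5⟩ := key w (Finset.mem_filter.1 hw).2
    rw [SimpleGraph.mem_edgeSet, inducedOn_adj]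
    refine ⟨?_, Finset.mem_union_right _ h1, Finset.mem_union_left _ h4⟩
    rcases hstar (f w) with h | h
    · rw [h3] at h
      exact (mem_nbrs.1 h).2
    · rw [← h3, h, h2] at h5
      cases h5
  · obtain ⟨w, hw, rfl⟩ := Finset.mem_image.1 he
    obtain ⟨w', hw', rfl⟩ := Finset.mem_image.1 he'
    rw [share w w' (Finset.mem_filter.1 hw).2 (Finset.mem_filter.1 hw').2 v hv hv']
  · intro w hw w' hw' h
    refine share w w' (Finset.mem_filter.1 hw).2 (Finset.mem_filter.1 hw').2 w (by simp) ?_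
    have h' : s(f w, w) = s(f w', w') := h
    rw [← h']
    simp

variable {pick : (V → Finset V) → PMF (V → V)}

theorem isMatching_of_mem_support_matchHeavy
    (hpick : ∀ A, ∀ f ∈ (pick A).support, ∀ w, (A w).Nonempty → f w ∈ A w) {H F : Finset V}
    {M : Finset (Sym2 V)} (hM : M ∈ (matchHeavy G pick H F).support) :
    IsMatching (inducedOn G (H ∪ F)) M := by
  simp only [matchHeavy, PMF.mem_support_bind_iff, PMF.support_map, Set.mem_image] at hM
  obtain ⟨star, hstar, red, -, f, hf, rfl⟩ := hM
  exact (isMatching_image_redPreimage (star := star) (red := red)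
    (fun v => mem_support_uniformOr (mem_support_of_mem_support_indep hstar v))
    (hpick _ f hf)).1

/-- The number of edges is the number of blue vertices that receive a proposal, so the rule `pick`
drops out. -/
theorem ev_matchHeavy_card
    (hpick : ∀ A, ∀ f ∈ (pick A).support, ∀ w, (A w).Nonempty → f w ∈ A w) (H F : Finset V) :
    ev (matchHeavy G pick H F) (fun M => (M.card : ℝ))
      = ev (indep fun v => uniformOr (nbrs G H v) v) fun star =>
          ev (indep fun _ : V => coin (1 / 2)) fun red =>
            ∑ w, if (redPreimage H F star red w).Nonempty then (1 : ℝ) else 0 := by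
  simp only [matchHeavy]
  rw [ev_bind]
  refine ev_congr_support _ fun star hstar => ?_
  rw [ev_bind]
  refine ev_congr_support _ fun red _ => ?_
  rw [ev_map, ← ev_const (pick (redPreimage H F star red)) (∑ w, _)]
  refine ev_congr_support _ fun f hf => ?_
  rw [Finset.sum_boole]
  norm_cast
  exact (isMatching_image_redPreimage (G := G) (star := star) (red := red)
    (fun v => mem_support_uniformOr (mem_support_of_mem_support_indep hstar v))
    (hpick _ f hf)).2

theorem ev_uniformOr_eq {W : Finset V} {d w : V} (hw : w ∈ W) (c : ℝ) :
    ev (uniformOr W d) (fun v => 1 - c * if v = w then 1 else 0) = 1 - c / W.card := by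
  have h : ((uniformOr W d) w).toReal = (W.card : ℝ)⁻¹ := by
    have hne : W.Nonempty := ⟨w, hw⟩
    rw [uniformOr, dif_pos hne, PMF.uniformOfFinset_apply_of_mem _ hw]
    simp
  rw [ev_sub, ev_const, ev_const_mul, ev]
  simp [h, div_eq_mul_inv]

/-- Since w ∉ N, the colour of w is independent of those in N. In the application, a v is the
indicator that v is a friend with `star v = w`, and the left side is the probability that w is blue
and one of these v is red. -/
theorem le_ev_coins {w : V} {N : Finset V} (hw : w ∉ N) (a : V → ℝ) :
    ev (indep fun _ : V => coin (1 / 2)) (fun red => (if red w = false then 1 else 0) *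
      (1 - ∏ v ∈ N, (1 - a v * if red v = true then 1 else 0)))
      = 1 / 2 - 1 / 2 * ∏ v ∈ N, (1 - 1 / 2 * a v) := by
  have h1 : ∀ red : V → Bool, (if red w = false then (1 : ℝ) else 0) *
      (1 - ∏ v ∈ N, (1 - a v * if red v = true then 1 else 0))
      = (if red w = false then 1 else 0) - ∏ v ∈ insert w N,
        (if v = w then (if red v = false then (1 : ℝ) else 0)
          else (1 - a v * if red v = true then 1 else 0)) := by
    intro red
    rw [Finset.prod_insert hw, if_pos rfl, mul_sub, mul_one]
    congr 2
    exact Finset.prod_congr rfl fun v hv => by rw [if_neg (ne_of_mem_of_not_mem hv hw)]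
  simp only [h1]
  rw [ev_sub, ev_indep_coord (fun _ : V => coin (1 / 2)) w fun x => if x = false then (1 : ℝ) else 0,
    ev_indep_prod_finset (fun _ : V => coin (1 / 2)) (insert w N) fun v x =>
      (if v = w then (if x = false then (1 : ℝ) else 0) else (1 - a v * if x = true then 1 else 0)),
    Finset.prod_insert hw]
  have hc : ∀ f : Bool → ℝ, ev (coin (1 / 2)) f = 1 / 2 * f true + (1 - 1 / 2) * f false :=
    ev_coin (by norm_num) (by norm_num)
  have h2 : ∀ v ∈ N, ev (coin (1 / 2)) (fun x => if v = w then (if x = false then (1 : ℝ) else 0)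
      else (1 - a v * if x = true then 1 else 0)) = 1 - 1 / 2 * a v := by
    intro v hv
    rw [hc]
    simp [ne_of_mem_of_not_mem hv hw]
    ring
  rw [Finset.prod_congr rfl h2, hc, hc]
  norm_num

/-- A heavy w is matched if it is blue and some red friend proposes to it. Averaging over the
colours and then over the proposals keeps the probability of no such friend in product form, so that
F can be averaged factor by factor afterwards. -/
theorem le_ev_matchHeavy_card
    (hpick : ∀ A, ∀ f ∈ (pick A).support, ∀ w, (A w).Nonempty → f w ∈ A w) (H F W : Finset V) :
    ∑ w ∈ H, (1 / 2 - 1 / 2 * ∏ v ∈ nbrs G W w,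
      (1 - (if v ∈ F then 1 else 0) * (1 / (2 * ((nbrs G H v).card : ℝ)))))
      ≤ ev (matchHeavy G pick H F) (fun M => (M.card : ℝ)) := by
  have hnot : ∀ w, w ∉ nbrs G W w := fun w hw => (mem_nbrs.1 hw).2.ne rfl
  have h1 : ∀ w ∈ H, (1 / 2 - 1 / 2 * ∏ v ∈ nbrs G W w,
      (1 - (if v ∈ F then 1 else 0) * (1 / (2 * ((nbrs G H v).card : ℝ)))))
      = ev (indep fun v => uniformOr (nbrs G H v) v) (fun star =>
          ev (indep fun _ : V => coin (1 / 2)) fun red => (if red w = false then 1 else 0) *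
      (1 - ∏ v ∈ nbrs G W w, (1 - (if v ∈ F ∧ star v = w then 1 else 0) *
        if red v = true then 1 else 0))) := by
    intro w hw
    simp only [le_ev_coins (hnot w)]
    rw [ev_sub, ev_const, ev_const_mul]
    congr 2
    have h2 : ∀ star : V → V, (∏ v ∈ nbrs G W w,
        (1 - 1 / 2 * (if v ∈ F ∧ star v = w then (1 : ℝ) else 0)))
        = ∏ v ∈ nbrs G W w, (1 - (1 / 2 * if v ∈ F then 1 else 0) * if star v = w then 1 else 0) := by
      intro star
      refine Finset.prod_congr rfl fun v _ => ?_
      by_cases h : v ∈ F <;> simp [h]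
    simp only [h2]
    rw [ev_indep_prod_finset (fun v => uniformOr (nbrs G H v) v) (nbrs G W w)
      fun v x => (1 - (1 / 2 * if v ∈ F then (1 : ℝ) else 0) * if x = w then 1 else 0)]
    refine Finset.prod_congr rfl fun v hv => ?_
    rw [ev_uniformOr_eq (mem_nbrs.2 ⟨hw, (mem_nbrs.1 hv).2.symm⟩)]
    ring
  rw [ev_matchHeavy_card hpick, Finset.sum_congr rfl h1, ← ev_sum]
  refine ev_mono _ fun star => ?_
  rw [← ev_sum]
  refine ev_mono _ fun red => ?_
  calc _ ≤ ∑ w ∈ H, (if (redPreimage H F star red w).Nonempty then (1 : ℝ) else 0) := ?_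
    _ ≤ _ := Finset.sum_le_univ_sum_of_nonneg fun w => by split_ifs <;> norm_num
  refine Finset.sum_le_sum fun w hw => ?_
  by_cases hred : red w = false
  · rw [if_pos hred, one_mul]
    split_ifs with hne
    · linarith [Finset.prod_nonneg (s := nbrs G W w) (f := fun v =>
        (1 - (if v ∈ F ∧ star v = w then (1 : ℝ) else 0) * if red v = true then 1 else 0))
        fun v _ => by split_ifs <;> norm_num]
    · rw [Finset.prod_eq_one, sub_self]
      intro v _
      by_cases h : v ∈ F ∧ star v = w
      · by_cases hv : red v = true
        · exact (hne ⟨v, Finset.mem_filter.2 ⟨h.1, hv, h.2, hw, hred⟩⟩).elim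
        · simp [hv]
      · simp [h]
  · rw [if_neg hred, zero_mul]
    split_ifs <;> norm_num

/-- If the friends of a set `H` of vertices of degree at least `Δ / 4` are selected with the
probabilities `|N(v) ∩ H| / (4 Δ)`, then `MatchHeavy` matches a constant fraction of `H`. -/
theorem le_ev_friends_matchHeavy_card
    (hpick : ∀ A, ∀ f ∈ (pick A).support, ∀ w, (A w).Nonempty → f w ∈ A w) {H W : Finset V}
    {Δ : ℝ} (hΔ : 0 < Δ) (hH : H ⊆ W) (hdeg : ∀ w ∈ H, Δ / 4 ≤ ((nbrs G W w).card : ℝ))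
    (hle : ∀ v ∈ W, ((nbrs G W v).card : ℝ) ≤ 2 * Δ) {p : V → ℝ}
    (hp : ∀ v ∈ W, p v = ((nbrs G H v).card : ℝ) / (4 * Δ)) :
    (H.card : ℝ) / 66 ≤ ev (randomSubset W p) fun F =>
      ev (matchHeavy G pick H F) fun M => (M.card : ℝ) := by
  have hcard : ∀ v ∈ W, ((nbrs G H v).card : ℝ) ≤ 2 * Δ := fun v hv =>
    (Nat.cast_le.2 (Finset.card_le_card (nbrs_mono hH v))).trans (hle v hv)
  have h0 : ∀ v ∈ W, 0 ≤ p v := fun v hv => by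
    rw [hp v hv]
    positivity
  have h1 : ∀ v ∈ W, p v ≤ 1 := fun v hv => by
    rw [hp v hv, div_le_one (by positivity)]
    linarith [hcard v hv]
  refine le_trans ?_ (ev_mono _ fun F => le_ev_matchHeavy_card (G := G) hpick H F W)
  rw [ev_sum]
  have hterm : ∀ w ∈ H, (1 : ℝ) / 66 ≤ ev (randomSubset W p) (fun F => 1 / 2 - 1 / 2 *
      ∏ v ∈ nbrs G W w, (1 - (if v ∈ F then 1 else 0) * (1 / (2 * ((nbrs G H v).card : ℝ))))) := by
    intro w hw
    rw [ev_sub, ev_const, ev_const_mul, ev_randomSubset]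
    have h2 : ∀ x : V → Bool, (∏ v ∈ nbrs G W w, (1 - (if v ∈ W.filter fun v => x v = true
        then (1 : ℝ) else 0) * (1 / (2 * ((nbrs G H v).card : ℝ)))))
        = ∏ v ∈ nbrs G W w, (1 - (if x v = true then (1 : ℝ) else 0) *
          (1 / (2 * ((nbrs G H v).card : ℝ)))) := by
      intro x
      refine Finset.prod_congr rfl fun v hv => ?_
      simp [(mem_nbrs.1 hv).1]
    simp only [h2]
    rw [ev_indep_prod_finset (fun v => coin (p v)) (nbrs G W w) fun v x =>
      (1 - (if x = true then (1 : ℝ) else 0) * (1 / (2 * ((nbrs G H v).card : ℝ))))]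
    -- This cancellation is the reason for the selection probabilities of F: v is a friend with
    -- probability |N(v) ∩ H| / (4Δ), and a friend v is red and proposes to w with probability 1 /
    -- (2|N(v) ∩ H|).
    have h3 : ∀ v ∈ nbrs G W w, ev (coin (p v)) (fun x => (1 - (if x = true then (1 : ℝ) else 0) *
        (1 / (2 * ((nbrs G H v).card : ℝ))))) = 1 - 1 / (8 * Δ) := by
      intro v hv
      have hvW := (mem_nbrs.1 hv).1
      have hpos : (0 : ℝ) < (nbrs G H v).card := by
        exact_mod_cast Finset.card_pos.2 ⟨w, mem_nbrs.2 ⟨hw, (mem_nbrs.1 hv).2.symm⟩⟩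
      rw [ev_coin (h0 v hvW) (h1 v hvW), hp v hvW]
      simp
      field_simp
      ring
    rw [Finset.prod_congr rfl h3, Finset.prod_const]
    set d := (nbrs G W w).card with hd
    have hd0 : Δ / 4 ≤ (d : ℝ) := hdeg w hw
    have hΔ8 : (1 : ℝ) ≤ 8 * Δ := by
      have h4 := hle w (hH hw)
      have : 0 < d := by
        have : (0 : ℝ) < d := by linarith
        exact_mod_cast this
      have : (1 : ℝ) ≤ d := by exact_mod_cast this
      linarith
    have hbase : 0 ≤ 1 - 1 / (8 * Δ) := by
      rw [sub_nonneg, div_le_one (by linarith)]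
      exact hΔ8
    -- The degree is at least Δ/4, so the exponent is at least 1/32. With the colour of w, 1/2 ·
    -- 1/33 gives the constant 1/66.
    have h5 : (1 - 1 / (8 * Δ)) ^ d ≤ 32 / 33 := by
      calc (1 - 1 / (8 * Δ)) ^ d ≤ Real.exp (-(1 / (8 * Δ))) ^ d := by
            gcongr
            linarith [Real.add_one_le_exp (-(1 / (8 * Δ)))]
        _ = Real.exp (-(d / (8 * Δ))) := by
            rw [← Real.exp_nat_mul]
            ring_nf
        _ ≤ Real.exp (-(1 / 32)) := by
            apply Real.exp_le_exp.2
            rw [neg_le_neg_iff, le_div_iff₀ (by positivity)]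
            linarith
        _ ≤ 32 / 33 := by
            rw [Real.exp_neg, inv_le_comm₀ (Real.exp_pos _) (by norm_num)]
            have := Real.add_one_le_exp (1 / 32 : ℝ)
            norm_num at this ⊢
            linarith
    linarith
  calc (H.card : ℝ) / 66 = ∑ _w ∈ H, (1 : ℝ) / 66 := by
        rw [Finset.sum_const, nsmul_eq_mul]
        ring
    _ ≤ _ := Finset.sum_le_sum hterm

/-- Double counting of the adjacencies between W and H: every w ∈ H contributes its degree divided
by 4Δ, which is at most 1/2. -/
theorem ev_friends_card_le {H W : Finset V} {Δ : ℝ} (hΔ : 0 < Δ) (hH : H ⊆ W)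
    (hle : ∀ v ∈ W, ((nbrs G W v).card : ℝ) ≤ 2 * Δ) {p : V → ℝ}
    (hp : ∀ v ∈ W, p v = ((nbrs G H v).card : ℝ) / (4 * Δ)) :
    ev (randomSubset W p) (fun F => (F.card : ℝ)) ≤ (H.card : ℝ) / 2 := by
  have hcard : ∀ v ∈ W, ((nbrs G H v).card : ℝ) ≤ 2 * Δ := fun v hv =>
    (Nat.cast_le.2 (Finset.card_le_card (nbrs_mono hH v))).trans (hle v hv)
  have h0 : ∀ v ∈ W, 0 ≤ p v := fun v hv => by
    rw [hp v hv]
    positivity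
  have h1 : ∀ v ∈ W, p v ≤ 1 := fun v hv => by
    rw [hp v hv, div_le_one (by positivity)]
    linarith [hcard v hv]
  have hcount : ∑ v ∈ W, ((nbrs G H v).card : ℝ) = ∑ w ∈ H, ((nbrs G W w).card : ℝ) := by
    classical
    have := Finset.sum_card_bipartiteAbove_eq_sum_card_bipartiteBelow (s := W) (t := H) G.Adj
    simp only [Finset.bipartiteAbove, Finset.bipartiteBelow] at this
    have h2 : ∑ v ∈ W, (nbrs G H v).card = ∑ w ∈ H, (nbrs G W w).card := by
      have e1 : ∀ v, nbrs G H v = H.filter fun u => G.Adj v u := fun v => by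
        ext u
        simp [mem_nbrs]
      have e2 : ∀ w, nbrs G W w = W.filter fun u => G.Adj u w := fun w => by
        ext u
        simp [mem_nbrs, G.adj_comm]
      simp only [e1, e2, this]
    exact_mod_cast h2
  have h3 : ev (randomSubset W p) (fun F => (F.card : ℝ))
      = ev (randomSubset W p) fun F => ((W ∩ F).card : ℝ) :=
    ev_congr_support _ fun F hF => by
      rw [Finset.inter_eq_right.2 (randomSubset_subset hF)]
  rw [h3, ev_card_inter_randomSubset subset_rfl h0 h1, Finset.sum_congr rfl hp, ← Finset.sum_div,
    hcount, div_le_iff₀ (by positivity)]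
  calc ∑ w ∈ H, ((nbrs G W w).card : ℝ) ≤ ∑ _w ∈ H, 2 * Δ :=
        Finset.sum_le_sum fun w hw => hle w (hH hw)
    _ = _ := by
        rw [Finset.sum_const, nsmul_eq_mul]
        ring

end MatchHeavy

/-! ### One phase of the global and of the local algorithm -/

section Phases

variable {V : Type*} [DecidableEq V] {G : SimpleGraph V}
  {pick : (V → Finset V) → PMF (V → V)} {mm : Finset V → PMF (Finset (Sym2 V))}

theorem card_inter_sdiff_ge (T W X : Finset V) :
    ((T ∩ W).card : ℝ) - (X.card : ℝ) ≤ ((T ∩ (W \ X)).card : ℝ) := by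
  have h : (T ∩ W).card ≤ (T ∩ (W \ X)).card + X.card := by
    refine (Finset.card_le_card fun v hv => ?_).trans (Finset.card_union_le _ _)
    simp only [Finset.mem_inter, Finset.mem_union, Finset.mem_sdiff] at hv ⊢
    tauto
  have h' : ((T ∩ W).card : ℝ) ≤ (T ∩ (W \ X)).card + X.card := by exact_mod_cast h
  linarith

theorem reachedFrom_sdiff {W X Y : Finset V} {M : Finset (Sym2 V)}
    (hM : IsMatching (inducedOn G X) M) (hX : X ⊆ W) (hXY : X ⊆ Y) :
    ReachedFrom G W (W \ Y, M) := by
  rw [isMatching_inducedOn] at hM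
  refine ⟨Finset.sdiff_subset, hM.1, fun e he v hv => ?_⟩
  have h := hM.2 e he v hv
  exact ⟨hX h, fun h' => (Finset.mem_sdiff.1 h').2 (hXY h)⟩

variable [Fintype V]

theorem reachedFrom_of_mem_support_globalPhase
    (hpick : ∀ A, ∀ f ∈ (pick A).support, ∀ w, (A w).Nonempty → f w ∈ A w) {Δ : ℝ}
    {W : Finset V} {t : Finset V × Finset (Sym2 V)}
    (ht : t ∈ (globalPhase G pick Δ W).support) :
    ReachedFrom G W t ∧ ∀ v ∈ t.1, ((nbrs G t.1 v).card : ℝ) < Δ / 2 := by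
  simp only [globalPhase, PMF.mem_support_bind_iff, PMF.support_map, Set.mem_image] at ht
  obtain ⟨F, hF, M, hM, rfl⟩ := ht
  refine ⟨reachedFrom_sdiff (isMatching_of_mem_support_matchHeavy hpick hM)
    (Finset.union_subset (Finset.filter_subset _ _) (randomSubset_subset hF)) subset_rfl,
    fun v hv => ?_⟩
  rw [Finset.mem_sdiff, Finset.mem_union, Finset.mem_filter] at hv
  by_contra! hcon
  exact hv.2 (Or.inl ⟨hv.1, hcon.trans (Nat.cast_le.2 (Finset.card_le_card
    (nbrs_mono Finset.sdiff_subset v)))⟩)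

/-- In a phase of the global algorithm, the size of the matching grows at least in proportion to
the number of vertices of `T` that are removed. -/
theorem le_ev_globalPhase
    (hpick : ∀ A, ∀ f ∈ (pick A).support, ∀ w, (A w).Nonempty → f w ∈ A w) {Δ : ℝ} (hΔ : 0 < Δ)
    {W : Finset V} (hW : ∀ v ∈ W, ((nbrs G W v).card : ℝ) < Δ) (T : Finset V) :
    1 / 200 * ((T ∩ W).card : ℝ) ≤ ev (globalPhase G pick Δ W) fun t =>
      (t.2.card : ℝ) + 1 / 200 * ((T ∩ t.1).card : ℝ) := by
  simp only [globalPhase]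
  set H := W.filter fun v => Δ / 2 ≤ ((nbrs G W v).card : ℝ) with hH
  have hHW : H ⊆ W := Finset.filter_subset _ _
  have hdeg : ∀ w ∈ H, Δ / 4 ≤ ((nbrs G W w).card : ℝ) := fun w hw => by
    have := (Finset.mem_filter.1 hw).2
    linarith
  have hle : ∀ v ∈ W, ((nbrs G W v).card : ℝ) ≤ 2 * Δ := fun v hv => by linarith [hW v hv]
  rw [ev_bind]
  set p : V → ℝ := fun v => ((nbrs G H v).card : ℝ) / (4 * Δ) with hp
  have h1 := le_ev_friends_matchHeavy_card hpick hΔ hHW hdeg hle (p := p) fun v _ => rfl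
  have h2 := ev_friends_card_le hΔ hHW hle (p := p) fun v _ => rfl
  -- The expected gain |H|/66 exceeds the expected loss, which is at most (|H| + |H|/2) / 200.
  calc _ ≤ ev (randomSubset W p) (fun F => ev (matchHeavy G pick H F) (fun M => (M.card : ℝ))
        + (1 / 200 * ((T ∩ W).card - H.card : ℝ) - 1 / 200 * (F.card : ℝ))) := by
        rw [ev_add, ev_sub, ev_const, ev_const_mul]
        linarith [Nat.cast_nonneg (α := ℝ) H.card]
    _ ≤ _ := by
        refine ev_mono _ fun F => ?_
        rw [ev_map]
        dsimp only
        rw [ev_add_const]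
        have h3 := card_inter_sdiff_ge T W (H ∪ F)
        have h4 : ((H ∪ F).card : ℝ) ≤ H.card + F.card := by
          exact_mod_cast Finset.card_union_le H F
        linarith

theorem reachedFrom_of_mem_support_localPhase {b : ℝ}
    (hmm : ∀ W, ∀ M ∈ (mm W).support, IsMaximalMatching (inducedOn G W) M) {Δ : ℝ}
    {W : Finset V} {t : Finset V × Finset (Sym2 V)}
    (ht : t ∈ (localPhase b G mm Δ W).support) : ReachedFrom G W t := by
  simp only [localPhase, PMF.mem_support_bind_iff, PMF.support_map, Set.mem_image] at ht
  obtain ⟨R, -, H, hH, F, hF, M, hM, rfl⟩ := ht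
  refine reachedFrom_sdiff (hmm _ M hM).prop
    (Finset.union_subset (randomSubset_subset hH) (randomSubset_subset hF)) ?_
  exact Finset.union_subset_union_left Finset.subset_union_right

theorem muH_nonneg_le_one {n : ℕ} (hn : 2 ≤ n) (r : ℝ) : 0 ≤ muH n r ∧ muH n r ≤ 1 := by
  have hα : 0 < alpha n := mul_pos (by norm_num) (Real.log_pos (by exact_mod_cast hn))
  unfold muH
  split_ifs with h
  · refine ⟨by positivity, ?_⟩
    have : Real.exp (alpha n / 2 * (r - 1 / 2)) ≤ 1 :=
      Real.exp_le_one_iff.2 (mul_nonpos_of_nonneg_of_nonpos (by positivity) (by linarith))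
    linarith
  · have h1 : Real.exp (-(alpha n / 2 * (r - 1 / 2))) ≤ 1 :=
      Real.exp_le_one_iff.2 (neg_nonpos.2 (mul_nonneg (by positivity) (by linarith)))
    have h2 := Real.exp_pos (-(alpha n / 2 * (r - 1 / 2)))
    constructor <;> linarith

theorem muF_eq (r : ℝ) : muF r = min (max (r / 4) 0) 1 := by
  unfold muF
  split_ifs with h
  · rw [min_eq_left (max_le (by linarith) zero_le_one)]
  · rw [min_eq_right (le_max_of_le_left (by linarith))]

theorem muF_nonneg_le_one (r : ℝ) : 0 ≤ muF r ∧ muF r ≤ 1 := by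
  rw [muF_eq]
  exact ⟨le_min (le_max_right _ _) zero_le_one, min_le_right _ _⟩

/-- In a phase of the local algorithm, the size of the matching grows at least in proportion to
the number of vertices of `T` that are removed, except for the effect of the reference set. -/
theorem le_ev_localPhase {b : ℝ}
    (hμ : 0 ≤ muR b (Fintype.card V) ∧ muR b (Fintype.card V) ≤ 1)
    (hmm : ∀ W, ∀ M ∈ (mm W).support, IsMaximalMatching (inducedOn G W) M) {Δ : ℝ} (hΔ : 0 < Δ)
    {W : Finset V} (hW : ∀ v ∈ W, ((nbrs G W v).card : ℝ) ≤ 2 * Δ) {δ : ℝ}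
    (hδ : ev (randomSubset W fun _ => muR b (Fintype.card V)) (fun R =>
      pr (randomSubset W fun v =>
        muH (Fintype.card V) ((nbrs G R v).card / muR b (Fintype.card V) / Δ)) fun H =>
        ∃ v ∈ H, ((nbrs G W v).card : ℝ) < Δ / 4) ≤ δ) (T : Finset V) :
    1 / 200 * ((1 - muR b (Fintype.card V)) * ((T ∩ W).card : ℝ) - Fintype.card V * δ)
      ≤ ev (localPhase b G mm Δ W) fun t =>
        (t.2.card : ℝ) + 1 / 200 * ((T ∩ t.1).card : ℝ) := by
  classical
  set n := Fintype.card V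
  set μ := muR b n
  -- If H contains a vertex of degree below Δ/4, all of T is written off at the price n; the number
  -- δ bounds the probability of this event. Otherwise MatchHeavy serves as a comparison.
  have hinner : ∀ R : Finset V, ∀ H : Finset V, H ⊆ W →
      1 / 200 * (((T ∩ W).card : ℝ) - ((T ∩ W ∩ R).card : ℝ)
        - n * if ∃ v ∈ H, ((nbrs G W v).card : ℝ) < Δ / 4 then 1 else 0)
      ≤ ev (randomSubset W fun v => muF ((nbrs G H v).card / Δ)) fun F =>
        ev (mm (H ∪ F)) fun M => (M.card : ℝ) + 1 / 200 * ((T ∩ (W \ (R ∪ H ∪ F))).card : ℝ) := by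
    intro R H hHW
    have hcut : ∀ F, ((T ∩ W).card : ℝ) - ((T ∩ W ∩ R).card : ℝ) - ((H ∪ F).card : ℝ)
        ≤ ((T ∩ (W \ (R ∪ H ∪ F))).card : ℝ) := by
      intro F
      have h : (T ∩ W).card ≤ (T ∩ (W \ (R ∪ H ∪ F))).card + (T ∩ W ∩ R).card + (H ∪ F).card := by
        refine (Finset.card_le_card (t := (T ∩ (W \ (R ∪ H ∪ F))) ∪ (T ∩ W ∩ R) ∪ (H ∪ F))
          fun v hv => ?_).trans ((Finset.card_union_le _ _).trans
            (Nat.add_le_add_right (Finset.card_union_le _ _) _))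
        simp only [Finset.mem_inter, Finset.mem_union, Finset.mem_sdiff] at hv ⊢
        tauto
      have h' : ((T ∩ W).card : ℝ) ≤ (T ∩ (W \ (R ∪ H ∪ F))).card + (T ∩ W ∩ R).card
        + (H ∪ F).card := by exact_mod_cast h
      linarith
    split_ifs with hlow
    · rw [← ev_const (randomSubset W fun v => muF ((nbrs G H v).card / Δ))
        (1 / 200 * (((T ∩ W).card : ℝ) - _ - n * 1))]
      refine ev_mono _ fun F => ?_
      rw [← ev_const (mm (H ∪ F)) (1 / 200 * (((T ∩ W).card : ℝ) - _ - n * 1))]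
      refine ev_mono _ fun M => ?_
      have h1 : ((T ∩ W).card : ℝ) ≤ n := by exact_mod_cast Finset.card_le_univ _
      have h2 : (0 : ℝ) ≤ (T ∩ W ∩ R).card := Nat.cast_nonneg _
      have h3 : (0 : ℝ) ≤ M.card := Nat.cast_nonneg _
      have h4 : (0 : ℝ) ≤ (T ∩ (W \ (R ∪ H ∪ F))).card := Nat.cast_nonneg _
      linarith
    · push Not at hlow
      -- The ratio is at most 2, hence in the linear range of μ_F.
      have hp : ∀ v ∈ W, muF ((nbrs G H v).card / Δ) = ((nbrs G H v).card : ℝ) / (4 * Δ) := by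
        intro v hv
        have h1 : ((nbrs G H v).card : ℝ) / Δ ≤ 2 := by
          rw [div_le_iff₀ hΔ]
          exact (Nat.cast_le.2 (Finset.card_le_card (nbrs_mono hHW v))).trans (hW v hv)
        have h2 : 0 ≤ ((nbrs G H v).card : ℝ) / Δ := by positivity
        rw [muF, if_pos (by linarith), max_eq_left (by linarith), div_div, mul_comm Δ]
      -- MatchHeavy is not executed here and only certifies a large matching in G[H ∪ F], so any
      -- rule of selection will do.
      have hch : ∀ A : V → Finset V, ∃ f : V → V, ∀ w, (A w).Nonempty → f w ∈ A w := fun A =>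
        Classical.axiomOfChoice (r := fun w x => (A w).Nonempty → x ∈ A w) fun w => by
          by_cases h : (A w).Nonempty
          · exact ⟨h.choose, fun _ => h.choose_spec⟩
          · exact ⟨w, fun h' => (h h').elim⟩
      choose f hf using hch
      have hpick : ∀ A, ∀ g ∈ (PMF.pure (f A)).support, ∀ w, (A w).Nonempty → g w ∈ A w := by
        intro A g hg w hw
        rw [PMF.support_pure, Set.mem_singleton_iff] at hg
        rw [hg]
        exact hf A w hw
      have h1 := le_ev_friends_matchHeavy_card hpick hΔ hHW hlow hW hp
      have h2 := ev_friends_card_le hΔ hHW hW hp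
      calc _ ≤ ev (randomSubset W fun v => muF ((nbrs G H v).card / Δ)) (fun F =>
            1 / 2 * ev (matchHeavy G (fun A => PMF.pure (f A)) H F) (fun M => (M.card : ℝ))
            + (1 / 200 * (((T ∩ W).card : ℝ) - (T ∩ W ∩ R).card - H.card)
              - 1 / 200 * (F.card : ℝ))) := by
            rw [ev_add, ev_sub, ev_const, ev_const_mul, ev_const_mul]
            linarith [Nat.cast_nonneg (α := ℝ) H.card]
        _ ≤ _ := by
            refine ev_mono _ fun F => ?_
            rw [← ev_const (mm (H ∪ F)) (_ + _)]
            refine ev_mono_support _ fun M hM => ?_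
            -- Maximality costs a factor 2. The weight 1/200 is chosen so that 1/2 · 1/66 still
            -- exceeds 3/2 · 1/200.
            have h3 : ev (matchHeavy G (fun A => PMF.pure (f A)) H F) (fun M => (M.card : ℝ))
                ≤ 2 * M.card := by
              rw [← ev_const (matchHeavy G (fun A => PMF.pure (f A)) H F) (2 * (M.card : ℝ))]
              refine ev_mono_support _ fun M' hM' => ?_
              exact_mod_cast (hmm _ M hM).card_le (isMatching_of_mem_support_matchHeavy hpick hM')
            have h4 := hcut F
            have h5 : ((H ∪ F).card : ℝ) ≤ H.card + F.card := by
              exact_mod_cast Finset.card_union_le H F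
            linarith
  simp only [localPhase]
  rw [ev_bind]
  have hR : ev (randomSubset W fun _ => μ) (fun R => ((T ∩ W ∩ R).card : ℝ))
      = μ * (T ∩ W).card := by
    rw [ev_card_inter_randomSubset Finset.inter_subset_right (fun _ _ => hμ.1) fun _ _ => hμ.2,
      Finset.sum_const, nsmul_eq_mul, mul_comm]
  calc _ ≤ ev (randomSubset W fun _ => μ) (fun R => 1 / 200 * (((T ∩ W).card : ℝ) -
        ((T ∩ W ∩ R).card : ℝ) - n * pr (randomSubset W fun v =>
        muH n ((nbrs G R v).card / μ / Δ)) fun H =>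
        ∃ v ∈ H, ((nbrs G W v).card : ℝ) < Δ / 4)) := by
        rw [ev_const_mul, ev_sub, ev_sub, ev_const, hR, ev_const_mul]
        have := mul_le_mul_of_nonneg_left hδ (Nat.cast_nonneg (α := ℝ) n)
        linarith
    _ ≤ _ := by
        refine ev_mono _ fun R => ?_
        rw [ev_bind, pr_eq_ev, ← ev_const_mul, ← ev_const (randomSubset W fun v =>
          muH n ((nbrs G R v).card / μ / Δ)) (((T ∩ W).card : ℝ) - (T ∩ W ∩ R).card), ← ev_sub,
          ← ev_const_mul]
        refine ev_mono_support _ fun H hH => ?_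
        rw [ev_bind]
        simp only [ev_map]
        exact hinner R H (randomSubset_subset hH)

end Phases

/-! ### The global algorithm -/

section Global

variable {V : Type*} [Fintype V] [DecidableEq V] {G : SimpleGraph V}
  {pick : (V → Finset V) → PMF (V → V)}

/-- A phase removes all vertices of degree at least half of the threshold, so the degree bound for
the next phase holds with certainty. This is why the global algorithm needs no concentration. -/
theorem globalState_support
    (hpick : ∀ A, ∀ f ∈ (pick A).support, ∀ w, (A w).Nonempty → f w ∈ A w) {D : ℝ} {W : Finset V}
    (hW : ∀ v ∈ W, ((nbrs G W v).card : ℝ) < D) (k : ℕ) {s : Finset V × Finset (Sym2 V)}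
    (hs : s ∈ (globalState G pick D W k).support) :
    ReachedFrom G W s ∧ ∀ v ∈ s.1, ((nbrs G s.1 v).card : ℝ) < D / 2 ^ k := by
  induction k generalizing s with
  | zero =>
    rw [globalState, PMF.support_pure, Set.mem_singleton_iff] at hs
    subst hs
    exact ⟨ReachedFrom.refl W, by simpa using hW⟩
  | succ k ih =>
    simp only [globalState, PMF.mem_support_bind_iff, PMF.support_map, Set.mem_image] at hs
    obtain ⟨s', hs', t, ht, rfl⟩ := hs
    obtain ⟨h1, h2⟩ := reachedFrom_of_mem_support_globalPhase hpick ht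
    refine ⟨(ih hs').1.trans h1, fun v hv => (h2 v hv).trans_eq ?_⟩
    rw [pow_succ, div_div]

theorem le_ev_globalState
    (hpick : ∀ A, ∀ f ∈ (pick A).support, ∀ w, (A w).Nonempty → f w ∈ A w) {D : ℝ} (hD : 0 < D)
    {W : Finset V} (hW : ∀ v ∈ W, ((nbrs G W v).card : ℝ) < D) (T : Finset V) (k : ℕ) :
    1 / 200 * ((T ∩ W).card : ℝ) ≤ ev (globalState G pick D W k) fun s =>
      (s.2.card : ℝ) + 1 / 200 * ((T ∩ s.1).card : ℝ) := by
  induction k with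
  | zero => simp [globalState, ev_pure]
  | succ k ih =>
    rw [globalState, ev_bind]
    refine ih.trans (ev_mono_support _ fun s hs => ?_)
    obtain ⟨h1, h2⟩ := globalState_support hpick hW k hs
    have h3 := le_ev_globalPhase hpick (by positivity) h2 T
    rw [ev_map]
    calc _ ≤ (s.2.card : ℝ) + ev (globalPhase G pick (D / 2 ^ k) s.1) (fun t =>
          (t.2.card : ℝ) + 1 / 200 * ((T ∩ t.1).card : ℝ)) := by linarith
      _ = ev (globalPhase G pick (D / 2 ^ k) s.1) (fun t => (s.2.card : ℝ) +
          ((t.2.card : ℝ) + 1 / 200 * ((T ∩ t.1).card : ℝ))) := by rw [ev_const_add]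
      _ ≤ _ := by
          refine ev_mono_support _ fun t ht => ?_
          rw [h1.card_union (reachedFrom_of_mem_support_globalPhase hpick ht).1]
          push_cast
          linarith

theorem globalAlg_support
    (hpick : ∀ A, ∀ f ∈ (pick A).support, ∀ w, (A w).Nonempty → f w ∈ A w) {D : ℝ} {W : Finset V}
    (hW : ∀ v ∈ W, ((nbrs G W v).card : ℝ) < D) {M : Finset (Sym2 V)}
    (hM : M ∈ (globalAlg G pick D W).support) : ReachedFrom G W (∅, M) := by
  rw [globalAlg, PMF.support_map] at hM
  obtain ⟨s, hs, rfl⟩ := hM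
  obtain ⟨-, h1, h2⟩ := (globalState_support hpick hW _ hs).1
  exact ⟨by simp, h1, fun e he v hv => ⟨(h2 e he v hv).1, by simp⟩⟩

theorem div_two_pow_numGlobalPhases_lt (D : ℝ) : D / 2 ^ numGlobalPhases D < 1 := by
  have hne : {k : ℕ | D / 2 ^ k < 1}.Nonempty := by
    obtain ⟨k, hk⟩ := pow_unbounded_of_one_lt D (one_lt_two)
    exact ⟨k, (div_lt_one (by positivity)).2 hk⟩
  exact Nat.sInf_mem hne

/-- The global algorithm finds a matching whose expected size is at least a constant fraction of the
size of every matching `N`. -/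
theorem le_ev_globalAlg
    (hpick : ∀ A, ∀ f ∈ (pick A).support, ∀ w, (A w).Nonempty → f w ∈ A w) {D : ℝ} (hD : 0 < D)
    {W : Finset V} (hW : ∀ v ∈ W, ((nbrs G W v).card : ℝ) < D) {N : Finset (Sym2 V)}
    (hN : IsMatching G N) :
    1 / 200 * ((N.biUnion Sym2.toFinset ∩ W).card : ℝ) - 1 / 200 * (N.card : ℝ)
      ≤ ev (globalAlg G pick D W) fun M => (M.card : ℝ) := by
  have h := le_ev_globalState hpick hD hW (N.biUnion Sym2.toFinset) (numGlobalPhases D)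
  rw [globalAlg, ev_map, sub_le_iff_le_add,
    ← ev_const (globalState G pick D W (numGlobalPhases D)) (1 / 200 * (N.card : ℝ)), ← ev_add]
  refine h.trans (ev_mono_support _ fun s hs => ?_)
  -- At the end all degrees are below 1, so the remaining set contains no edge and at most one
  -- endpoint of each edge of N.
  have hempty : ∀ v ∈ s.1, nbrs G s.1 v = ∅ := by
    intro v hv
    have h1 := ((globalState_support hpick hW _ hs).2 v hv).trans
      (div_two_pow_numGlobalPhases_lt D)
    have h2 : (nbrs G s.1 v).card < 1 := by exact_mod_cast h1
    exact Finset.card_eq_zero.1 (by omega)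
  have h3 : ((N.biUnion Sym2.toFinset ∩ s.1).card : ℝ) ≤ N.card := by
    exact_mod_cast hN.card_biUnion_inter_le hempty
  linarith

end Global

/-! ### Smoothness of the selection probabilities -/

theorem exp_sub_exp_le {p q : ℝ} (hqp : q ≤ p) (hp : p ≤ 0) : Real.exp p - Real.exp q ≤ p - q := by
  have h1 : Real.exp q = Real.exp p * Real.exp (q - p) := by
    rw [← Real.exp_add]
    ring_nf
  have h2 := Real.add_one_le_exp (q - p)
  have h3 := Real.exp_le_one_iff.2 hp
  have h4 : Real.exp (q - p) ≤ 1 := Real.exp_le_one_iff.2 (by linarith)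
  rw [h1]
  nlinarith [Real.exp_pos p]

theorem alpha_pos {n : ℕ} (hn : 2 ≤ n) : 0 < alpha n :=
  mul_pos (by norm_num) (Real.log_pos (by exact_mod_cast hn))

/-- Both branches are built from the exponential function at nonpositive arguments, where it is
1-Lipschitz, and they meet at the value 1/2 for r = 1/2. The smoothness keeps errors from being
amplified by more than a factor of order α. -/
theorem muH_sub_le {n : ℕ} (hn : 2 ≤ n) {x y : ℝ} (hxy : x ≤ y) :
    0 ≤ muH n y - muH n x ∧ muH n y - muH n x ≤ alpha n / 2 * (y - x) := by
  have hα := alpha_pos hn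
  set a := alpha n / 2 with ha
  have ha0 : 0 < a := by positivity
  have hm : 0 ≤ a * (y - x) := mul_nonneg ha0.le (by linarith)
  unfold muH
  rw [← ha]
  split_ifs with h1 h2 h2
  · have hle : a * (x - 1 / 2) ≤ a * (y - 1 / 2) := mul_le_mul_of_nonneg_left (by linarith) ha0.le
    have h3 := exp_sub_exp_le hle (mul_nonpos_of_nonneg_of_nonpos ha0.le (by linarith))
    have h4 := Real.exp_le_exp.2 hle
    constructor <;> linarith
  · linarith
  · have h3 := exp_sub_exp_le (p := 0) (q := -(a * (y - 1 / 2)))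
      (neg_nonpos.2 (mul_nonneg ha0.le (by linarith))) le_rfl
    have h4 := exp_sub_exp_le (p := 0) (q := a * (x - 1 / 2))
      (mul_nonpos_of_nonneg_of_nonpos ha0.le (by linarith)) le_rfl
    have h5 : Real.exp (-(a * (y - 1 / 2))) ≤ 1 :=
      Real.exp_le_one_iff.2 (neg_nonpos.2 (mul_nonneg ha0.le (by linarith)))
    have h6 : Real.exp (a * (x - 1 / 2)) ≤ 1 :=
      Real.exp_le_one_iff.2 (mul_nonpos_of_nonneg_of_nonpos ha0.le (by linarith))
    rw [Real.exp_zero] at h3 h4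
    constructor <;> linarith
  · have hle : a * (x - 1 / 2) ≤ a * (y - 1 / 2) := mul_le_mul_of_nonneg_left (by linarith) ha0.le
    have h3 := exp_sub_exp_le (p := -(a * (x - 1 / 2))) (q := -(a * (y - 1 / 2))) (by linarith)
      (neg_nonpos.2 (mul_nonneg ha0.le (by linarith)))
    have h4 := Real.exp_le_exp.2 (neg_le_neg hle)
    constructor <;> linarith

theorem abs_muH_sub_le {n : ℕ} (hn : 2 ≤ n) (x y : ℝ) :
    |muH n x - muH n y| ≤ alpha n / 2 * |x - y| := by
  rcases le_total x y with h | h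
  · obtain ⟨h1, h2⟩ := muH_sub_le hn h
    rw [abs_sub_comm, abs_of_nonneg h1, abs_sub_comm, abs_of_nonneg (sub_nonneg.2 h)]
    exact h2
  · obtain ⟨h1, h2⟩ := muH_sub_le hn h
    rw [abs_of_nonneg h1, abs_of_nonneg (sub_nonneg.2 h)]
    exact h2

theorem abs_muF_sub_le (x y : ℝ) : |muF x - muF y| ≤ |x - y| / 4 := by
  rw [muF_eq, muF_eq]
  have h1 := abs_min_sub_min_le_max (max (x / 4) 0) 1 (max (y / 4) 0) 1
  have h2 := abs_max_sub_max_le_max (x / 4) 0 (y / 4) 0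
  rw [sub_self, abs_zero, max_eq_left (abs_nonneg (max (x / 4) 0 - max (y / 4) 0))] at h1
  rw [sub_self, abs_zero, max_eq_left (abs_nonneg (x / 4 - y / 4))] at h2
  refine (h1.trans h2).trans_eq ?_
  rw [← sub_div, abs_div]
  norm_num

/-- Here 48 · (9/32 - 1/2) = -10.5. The value 9/32 is 1/4 plus room for the error of the reference
set. -/
theorem muH_le_of_le {n : ℕ} (hn : 2 ≤ n) {r : ℝ} (hr : r ≤ 9 / 32) :
    muH n r ≤ Real.exp (-(10 * Real.log n)) := by
  have hL : 0 < Real.log n := Real.log_pos (by exact_mod_cast hn)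
  rw [muH, if_pos (by linarith), alpha]
  have h : Real.exp (96 * Real.log n / 2 * (r - 1 / 2)) ≤ Real.exp (-(10 * Real.log n)) := by
    apply Real.exp_le_exp.2
    nlinarith
  linarith [Real.exp_pos (96 * Real.log n / 2 * (r - 1 / 2))]

/-- The mirror image of the previous bound: 23/32 is 3/4 minus two errors of size 1/64. -/
theorem one_sub_muH_le_of_le {n : ℕ} (hn : 2 ≤ n) {r : ℝ} (hr : 23 / 32 ≤ r) :
    1 - muH n r ≤ Real.exp (-(10 * Real.log n)) := by
  have hL : 0 < Real.log n := Real.log_pos (by exact_mod_cast hn)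
  rw [muH, if_neg (by linarith), alpha]
  have h : Real.exp (-(96 * Real.log n / 2 * (r - 1 / 2))) ≤ Real.exp (-(10 * Real.log n)) := by
    apply Real.exp_le_exp.2
    nlinarith
  linarith [Real.exp_pos (-(96 * Real.log n / 2 * (r - 1 / 2)))]

theorem sum_abs_le {V : Type*} {Y : Finset V} {g x y : V → ℝ} {c B : ℝ} (hY : (Y.card : ℝ) ≤ B)
    (hc : 0 ≤ c) (hg : ∀ u, 0 ≤ g u ∧ g u ≤ 1) (hxy : ∀ u ∈ Y, |x u - y u| ≤ c) :
    |∑ u ∈ Y, x u * g u - ∑ u ∈ Y, y u * g u| ≤ B * c := by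
  rw [← Finset.sum_sub_distrib]
  calc _ ≤ ∑ u ∈ Y, |x u * g u - y u * g u| := Finset.abs_sum_le_sum_abs _ _
    _ ≤ ∑ _u ∈ Y, c := by
        refine Finset.sum_le_sum fun u hu => ?_
        rw [← sub_mul, abs_mul, abs_of_nonneg (hg u).1]
        exact (mul_le_of_le_one_right (abs_nonneg _) (hg u).2).trans (hxy u hu)
    _ = Y.card * c := by rw [Finset.sum_const, nsmul_eq_mul]
    _ ≤ B * c := mul_le_mul_of_nonneg_right hY hc

/-! ### The mean-field approximation of one iteration of the main loop -/

/-- The deterministic quantities that describe the expected course of an iteration of the main loop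
that starts from the vertex set `U` with threshold `Δ`, on `m` machines, in `τ` phases. The numbers
`s k v`, `h k v` and `f k v` approximate the probability that `v` survives `k` phases, and the
probabilities that it is then selected for the heavy set or for the set of friends. The
approximation error in phase `k` is measured by `ε k`. -/
structure MeanField (V : Type*) [Fintype V] where
  /-- the graph -/
  G : SimpleGraph V
  /-- the vertices that remain at the start -/
  U : Finset V
  /-- the probability of the selection for the reference set -/
  μ : ℝ
  /-- the threshold -/
  Δ : ℝ
  /-- the number of machines -/
  m : ℕ
  /-- the number of phases -/
  τ : ℕ
  /-- the approximation errors -/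
  ε : ℕ → ℝ
  /-- the probability of survival -/
  s : ℕ → V → ℝ
  /-- the probability of the selection for the heavy set -/
  h : ℕ → V → ℝ
  /-- the probability of the selection for the set of friends -/
  f : ℕ → V → ℝ
  two_le : 2 ≤ Fintype.card V
  one_le_alpha : 1 ≤ alpha (Fintype.card V)
  μ_pos : 0 < μ
  μ_le_one : μ ≤ 1
  Δ_pos : 0 < Δ
  m_pos : 0 < m
  τ_lt : τ < Fintype.card V
  -- The constant 7/4 leaves room for the tracking error below the bound 2Δ that the analysis of a
  -- phase requires.
  deg_le : ∀ v ∈ U, ((nbrs G U v).card : ℝ) ≤ 7 / 4 * Δ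
  s_zero : ∀ v, s 0 v = 1
  s_succ : ∀ k v, s (k + 1) v = s k v * ((1 - μ) * (1 - h k v) * (1 - f k v))
  h_eq : ∀ k v, h k v = muH (Fintype.card V) ((∑ u ∈ nbrs G U v, s k u) / (Δ / 2 ^ k))
  f_eq : ∀ k v, f k v = muF ((∑ u ∈ nbrs G U v, s k u * h k u) / (Δ / 2 ^ k))
  ε_zero_pos : 0 < ε 0
  ε_succ : ∀ k, ε (k + 1) = 120 * alpha (Fintype.card V) * ε k
  ε_le : ∀ k ≤ τ, ε k ≤ 1 / 64
  -- Makes every Chernoff bound below fail with probability at most 2n⁻¹⁰. The critical case is the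
  -- reference set, whose means carry the factor μ.
  concentrated : ∀ k ≤ τ, 10 * Real.log (Fintype.card V)
    ≤ (ε 0 / 4) ^ 2 * (2 * μ * (Δ / (2 ^ k * m)))

namespace MeanField

variable {V : Type*} [Fintype V] (P : MeanField V)

/-- The threshold on a machine in phase `k`. -/
noncomputable def d (k : ℕ) : ℝ := P.Δ / (2 ^ k * P.m)

/-- The probability of surviving the phases from `j` up to `k`. -/
noncomputable def wt (j k : ℕ) (u : V) : ℝ :=
  ∏ l ∈ Finset.Ico j k, ((1 - P.μ) * (1 - P.h l u) * (1 - P.f l u))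

/-- The weights that are tracked, besides the weight `1`. -/
noncomputable def test (b : Bool) (k : ℕ) (u : V) : ℝ := cond b (P.h k u) 1

/-- The vertices which are expected to have bounded degree in all phases up to `k`. -/
def Eligible (k : ℕ) (v : V) : Prop :=
  -- The case l = 0 is left out because `deg_le` already covers it for all of U, with the weaker
  -- constant 7/4.
  ∀ l, 1 ≤ l → l ≤ k → ∑ u ∈ nbrs P.G P.U v, P.s l u ≤ 3 / 2 * (P.Δ / 2 ^ l)

/-- The vertex set `W` of a machine at the start of phase `j` is as expected. -/
structure Tracked (j : ℕ) (W : Finset V) : Prop where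
  subset : W ⊆ P.U
  eligible : ∀ v ∈ W, P.Eligible j v
  -- For k = j the two values of b give the current degree and the expected number of heavy
  -- neighbours; k > j is needed for the induction. The vertex v ranges over U and not only over W,
  -- since at the end the neighbours of v on all machines are counted.
  close : ∀ k, j ≤ k → k ≤ P.τ → ∀ v ∈ P.U, P.Eligible k v → ∀ b,
    |∑ u ∈ nbrs P.G W v, P.wt j k u * P.test b k u
      - (∑ u ∈ nbrs P.G P.U v, P.s k u * P.test b k u) / P.m| ≤ P.ε j * P.d j

variable {P} {j k : ℕ} {u v : V} {W : Finset V} {b : Bool}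

theorem m_pos' (P : MeanField V) : (0 : ℝ) < P.m := Nat.cast_pos.2 P.m_pos

theorem d_pos (P : MeanField V) (k : ℕ) : 0 < P.d k :=
  div_pos P.Δ_pos (mul_pos (by positivity) P.m_pos')

theorem d_mul (P : MeanField V) (k : ℕ) : P.d k * P.m = P.Δ / 2 ^ k := by
  have := P.m_pos'
  rw [d]
  field_simp

theorem d_succ (P : MeanField V) (k : ℕ) : P.d (k + 1) = P.d k / 2 := by
  rw [d, d, div_div]
  ring_nf

theorem h_mem (P : MeanField V) (k : ℕ) (v : V) : 0 ≤ P.h k v ∧ P.h k v ≤ 1 := by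
  rw [P.h_eq]
  exact muH_nonneg_le_one P.two_le _

theorem f_mem (P : MeanField V) (k : ℕ) (v : V) : 0 ≤ P.f k v ∧ P.f k v ≤ 1 := by
  rw [P.f_eq]
  exact muF_nonneg_le_one _

theorem mul_mem {x y : ℝ} (hx : 0 ≤ x ∧ x ≤ 1) (hy : 0 ≤ y ∧ y ≤ 1) : 0 ≤ x * y ∧ x * y ≤ 1 :=
  ⟨mul_nonneg hx.1 hy.1, mul_le_one₀ hx.2 hy.1 hy.2⟩

theorem one_sub_mem {x : ℝ} (hx : 0 ≤ x ∧ x ≤ 1) : 0 ≤ 1 - x ∧ 1 - x ≤ 1 :=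
  ⟨by linarith [hx.2], by linarith [hx.1]⟩

theorem factor_mem (P : MeanField V) (k : ℕ) (v : V) :
    0 ≤ (1 - P.μ) * (1 - P.h k v) * (1 - P.f k v) ∧
      (1 - P.μ) * (1 - P.h k v) * (1 - P.f k v) ≤ 1 :=
  mul_mem (mul_mem (one_sub_mem ⟨P.μ_pos.le, P.μ_le_one⟩) (one_sub_mem (P.h_mem k v)))
    (one_sub_mem (P.f_mem k v))

theorem wt_mem (P : MeanField V) (j k : ℕ) (v : V) : 0 ≤ P.wt j k v ∧ P.wt j k v ≤ 1 :=
  ⟨Finset.prod_nonneg fun l _ => (P.factor_mem l v).1,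
    Finset.prod_le_one (fun l _ => (P.factor_mem l v).1) fun l _ => (P.factor_mem l v).2⟩

theorem test_mem (P : MeanField V) (b : Bool) (k : ℕ) (v : V) :
    0 ≤ P.test b k v ∧ P.test b k v ≤ 1 := by
  cases b
  · simp [test]
  · exact P.h_mem k v

theorem wt_self (P : MeanField V) (k : ℕ) (v : V) : P.wt k k v = 1 := by
  simp [wt]

theorem wt_eq_mul (hjk : j < k) (v : V) :
    P.wt j k v = (1 - P.μ) * (1 - P.h j v) * (1 - P.f j v) * P.wt (j + 1) k v := by
  rw [wt, Finset.prod_eq_prod_Ico_succ_bot hjk, wt]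

theorem s_eq_wt (P : MeanField V) (k : ℕ) (v : V) : P.s k v = P.wt 0 k v := by
  induction k with
  | zero => rw [P.s_zero, wt_self]
  | succ k ih => rw [P.s_succ, ih, wt, wt, Finset.prod_Ico_succ_top (Nat.zero_le k)]

theorem s_mem (P : MeanField V) (k : ℕ) (v : V) : 0 ≤ P.s k v ∧ P.s k v ≤ 1 := by
  rw [s_eq_wt]
  exact P.wt_mem 0 k v

theorem s_succ_le (P : MeanField V) (k : ℕ) (v : V) : P.s (k + 1) v ≤ P.s k v := by
  rw [P.s_succ]
  exact mul_le_of_le_one_right (P.s_mem k v).1 (P.factor_mem k v).2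

theorem Eligible.mono (h : P.Eligible k v) (hjk : j ≤ k) : P.Eligible j v :=
  fun l h1 h2 => h l h1 (h2.trans hjk)

theorem ε_pos (P : MeanField V) (k : ℕ) : 0 < P.ε k := by
  induction k with
  | zero => exact P.ε_zero_pos
  | succ k ih =>
    rw [P.ε_succ]
    have := P.one_le_alpha
    positivity

theorem ε_zero_le (P : MeanField V) (k : ℕ) : P.ε 0 ≤ P.ε k := by
  induction k with
  | zero => rfl
  | succ k ih =>
    refine ih.trans ?_
    rw [P.ε_succ]
    exact le_mul_of_one_le_left (P.ε_pos k).le (by linarith [P.one_le_alpha])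

theorem Eligible.sum_le (hv : v ∈ P.U) (h : P.Eligible k v) :
    ∑ u ∈ nbrs P.G P.U v, P.s k u ≤ 7 / 4 * (P.Δ / 2 ^ k) := by
  have h0 := P.Δ_pos
  rcases Nat.eq_zero_or_pos k with rfl | hk
  · simp only [P.s_zero, pow_zero, div_one, Finset.sum_const, nsmul_eq_mul, mul_one]
    exact P.deg_le v hv
  · have h1 := h k hk le_rfl
    have : 0 < P.Δ / 2 ^ k := by positivity
    linarith

theorem Tracked.abs_card_sub_le (hW : P.Tracked j W) (hj : j ≤ P.τ) (hv : v ∈ P.U)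
    (he : P.Eligible j v) :
    |((nbrs P.G W v).card : ℝ) - (∑ u ∈ nbrs P.G P.U v, P.s j u) / P.m| ≤ P.ε j * P.d j := by
  simpa [wt_self, test] using hW.close j le_rfl hj v hv he false

theorem Tracked.card_le (hW : P.Tracked j W) (hj : j ≤ P.τ) (hv : v ∈ P.U) (he : P.Eligible j v) :
    ((nbrs P.G W v).card : ℝ) ≤ 2 * P.d j := by
  have h1 := (abs_le.1 (hW.abs_card_sub_le hj hv he)).2
  have h2 : (∑ u ∈ nbrs P.G P.U v, P.s j u) / P.m ≤ 7 / 4 * P.d j := by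
    rw [div_le_iff₀ P.m_pos', mul_assoc, d_mul]
    exact he.sum_le hv
  have h3 := mul_le_mul_of_nonneg_right (P.ε_le j hj) (P.d_pos j).le
  linarith [P.d_pos j]

theorem Tracked.abs_ratio_sub_le (hW : P.Tracked j W) (hj : j ≤ P.τ) (hv : v ∈ P.U)
    (he : P.Eligible j v) :
    |((nbrs P.G W v).card : ℝ) / P.d j
      - (∑ u ∈ nbrs P.G P.U v, P.s j u) / (P.Δ / 2 ^ j)| ≤ P.ε j := by
  have hd := P.d_pos j
  have hm := P.m_pos'
  have h1 : ((nbrs P.G W v).card : ℝ) / P.d j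
      - (∑ u ∈ nbrs P.G P.U v, P.s j u) / (P.Δ / 2 ^ j)
      = ((nbrs P.G W v).card - (∑ u ∈ nbrs P.G P.U v, P.s j u) / P.m) / P.d j := by
    rw [← d_mul, sub_div, div_div, mul_comm (P.d j)]
  rw [h1, abs_div, abs_of_pos hd, div_le_iff₀ hd]
  exact hW.abs_card_sub_le hj hv he

/-! #### One phase on one machine -/

/-- The probability of the selection for the heavy set, given the reference set `R`. -/
noncomputable def pH (P : MeanField V) (j : ℕ) (R : Finset V) (v : V) : ℝ :=
  muH (Fintype.card V) ((nbrs P.G R v).card / P.μ / P.d j)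

/-- The probability of the selection for the set of friends, given the heavy set `H`. -/
noncomputable def pF (P : MeanField V) (j : ℕ) (H : Finset V) (v : V) : ℝ :=
  muF ((nbrs P.G H v).card / P.d j)

/-- The weights to be tracked after phase `j`. -/
def Index (P : MeanField V) (j k : ℕ) (v : V) : Prop :=
  j < k ∧ k ≤ P.τ ∧ v ∈ P.U ∧ P.Eligible k v

/-- The reference set `R` is as expected. -/
structure GoodReference (P : MeanField V) [DecidableEq V] (j : ℕ) (W R : Finset V) : Prop where
  card : ∀ v ∈ W, |((nbrs P.G R v).card : ℝ) - P.μ * (nbrs P.G W v).card| ≤ P.ε 0 * (P.μ * P.d j)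
  -- Only the factor 1 - μ of the weight is traded for the removal of R. The factors for H and F are
  -- traded in the same way in `GoodHeavy` and `GoodFriends`.
  close : ∀ k v b, P.Index j k v →
    |∑ u ∈ nbrs P.G (W \ R) v,
        (1 - P.h j u) * ((1 - P.f j u) * (P.wt (j + 1) k u * P.test b k u))
      - ∑ u ∈ nbrs P.G W v,
        (1 - P.μ) * ((1 - P.h j u) * ((1 - P.f j u) * (P.wt (j + 1) k u * P.test b k u)))|
      ≤ P.ε 0 * P.d j

/-- The heavy set `H` is as expected. -/
structure GoodHeavy (P : MeanField V) [DecidableEq V] (j : ℕ) (W R H : Finset V) : Prop where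
  card : ∀ v ∈ W, |((nbrs P.G H v).card : ℝ) - ∑ u ∈ nbrs P.G W v, P.pH j R u| ≤ P.ε 0 * P.d j
  close : ∀ k v b, P.Index j k v →
    |∑ u ∈ nbrs P.G ((W \ R) \ H) v, (1 - P.f j u) * (P.wt (j + 1) k u * P.test b k u)
      - ∑ u ∈ nbrs P.G (W \ R) v,
        (1 - P.pH j R u) * ((1 - P.f j u) * (P.wt (j + 1) k u * P.test b k u))|
      ≤ P.ε 0 * P.d j
  heavy : ∀ v ∈ W, 3 / 4 * (P.Δ / 2 ^ j) < ∑ u ∈ nbrs P.G P.U v, P.s j u → v ∈ H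

/-- The set `F` of friends is as expected. -/
def GoodFriends (P : MeanField V) [DecidableEq V] (j : ℕ) (W R H F : Finset V) : Prop :=
  ∀ k v b, P.Index j k v →
    |∑ u ∈ nbrs P.G (((W \ R) \ H) \ F) v, P.wt (j + 1) k u * P.test b k u
      - ∑ u ∈ nbrs P.G ((W \ R) \ H) v, (1 - P.pF j H u) * (P.wt (j + 1) k u * P.test b k u)|
      ≤ P.ε 0 * P.d j

section Deterministic

variable [DecidableEq V] {R H F : Finset V}

theorem GoodReference.abs_ratio_sub_le (hR : P.GoodReference j W R) (hv : v ∈ W) :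
    |((nbrs P.G R v).card : ℝ) / P.μ / P.d j - (nbrs P.G W v).card / P.d j| ≤ P.ε 0 := by
  have hμ := P.μ_pos
  have hd := P.d_pos j
  have h1 : ((nbrs P.G R v).card : ℝ) / P.μ / P.d j - (nbrs P.G W v).card / P.d j
      = ((nbrs P.G R v).card - P.μ * (nbrs P.G W v).card) / (P.μ * P.d j) := by
    field_simp
  rw [h1, abs_div, abs_of_pos (mul_pos hμ hd), div_le_iff₀ (mul_pos hμ hd)]
  exact hR.card v hv

/-- The argument of μ_H is off by ε₀ through sampling with R and by ε_j through tracking, together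
at most 2ε_j; the Lipschitz constant is α/2. -/
theorem abs_pH_sub_le (hW : P.Tracked j W) (hj : j ≤ P.τ) (hR : P.GoodReference j W R)
    (hv : v ∈ W) : |P.pH j R v - P.h j v| ≤ alpha (Fintype.card V) * P.ε j := by
  have h1 := hR.abs_ratio_sub_le hv
  have h2 := hW.abs_ratio_sub_le hj (hW.subset hv) (hW.eligible v hv)
  have h3 := abs_sub_le (((nbrs P.G R v).card : ℝ) / P.μ / P.d j)
    ((nbrs P.G W v).card / P.d j) ((∑ u ∈ nbrs P.G P.U v, P.s j u) / (P.Δ / 2 ^ j))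
  have h4 := P.ε_zero_le j
  rw [pH, P.h_eq]
  refine (abs_muH_sub_le P.two_le _ _).trans ?_
  have h5 := mul_le_mul_of_nonneg_left (h3.trans ((add_le_add h1 h2).trans
    (add_le_add_left h4 _))) (show 0 ≤ alpha (Fintype.card V) / 2 by linarith [P.one_le_alpha])
  linarith

/-- The number of heavy neighbours concentrates about the sum of `pH`. This differs from the sum of
h by at most 2d · αε_j, and the latter is tracked by the weights with b = true. The slope 1/4 of μ_F
reduces the total (2 + 2α)ε_j to at most αε_j. -/
theorem abs_pF_sub_le (hW : P.Tracked j W) (hj : j ≤ P.τ) (hR : P.GoodReference j W R)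
    (hH : P.GoodHeavy j W R H) (hv : v ∈ W) :
    |P.pF j H v - P.f j v| ≤ alpha (Fintype.card V) * P.ε j := by
  have hd := P.d_pos j
  have hm := P.m_pos'
  have hα := P.one_le_alpha
  have hε := P.ε_pos j
  have h1 := hH.card v hv
  have h2 := hW.close j le_rfl hj v (hW.subset hv) (hW.eligible v hv) true
  simp only [wt_self, test, cond_true, one_mul] at h2
  have h3 := sum_abs_le (g := fun _ => 1) (hW.card_le hj (hW.subset hv) (hW.eligible v hv))
    (by positivity) (fun _ => by norm_num) fun u hu =>
      abs_pH_sub_le hW hj hR (nbrs_subset _ _ _ hu)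
  simp only [mul_one] at h3
  have h4 : |((nbrs P.G H v).card : ℝ) - (∑ u ∈ nbrs P.G P.U v, P.s j u * P.h j u) / P.m|
      ≤ (2 + 2 * alpha (Fintype.card V)) * P.ε j * P.d j := by
    have h5 := abs_sub_le ((nbrs P.G H v).card : ℝ) (∑ u ∈ nbrs P.G W v, P.pH j R u)
      ((∑ u ∈ nbrs P.G P.U v, P.s j u * P.h j u) / P.m)
    have h6 := abs_sub_le (∑ u ∈ nbrs P.G W v, P.pH j R u) (∑ u ∈ nbrs P.G W v, P.h j u)
      ((∑ u ∈ nbrs P.G P.U v, P.s j u * P.h j u) / P.m)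
    have h7 := mul_le_mul_of_nonneg_right (P.ε_zero_le j) hd.le
    linarith
  have h8 : ((nbrs P.G H v).card : ℝ) / P.d j
      - (∑ u ∈ nbrs P.G P.U v, P.s j u * P.h j u) / (P.Δ / 2 ^ j)
      = ((nbrs P.G H v).card - (∑ u ∈ nbrs P.G P.U v, P.s j u * P.h j u) / P.m) / P.d j := by
    rw [← d_mul, sub_div, div_div, mul_comm (P.d j)]
  rw [pF, P.f_eq]
  refine (abs_muF_sub_le _ _).trans ?_
  have h9 : |((nbrs P.G H v).card : ℝ) / P.d j
      - (∑ u ∈ nbrs P.G P.U v, P.s j u * P.h j u) / (P.Δ / 2 ^ j)|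
      ≤ (2 + 2 * alpha (Fintype.card V)) * P.ε j := by
    rw [h8, abs_div, abs_of_pos hd, div_le_iff₀ hd]
    exact h4
  nlinarith

/-- If all random sets of a phase are as expected, then so is the set of the remaining vertices. -/
theorem Tracked.succ (hW : P.Tracked j W) (hj : j < P.τ) (hR : P.GoodReference j W R)
    (hH : P.GoodHeavy j W R H) (hF : P.GoodFriends j W R H F) :
    P.Tracked (j + 1) (W \ (R ∪ H ∪ F)) := by
  have hd := P.d_pos j
  have hα := P.one_le_alpha
  have hε := P.ε_pos j
  have hset : W \ (R ∪ H ∪ F) = ((W \ R) \ H) \ F := by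
    rw [sdiff_sdiff_left, sdiff_sdiff_left, Finset.sup_eq_union, Finset.sup_eq_union, ← Finset.union_assoc]
  refine ⟨Finset.sdiff_subset.trans hW.subset, fun v hv l h1 h2 => ?_,
    fun k hk hkτ v hv he b => ?_⟩
  · rw [Finset.mem_sdiff, Finset.mem_union, Finset.mem_union] at hv
    rcases Nat.of_le_succ h2 with h2 | rfl
    · exact hW.eligible v hv.1 l h1 h2
    -- Passing from s (j+1) back to s j only increases the sum, so a survivor that is not eligible
    -- would have exceeded 3/4 of the old threshold and been put into H.
    · by_contra! hcon
      refine hv.2 (Or.inl (Or.inr (hH.heavy v hv.1 ?_)))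
      have h3 := Finset.sum_le_sum fun u (_ : u ∈ nbrs P.G P.U v) => P.s_succ_le j u
      calc 3 / 4 * (P.Δ / 2 ^ j) = 3 / 2 * (P.Δ / 2 ^ (j + 1)) := by
            rw [pow_succ]
            ring
        _ < _ := hcon
        _ ≤ _ := h3
  · have hidx : P.Index j k v := ⟨hk, hkτ, hv, he⟩
    have hej : P.Eligible j v := he.mono (by omega)
    have hcard := hW.card_le hj.le hv hej
    have hsub1 : W \ R ⊆ W := Finset.sdiff_subset
    have hsub2 : (W \ R) \ H ⊆ W := Finset.sdiff_subset.trans hsub1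
    have hcard1 : ((nbrs P.G (W \ R) v).card : ℝ) ≤ 2 * P.d j :=
      (Nat.cast_le.2 (Finset.card_le_card (nbrs_mono hsub1 v))).trans hcard
    have hcard2 : ((nbrs P.G ((W \ R) \ H) v).card : ℝ) ≤ 2 * P.d j :=
      (Nat.cast_le.2 (Finset.card_le_card (nbrs_mono hsub2 v))).trans hcard
    have hg : ∀ u, 0 ≤ P.wt (j + 1) k u * P.test b k u ∧ P.wt (j + 1) k u * P.test b k u ≤ 1 :=
      fun u => mul_mem (P.wt_mem _ _ u) (P.test_mem b k u)
    have hg2 := fun u => mul_mem (one_sub_mem (P.f_mem j u)) (hg u)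
    -- The chain of estimates: tracking (e0), three concentration steps (e1, e2, e3), and two
    -- replacements of actual selection probabilities by mean-field ones (a2, a3). The total is at
    -- most (ε_j + 3ε₀ + 4αε_j) d_j.
    have e0 := hW.close k (by omega) hkτ v hv he b
    have e1 := hR.close k v b hidx
    have e2 := hH.close k v b hidx
    have e3 := hF k v b hidx
    have a2 := sum_abs_le (x := fun u => 1 - P.pH j R u) (y := fun u => 1 - P.h j u)
      (c := alpha (Fintype.card V) * P.ε j) hcard1 (by positivity) hg2 fun u hu => by
        rw [sub_sub_sub_cancel_left, abs_sub_comm]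
        exact abs_pH_sub_le hW hj.le hR (hsub1 (nbrs_subset _ _ _ hu))
    have a3 := sum_abs_le (x := fun u => 1 - P.pF j H u) (y := fun u => 1 - P.f j u)
      (c := alpha (Fintype.card V) * P.ε j) hcard2 (by positivity) hg fun u hu => by
        rw [sub_sub_sub_cancel_left, abs_sub_comm]
        exact abs_pF_sub_le hW hj.le hR hH (hsub2 (nbrs_subset _ _ _ hu))
    have hwt : ∑ u ∈ nbrs P.G W v, P.wt j k u * P.test b k u = ∑ u ∈ nbrs P.G W v,
        (1 - P.μ) * ((1 - P.h j u) * ((1 - P.f j u) * (P.wt (j + 1) k u * P.test b k u))) :=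
      Finset.sum_congr rfl fun u _ => by
        rw [wt_eq_mul (by omega)]
        ring
    rw [hwt] at e0
    have h7 := mul_le_mul_of_nonneg_right (P.ε_zero_le j) hd.le
    rw [hset, P.ε_succ, d_succ]
    have h8 : 0 ≤ (alpha (Fintype.card V) - 1) * (P.ε j * P.d j) :=
      mul_nonneg (by linarith) (by positivity)
    rw [abs_le] at e0 e1 e2 e3 a2 a3 ⊢
    constructor <;> nlinarith [e0.1, e0.2, e1.1, e1.2, e2.1, e2.2, e3.1, e3.2, a2.1, a2.2, a3.1,
      a3.2]

end Deterministic

end MeanField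

namespace MeanField

variable {V : Type*} [Fintype V] {P : MeanField V} {j k : ℕ} {u v : V} {W : Finset V} {b : Bool}

/-! #### The random sets of a phase are as expected with high probability -/

/-- A bound on the probability that a single random weight is not as expected. -/
noncomputable def q (_P : MeanField V) : ℝ := 2 * Real.exp (-(10 * Real.log (Fintype.card V)))

theorem q_nonneg (P : MeanField V) : 0 ≤ P.q := by
  unfold q
  positivity

theorem deviation_le (hj : j ≤ P.τ) {M : ℝ} (hM : 2 * (P.μ * P.d j) ≤ M) :
    2 * Real.exp (-((P.ε 0 / 4) ^ 2 * M)) ≤ P.q := by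
  have h1 := P.concentrated j hj
  have h2 := mul_le_mul_of_nonneg_left hM (sq_nonneg (P.ε 0 / 4))
  have h3 : Real.exp (-((P.ε 0 / 4) ^ 2 * M)) ≤ Real.exp (-(10 * Real.log (Fintype.card V))) := by
    apply Real.exp_le_exp.2
    rw [d] at h2
    linarith
  unfold q
  linarith

theorem deviation_le' (hj : j ≤ P.τ) :
    2 * Real.exp (-((P.ε 0 / 4) ^ 2 * (2 * P.d j))) ≤ P.q :=
  deviation_le hj (mul_le_mul_of_nonneg_left
    (mul_le_of_le_one_left (P.d_pos j).le P.μ_le_one) (by norm_num))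

theorem ε_div_mem (P : MeanField V) : 0 ≤ P.ε 0 / 4 ∧ P.ε 0 / 4 ≤ 1 := by
  have h1 := P.ε_zero_pos
  have h2 := P.ε_le 0 (Nat.zero_le _)
  constructor <;> linarith

/-- Puts the tracked weights into a finite type, for the union bound. -/
theorem forall_index_iff {E : ℕ → V → Bool → Prop} :
    (∀ k v b, P.Index j k v → E k v b) ↔
      ∀ i : Fin (P.τ + 1) × V × Bool, P.Index j i.1 i.2.1 → E i.1 i.2.1 i.2.2 := by
  refine ⟨fun h i hi => h _ _ _ hi, fun h k v b hk => ?_⟩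
  exact h (⟨k, Nat.lt_succ_of_le hk.2.1⟩, v, b) hk

theorem card_index_mul_le (P : MeanField V) :
    (Fintype.card (Fin (P.τ + 1) × V × Bool) : ℝ) * P.q
      ≤ 2 * (Fintype.card V : ℝ) ^ 2 * P.q := by
  refine mul_le_mul_of_nonneg_right ?_ P.q_nonneg
  simp only [Fintype.card_prod, Fintype.card_fin, Fintype.card_bool]
  have h : ((P.τ + 1 : ℕ) : ℝ) ≤ Fintype.card V := by exact_mod_cast P.τ_lt
  have h0 : (0 : ℝ) ≤ Fintype.card V := Nat.cast_nonneg _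
  push_cast at h ⊢
  nlinarith

theorem card_mul_le (P : MeanField V) :
    (Fintype.card V : ℝ) * P.q ≤ (Fintype.card V : ℝ) ^ 2 * P.q := by
  refine mul_le_mul_of_nonneg_right ?_ P.q_nonneg
  have h : (2 : ℝ) ≤ Fintype.card V := by exact_mod_cast P.two_le
  nlinarith

theorem pH_mem (P : MeanField V) (j : ℕ) (R : Finset V) (v : V) :
    0 ≤ P.pH j R v ∧ P.pH j R v ≤ 1 :=
  muH_nonneg_le_one P.two_le _

theorem pF_mem (P : MeanField V) (j : ℕ) (H : Finset V) (v : V) :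
    0 ≤ P.pF j H v ∧ P.pF j H v ≤ 1 :=
  muF_nonneg_le_one _

/-- A bound on the probability that a phase is not as expected. -/
noncomputable def δ (P : MeanField V) : ℝ := 9 * (Fintype.card V : ℝ) ^ 2 * P.q

theorem δ_nonneg (P : MeanField V) : 0 ≤ P.δ := by
  have := P.q_nonneg
  unfold δ
  positivity

variable [DecidableEq V] {R H : Finset V}

/-- A union bound over at most n degrees and 2n² weights. Each Chernoff bound uses l = ε₀/4 with M =
2μd or M = 2d, so that 2lM is the admitted deviation. -/
theorem pr_not_goodReference_le (hW : P.Tracked j W) (hj : j < P.τ) :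
    pr (randomSubset W fun _ => P.μ) (fun R => ¬ P.GoodReference j W R)
      ≤ 3 * (Fintype.card V : ℝ) ^ 2 * P.q := by
  have h0 : ∀ v ∈ W, (0 : ℝ) ≤ P.μ := fun _ _ => P.μ_pos.le
  have h1 : ∀ v ∈ W, P.μ ≤ 1 := fun _ _ => P.μ_le_one
  obtain ⟨l0, l1⟩ := P.ε_div_mem
  have hA := pr_not_forall_le (randomSubset W fun _ => P.μ) (fun v => v ∈ W)
    (fun v R => |((nbrs P.G R v).card : ℝ) - P.μ * (nbrs P.G W v).card| ≤ P.ε 0 * (P.μ * P.d j))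
    P.q_nonneg fun v hv => by
      have hM : ∑ u ∈ nbrs P.G W v, P.μ * 1 ≤ 2 * (P.μ * P.d j) := by
        rw [Finset.sum_const, nsmul_eq_mul]
        have := mul_le_mul_of_nonneg_left
          (hW.card_le hj.le (hW.subset hv) (hW.eligible v hv)) P.μ_pos.le
        linarith
      refine le_trans (pr_mono_support _ fun R hR h => ?_)
        ((pr_randomSubset_inter (p := fun _ => P.μ) (g := fun _ => 1) (nbrs_subset P.G W v) h0 h1
          (fun _ => by norm_num) hM l0 l1).trans (deviation_le hj.le le_rfl))
      rw [← nbrs_eq_inter (randomSubset_subset hR)]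
      convert h using 2
      · simp [mul_comm]
      · ring
  have hB := pr_not_forall_le (randomSubset W fun _ => P.μ)
    (fun i : Fin (P.τ + 1) × V × Bool => P.Index j i.1 i.2.1)
    (fun i R => |∑ u ∈ nbrs P.G (W \ R) i.2.1,
        (1 - P.h j u) * ((1 - P.f j u) * (P.wt (j + 1) i.1 u * P.test i.2.2 i.1 u))
      - ∑ u ∈ nbrs P.G W i.2.1,
        (1 - P.μ) * ((1 - P.h j u) * ((1 - P.f j u) * (P.wt (j + 1) i.1 u * P.test i.2.2 i.1 u)))|
      ≤ P.ε 0 * P.d j) P.q_nonneg fun i hi => by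
      refine le_trans (pr_mono _ fun R h => ?_)
        ((pr_randomSubset_sdiff (p := fun _ => P.μ) (nbrs_subset P.G W i.2.1) h0 h1
          (fun u => mul_mem (one_sub_mem (P.h_mem j u)) (mul_mem (one_sub_mem (P.f_mem j u))
            (mul_mem (P.wt_mem (j + 1) i.1 u) (P.test_mem i.2.2 i.1 u))))
          (hW.card_le hj.le hi.2.2.1 (hi.2.2.2.mono hi.1.le)) l0 l1).trans (deviation_le' hj.le))
      rw [nbrs_sdiff] at h
      convert h using 2
      ring
  refine (pr_mono _ fun R h => ?_).trans ((pr_not_and_le _ _ _).trans (add_le_add hA hB) |>.trans ?_)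
  · exact fun h' => h ⟨h'.1, forall_index_iff.2 h'.2⟩
  · linarith [P.card_index_mul_le, P.card_mul_le]

/-- Once R is fixed, the vertices enter H independently with the probabilities `pH`, and N(v) ∩ (W \
R) is a fixed set to which the Chernoff bound applies. -/
theorem pr_not_goodHeavy_le (hW : P.Tracked j W) (hj : j < P.τ) (hR : P.GoodReference j W R) :
    pr (randomSubset W (P.pH j R)) (fun H => ¬ P.GoodHeavy j W R H)
      ≤ 4 * (Fintype.card V : ℝ) ^ 2 * P.q := by
  have h0 : ∀ v ∈ W, 0 ≤ P.pH j R v := fun v _ => (P.pH_mem j R v).1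
  have h1 : ∀ v ∈ W, P.pH j R v ≤ 1 := fun v _ => (P.pH_mem j R v).2
  obtain ⟨l0, l1⟩ := P.ε_div_mem
  have hA := pr_not_forall_le (randomSubset W (P.pH j R)) (fun v => v ∈ W)
    (fun v H => |((nbrs P.G H v).card : ℝ) - ∑ u ∈ nbrs P.G W v, P.pH j R u| ≤ P.ε 0 * P.d j)
    P.q_nonneg fun v hv => by
      have hM : ∑ u ∈ nbrs P.G W v, P.pH j R u * 1 ≤ 2 * P.d j := by
        refine le_trans (Finset.sum_le_sum fun u _ => mul_le_one₀ (P.pH_mem j R u).2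
          zero_le_one le_rfl) ?_
        simpa using hW.card_le hj.le (hW.subset hv) (hW.eligible v hv)
      refine le_trans (pr_mono_support _ fun H hH h => ?_)
        ((pr_randomSubset_inter (g := fun _ => 1) (nbrs_subset P.G W v) h0 h1
          (fun _ => by norm_num) hM l0 l1).trans (deviation_le' hj.le))
      rw [← nbrs_eq_inter (randomSubset_subset hH)]
      convert h using 2
      · simp
      · ring
  have hB := pr_not_forall_le (randomSubset W (P.pH j R))
    (fun i : Fin (P.τ + 1) × V × Bool => P.Index j i.1 i.2.1)
    (fun i H => |∑ u ∈ nbrs P.G ((W \ R) \ H) i.2.1,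
        (1 - P.f j u) * (P.wt (j + 1) i.1 u * P.test i.2.2 i.1 u)
      - ∑ u ∈ nbrs P.G (W \ R) i.2.1,
        (1 - P.pH j R u) * ((1 - P.f j u) * (P.wt (j + 1) i.1 u * P.test i.2.2 i.1 u))|
      ≤ P.ε 0 * P.d j) P.q_nonneg fun i hi => by
      refine le_trans (pr_mono _ fun H h => ?_)
        ((pr_randomSubset_sdiff (Y := nbrs P.G (W \ R) i.2.1)
          ((nbrs_subset _ _ _).trans Finset.sdiff_subset) h0 h1
          (fun u => mul_mem (one_sub_mem (P.f_mem j u))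
            (mul_mem (P.wt_mem (j + 1) i.1 u) (P.test_mem i.2.2 i.1 u)))
          ((Nat.cast_le.2 (Finset.card_le_card (nbrs_mono Finset.sdiff_subset _))).trans
            (hW.card_le hj.le hi.2.2.1 (hi.2.2.2.mono hi.1.le))) l0 l1).trans
          (deviation_le' hj.le))
      rw [nbrs_sdiff] at h
      convert h using 2
      ring
  -- The ratio seen through R is at least 3/4 - ε_j - ε₀ ≥ 23/32, so v is missed with probability at
  -- most n⁻¹⁰.
  have hC := pr_not_forall_le (randomSubset W (P.pH j R))
    (fun v => v ∈ W ∧ 3 / 4 * (P.Δ / 2 ^ j) < ∑ u ∈ nbrs P.G P.U v, P.s j u) (fun v H => v ∈ H)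
    P.q_nonneg fun v hv => by
      rw [pr_notMem_randomSubset hv.1 (h0 v hv.1) (h1 v hv.1)]
      have h2 := (abs_le.1 (hR.abs_ratio_sub_le hv.1)).1
      have h3 := (abs_le.1 (hW.abs_ratio_sub_le hj.le (hW.subset hv.1) (hW.eligible v hv.1))).1
      have h4 : 3 / 4 < (∑ u ∈ nbrs P.G P.U v, P.s j u) / (P.Δ / 2 ^ j) := by
        rw [lt_div_iff₀ (div_pos P.Δ_pos (by positivity))]
        exact hv.2
      have h5 := P.ε_le 0 (Nat.zero_le _)
      have h6 := P.ε_le j hj.le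
      refine (one_sub_muH_le_of_le P.two_le (by linarith)).trans ?_
      unfold q
      linarith [Real.exp_pos (-(10 * Real.log (Fintype.card V)))]
  refine (pr_mono _ fun H h => ?_).trans ((pr_not_and_le _ _ _).trans
    (add_le_add hA ((pr_not_and_le _ _ _).trans (add_le_add hB hC))) |>.trans ?_)
  · exact fun h' => h ⟨h'.1, forall_index_iff.2 h'.2.1, fun v h1 h2 => h'.2.2 v ⟨h1, h2⟩⟩
  · linarith [P.card_index_mul_le, P.card_mul_le]

/-- A vertex of degree below d/4 has a ratio of at most 1/4 + 1/64 < 9/32 as seen through R. -/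
theorem pr_exists_light_le (hR : P.GoodReference j W R) :
    pr (randomSubset W (P.pH j R)) (fun H => ∃ v ∈ H, ((nbrs P.G W v).card : ℝ) < P.d j / 4)
      ≤ (Fintype.card V : ℝ) ^ 2 * P.q := by
  have h := pr_not_forall_le (randomSubset W (P.pH j R))
    (fun v => v ∈ W ∧ ((nbrs P.G W v).card : ℝ) < P.d j / 4) (fun v H => v ∉ H)
    P.q_nonneg fun v hv => by
      simp only [not_not]
      rw [pr_mem_randomSubset hv.1 (P.pH_mem j R v).1 (P.pH_mem j R v).2]
      have h2 := (abs_le.1 (hR.abs_ratio_sub_le hv.1)).2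
      have h4 : ((nbrs P.G W v).card : ℝ) / P.d j < 1 / 4 := by
        rw [div_lt_iff₀ (P.d_pos j)]
        linarith [hv.2]
      have h5 := P.ε_le 0 (Nat.zero_le _)
      refine (muH_le_of_le P.two_le (by linarith)).trans ?_
      unfold q
      linarith [Real.exp_pos (-(10 * Real.log (Fintype.card V)))]
  refine (pr_mono_support _ fun H hH h' h2 => ?_).trans (h.trans P.card_mul_le)
  obtain ⟨v, hv, hlt⟩ := h'
  exact h2 v ⟨randomSubset_subset hH hv, hlt⟩ hv

theorem pr_not_goodFriends_le (hW : P.Tracked j W) (hj : j < P.τ) (R H : Finset V) :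
    pr (randomSubset W (P.pF j H)) (fun F => ¬ P.GoodFriends j W R H F)
      ≤ 2 * (Fintype.card V : ℝ) ^ 2 * P.q := by
  have h0 : ∀ v ∈ W, 0 ≤ P.pF j H v := fun v _ => (P.pF_mem j H v).1
  have h1 : ∀ v ∈ W, P.pF j H v ≤ 1 := fun v _ => (P.pF_mem j H v).2
  obtain ⟨l0, l1⟩ := P.ε_div_mem
  have hB := pr_not_forall_le (randomSubset W (P.pF j H))
    (fun i : Fin (P.τ + 1) × V × Bool => P.Index j i.1 i.2.1)
    (fun i F => |∑ u ∈ nbrs P.G (((W \ R) \ H) \ F) i.2.1,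
        P.wt (j + 1) i.1 u * P.test i.2.2 i.1 u
      - ∑ u ∈ nbrs P.G ((W \ R) \ H) i.2.1,
        (1 - P.pF j H u) * (P.wt (j + 1) i.1 u * P.test i.2.2 i.1 u)|
      ≤ P.ε 0 * P.d j) P.q_nonneg fun i hi => by
      have hsub : (W \ R) \ H ⊆ W := Finset.sdiff_subset.trans Finset.sdiff_subset
      refine le_trans (pr_mono _ fun F h => ?_)
        ((pr_randomSubset_sdiff (Y := nbrs P.G ((W \ R) \ H) i.2.1)
          ((nbrs_subset _ _ _).trans hsub) h0 h1
          (fun u => mul_mem (P.wt_mem (j + 1) i.1 u) (P.test_mem i.2.2 i.1 u))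
          ((Nat.cast_le.2 (Finset.card_le_card (nbrs_mono hsub _))).trans
            (hW.card_le hj.le hi.2.2.1 (hi.2.2.2.mono hi.1.le))) l0 l1).trans
          (deviation_le' hj.le))
      rw [nbrs_sdiff] at h
      convert h using 2
      ring
  refine (pr_mono _ fun F h => ?_).trans (hB.trans P.card_index_mul_le)
  exact fun h' => h (forall_index_iff.2 h')

variable {base : ℝ} {mm : Finset V → PMF (Finset (Sym2 V))}

theorem pr_not_tracked_succ_le (hμ : P.μ = muR base (Fintype.card V)) (hW : P.Tracked j W)
    (hj : j < P.τ) :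
    pr (localPhase base P.G mm (P.d j) W) (fun t => ¬ P.Tracked (j + 1) t.1) ≤ P.δ := by
  have hq := P.q_nonneg
  have hn : (0 : ℝ) ≤ (Fintype.card V : ℝ) ^ 2 := by positivity
  simp only [localPhase, ← hμ]
  -- The failure probabilities of the three stages are 3, 4 and 2 times n²q, which add up to δ.
  refine (pr_bind_le _ _ _ _ (ε := 4 * (Fintype.card V : ℝ) ^ 2 * P.q
    + 2 * (Fintype.card V : ℝ) ^ 2 * P.q) (by positivity)
    (pr_not_goodReference_le hW hj) fun R _ hR => ?_).trans_eq (by unfold δ; ring)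
  refine pr_bind_le _ _ _ _ (by positivity) (pr_not_goodHeavy_le hW hj hR) fun H _ hH => ?_
  refine (pr_bind_le _ _ _ _ le_rfl (pr_not_goodFriends_le hW hj R H) fun F _ hF => ?_).trans_eq
    (add_zero _)
  rw [pr_map, pr_eq_zero]
  intro M _ h
  exact h (hW.succ hj hR hH hF)

theorem le_ev_localPhase (hμ : P.μ = muR base (Fintype.card V))
    (hmm : ∀ W, ∀ M ∈ (mm W).support, IsMaximalMatching (inducedOn P.G W) M)
    (hW : P.Tracked j W) (hj : j < P.τ) (T : Finset V) :
    1 / 200 * ((1 - P.μ) * ((T ∩ W).card : ℝ) - Fintype.card V * P.δ)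
      ≤ ev (localPhase base P.G mm (P.d j) W) fun t =>
        (t.2.card : ℝ) + 1 / 200 * ((T ∩ t.1).card : ℝ) := by
  have hq := P.q_nonneg
  have hn : (0 : ℝ) ≤ (Fintype.card V : ℝ) ^ 2 := by positivity
  rw [hμ]
  refine RoundCompression.le_ev_localPhase (hμ ▸ ⟨P.μ_pos.le, P.μ_le_one⟩) hmm (P.d_pos j)
    (fun v hv => hW.card_le hj.le (hW.subset hv) (hW.eligible v hv)) ?_ T
  rw [← hμ]
  have h := pr_bind_le (randomSubset W fun _ => P.μ) (fun R => randomSubset W (P.pH j R))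
    (fun R => P.GoodReference j W R)
    (fun H => ¬ ∃ v ∈ H, ((nbrs P.G W v).card : ℝ) < P.d j / 4)
    (ε := (Fintype.card V : ℝ) ^ 2 * P.q) (by positivity)
    (pr_not_goodReference_le hW hj) fun R _ hR => by
      simp only [not_not]
      exact pr_exists_light_le hR
  simp only [not_not] at h
  rw [pr, ev_bind] at h
  refine h.trans ?_
  unfold δ
  nlinarith [mul_nonneg hn hq]

end MeanField

/-! ### The phases on one machine -/

section LocalRun

variable {V : Type*} [Fintype V] [DecidableEq V] {base : ℝ}
  {mm : Finset V → PMF (Finset (Sym2 V))}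

theorem localRun_support {G : SimpleGraph V}
    (hmm : ∀ W, ∀ M ∈ (mm W).support, IsMaximalMatching (inducedOn G W) M) {m : ℕ} {Δ : ℝ}
    {W : Finset V} (j : ℕ) {s : Finset V × Finset (Sym2 V)}
    (hs : s ∈ (localRun base G mm m Δ W j).support) : ReachedFrom G W s := by
  induction j generalizing s with
  | zero =>
    rw [localRun, PMF.support_pure, Set.mem_singleton_iff] at hs
    subst hs
    exact ReachedFrom.refl W
  | succ j ih =>
    simp only [localRun, PMF.mem_support_bind_iff, PMF.support_map, Set.mem_image] at hs
    obtain ⟨s', hs', t, ht, rfl⟩ := hs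
    exact (ih hs').trans (reachedFrom_of_mem_support_localPhase hmm ht)

variable {P : MeanField V} {W : Finset V}

theorem MeanField.pr_localRun_le (hμ : P.μ = muR base (Fintype.card V)) (hW : P.Tracked 0 W)
    {j : ℕ} (hj : j ≤ P.τ) :
    pr (localRun base P.G mm P.m P.Δ W j) (fun s => ¬ P.Tracked j s.1) ≤ j * P.δ := by
  induction j with
  | zero =>
    rw [pr_eq_zero]
    · simp
    · intro s hs h
      rw [localRun, PMF.support_pure, Set.mem_singleton_iff] at hs
      subst hs
      exact h hW
  | succ j ih =>
    rw [localRun]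
    refine (pr_bind_le _ _ _ _ P.δ_nonneg (ih (by omega)) fun s _ hs => ?_).trans_eq
      (by push_cast; ring)
    rw [pr_map]
    exact P.pr_not_tracked_succ_le hμ hs hj

/-- Besides the share μ|T ∩ W| for the reference set, phase j loses at most nδ to light vertices in
H and at most n · jδ to runs that went off track, whose vertices are written off. Since j + 1 ≤ n,
the last two are at most n²δ. -/
theorem MeanField.le_ev_localRun (hμ : P.μ = muR base (Fintype.card V))
    (hmm : ∀ W, ∀ M ∈ (mm W).support, IsMaximalMatching (inducedOn P.G W) M)
    (hW : P.Tracked 0 W) (T : Finset V) {j : ℕ} (hj : j ≤ P.τ) :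
    1 / 200 * ((T ∩ W).card - j * (P.μ * (T ∩ W).card + (Fintype.card V : ℝ) ^ 2 * P.δ))
      ≤ ev (localRun base P.G mm P.m P.Δ W j) fun s =>
        (s.2.card : ℝ) + 1 / 200 * ((T ∩ s.1).card : ℝ) := by
  classical
  induction j with
  | zero => simp [localRun, ev_pure]
  | succ j ih =>
    set n := Fintype.card V with hn
    have hδ := P.δ_nonneg
    have hpr := P.pr_localRun_le (mm := mm) hμ hW (j := j) (by omega)
    rw [localRun, ev_bind]
    have hstep : ev (localRun base P.G mm P.m P.Δ W j) (fun s =>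
        ((s.2.card : ℝ) + 1 / 200 * ((T ∩ s.1).card : ℝ)) +
          (-(1 / 200 * (P.μ * (T ∩ W).card + n * P.δ)) +
            (-(1 / 200 * n)) * if ¬ P.Tracked j s.1 then 1 else 0))
        ≤ ev (localRun base P.G mm P.m P.Δ W j) (fun s =>
          ev ((localPhase base P.G mm (P.Δ / (2 ^ j * P.m)) s.1).map fun t => (t.1, s.2 ∪ t.2))
            fun s => (s.2.card : ℝ) + 1 / 200 * ((T ∩ s.1).card : ℝ)) := by
      refine ev_mono_support _ fun s hs => ?_
      have hreach := localRun_support hmm j hs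
      have hTs : ((T ∩ s.1).card : ℝ) ≤ (T ∩ W).card := by
        exact_mod_cast Finset.card_le_card (Finset.inter_subset_inter_left hreach.1)
      have hTn : ((T ∩ s.1).card : ℝ) ≤ n := by exact_mod_cast Finset.card_le_univ _
      have hμT : P.μ * (T ∩ s.1).card ≤ P.μ * (T ∩ W).card :=
        mul_le_mul_of_nonneg_left hTs P.μ_pos.le
      have hμT0 : 0 ≤ P.μ * (T ∩ s.1).card := mul_nonneg P.μ_pos.le (Nat.cast_nonneg _)
      have hnδ : 0 ≤ n * P.δ := mul_nonneg (Nat.cast_nonneg _) hδ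
      have hsplit : (s.2.card : ℝ) + ev (localPhase base P.G mm (P.d j) s.1) (fun t =>
          (t.2.card : ℝ) + 1 / 200 * ((T ∩ t.1).card : ℝ))
          ≤ ev ((localPhase base P.G mm (P.Δ / (2 ^ j * P.m)) s.1).map fun t => (t.1, s.2 ∪ t.2))
            fun s => (s.2.card : ℝ) + 1 / 200 * ((T ∩ s.1).card : ℝ) := by
        rw [ev_map, ← ev_const_add]
        refine ev_mono_support _ fun t ht => ?_
        rw [hreach.card_union (reachedFrom_of_mem_support_localPhase hmm ht)]
        push_cast
        linarith
      refine le_trans ?_ hsplit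
      by_cases h : P.Tracked j s.1
      · have := P.le_ev_localPhase hμ hmm h (by omega) T
        rw [if_neg (not_not.2 h)]
        linarith
      · have : 0 ≤ ev (localPhase base P.G mm (P.d j) s.1) (fun t =>
          (t.2.card : ℝ) + 1 / 200 * ((T ∩ t.1).card : ℝ)) := ev_nonneg _ fun t => by positivity
        rw [if_pos h]
        linarith
    refine le_trans ?_ hstep
    rw [ev_add, ev_const_add, ev_const_mul, ← pr_eq_ev]
    have hjn : ((j + 1 : ℕ) : ℝ) ≤ n := by exact_mod_cast hj.trans P.τ_lt.le
    have h1 : (n : ℝ) * (pr (localRun base P.G mm P.m P.Δ W j) fun s => ¬ P.Tracked j s.1)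
        ≤ n * (j * P.δ) := mul_le_mul_of_nonneg_left hpr (Nat.cast_nonneg _)
    have h2 : n * P.δ + n * (j * P.δ) ≤ (n : ℝ) ^ 2 * P.δ := by
      have := mul_le_mul_of_nonneg_right hjn (mul_nonneg (Nat.cast_nonneg (α := ℝ) n) hδ)
      push_cast at this
      linarith
    have h3 := ih (by omega)
    push_cast
    linarith

end LocalRun

/-! ### The parameters of an iteration of the main loop -/

section Parameters

variable {n S : ℕ} {Δ b : ℝ}

theorem one_le_cast_div (hS : 1 ≤ S) (hSn : S ≤ n) : (1 : ℝ) ≤ (n : ℝ) / S := by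
  rw [one_le_div (by exact_mod_cast hS)]
  exact_mod_cast hSn

/-- The loop condition forces (200 L)³² ≤ n for L = log n, that is, L ≥ 32 log (200 L). Starting
from L > 0.69, two rounds with 2⁶ ≤ 200 L and 2¹⁴ ≤ 200 L suffice. The slack in all later constants
comes from here. -/
theorem LoopCond.log_ge (h : LoopCond n S Δ) (hn : 2 ≤ n) (hS : 1 ≤ S) (hSn : S ≤ n)
    (hΔ : Δ ≤ n) : 300 ≤ Real.log n := by
  have hn' : (2 : ℝ) ≤ n := by exact_mod_cast hn
  set L := Real.log n with hL
  have hlog2 := Real.log_two_gt_d9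
  have hL0 : 0.69 < L :=
    lt_of_lt_of_le (by linarith) (Real.log_le_log (by norm_num) hn')
  have h1 : (200 * L) ^ 32 ≤ n := by
    refine le_trans ?_ (h.trans hΔ)
    exact le_mul_of_one_le_left (by positivity) (one_le_cast_div hS hSn)
  have key : ∀ k : ℕ, (2 : ℝ) ^ k ≤ 200 * L → 32 * (k * 0.69) ≤ L := by
    intro k hk
    have h2 : ((2 : ℝ) ^ k) ^ 32 ≤ n := (pow_le_pow_left₀ (by positivity) hk 32).trans h1
    have h3 := Real.log_le_log (by positivity) h2
    rw [Real.log_pow, Real.log_pow] at h3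
    have : (k : ℝ) * 0.69 ≤ k * Real.log 2 :=
      mul_le_mul_of_nonneg_left (by linarith) (Nat.cast_nonneg _)
    push_cast at h3
    linarith
  have h6 := key 6 (by norm_num; linarith)
  have h14 := key 14 (by norm_num at h6 ⊢; linarith)
  norm_num at h14
  linarith

theorem sqrt_ge_of_loopCond (h : LoopCond n S Δ) (hn : 2 ≤ n) (hS : 1 ≤ S) (hSn : S ≤ n)
    (hΔ : Δ ≤ n) : 100 ≤ Real.sqrt (n * Δ / S) := by
  have hL := h.log_ge hn hS hSn hΔ
  have h1 := one_le_cast_div hS hSn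
  have h2 : (100 : ℝ) ^ 2 ≤ (200 * Real.log n) ^ 32 :=
    calc (100 : ℝ) ^ 2 ≤ 100 ^ 32 := pow_le_pow_right₀ (by norm_num) (by norm_num)
      _ ≤ _ := pow_le_pow_left₀ (by norm_num) (by linarith) 32
  have h3 : (100 : ℝ) ^ 2 ≤ Δ := (h2.trans (le_mul_of_one_le_left (by positivity) h1)).trans h
  apply Real.le_sqrt_of_sq_le
  rw [show (n : ℝ) * Δ / S = n / S * Δ by ring]
  exact h3.trans (le_mul_of_one_le_left (by linarith) h1)

theorem LoopCond.pos (h : LoopCond n S Δ) (hn : 2 ≤ n) (hS : 1 ≤ S) (hSn : S ≤ n)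
    (hΔ : Δ ≤ n) : 0 < Δ := by
  have hL := h.log_ge hn hS hSn hΔ
  have h1 := one_le_cast_div hS hSn
  exact lt_of_lt_of_le (by positivity) h

theorem numMachines_sq_le (h : LoopCond n S Δ) (hn : 2 ≤ n) (hS : 1 ≤ S) (hSn : S ≤ n)
    (hΔ : Δ ≤ n) : (numMachines n S Δ : ℝ) ^ 2 ≤ n * Δ / S := by
  have hΔ0 := h.pos hn hS hSn hΔ
  have h1 : (numMachines n S Δ : ℝ) ≤ Real.sqrt (n * Δ / S) := Nat.floor_le (Real.sqrt_nonneg _)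
  calc (numMachines n S Δ : ℝ) ^ 2 ≤ Real.sqrt (n * Δ / S) ^ 2 :=
        pow_le_pow_left₀ (Nat.cast_nonneg _) h1 2
    _ = _ := Real.sq_sqrt (by positivity)

/-- Rounding down costs little because the square root is at least 100. -/
theorem le_two_mul_numMachines_sq (h : LoopCond n S Δ) (hn : 2 ≤ n) (hS : 1 ≤ S) (hSn : S ≤ n)
    (hΔ : Δ ≤ n) : n * Δ / S ≤ 2 * (numMachines n S Δ : ℝ) ^ 2 := by
  have hΔ0 := h.pos hn hS hSn hΔ
  have h1 : Real.sqrt (n * Δ / S) - 1 < numMachines n S Δ := Nat.sub_one_lt_floor _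
  have h2 := sqrt_ge_of_loopCond h hn hS hSn hΔ
  have h3 : Real.sqrt (n * Δ / S) ^ 2 = n * Δ / S := Real.sq_sqrt (by positivity)
  nlinarith

theorem numMachines_pos (h : LoopCond n S Δ) (hn : 2 ≤ n) (hS : 1 ≤ S) (hSn : S ≤ n)
    (hΔ : Δ ≤ n) : 0 < numMachines n S Δ :=
  Nat.floor_pos.2 (by linarith [sqrt_ge_of_loopCond h hn hS hSn hΔ])

theorem numMachines_le (h : LoopCond n S Δ) (hn : 2 ≤ n) (hS : 1 ≤ S) (hSn : S ≤ n)
    (hΔ : Δ ≤ n) : numMachines n S Δ ≤ n := by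
  have hΔ0 := h.pos hn hS hSn hΔ
  have h1 := numMachines_sq_le h hn hS hSn hΔ
  have h2 : (n : ℝ) * Δ / S ≤ (n : ℝ) ^ 2 := by
    rw [div_le_iff₀ (by exact_mod_cast hS)]
    have : (1 : ℝ) ≤ S := by exact_mod_cast hS
    nlinarith [Nat.cast_nonneg (α := ℝ) n]
  have h3 : (numMachines n S Δ : ℝ) ≤ n :=
    (sq_le_sq₀ (Nat.cast_nonneg _) (Nat.cast_nonneg _)).1 (h1.trans h2)
  exact_mod_cast h3

/-- The sixteenth root `y` of the initial threshold on a machine dominates all other parameters. -/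
theorem exists_root (h : LoopCond n S Δ) (hn : 2 ≤ n) (hS : 1 ≤ S) (hSn : S ≤ n) (hΔ : Δ ≤ n) :
    ∃ y : ℝ, 200 * Real.log n ≤ y ∧ y ^ 16 = Δ / numMachines n S Δ ∧ 1 ≤ numPhases n S Δ ∧
      (120 * alpha n) ^ numPhases n S Δ ≤ 120 * alpha n * y ∧
      2 ^ numPhases n S Δ ≤ 2 * y := by
  have hL := h.log_ge hn hS hSn hΔ
  have hΔ0 := h.pos hn hS hSn hΔ
  have hm := numMachines_pos h hn hS hSn hΔ
  have hm' : (0 : ℝ) < numMachines n S Δ := by exact_mod_cast hm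
  have hS' : (0 : ℝ) < S := by exact_mod_cast hS
  have hn' : (0 : ℝ) < n := by exact_mod_cast (by omega : 0 < n)
  set x := Δ / numMachines n S Δ with hx
  have hx0 : 0 < x := by positivity
  -- From m² ≤ nΔ/S it follows that (Δ/m)² ≥ ΔS/n, which is at least (200 ln n)³² by the loop
  -- condition.
  have hxge : (200 * Real.log n) ^ 16 ≤ x := by
    rw [← sq_le_sq₀ (by positivity) hx0.le, ← pow_mul, hx, div_pow,
      le_div_iff₀ (by positivity)]
    have h1 := numMachines_sq_le h hn hS hSn hΔ
    unfold LoopCond at h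
    calc (200 * Real.log n) ^ (16 * 2) * (numMachines n S Δ : ℝ) ^ 2
        ≤ (200 * Real.log n) ^ 32 * (n * Δ / S) :=
          mul_le_mul_of_nonneg_left h1 (by positivity)
      _ = (n / S * (200 * Real.log n) ^ 32) * Δ := by ring
      _ ≤ Δ * Δ := mul_le_mul_of_nonneg_right h hΔ0.le
      _ = Δ ^ 2 := (sq Δ).symm
  set y := x ^ (1 / 16 : ℝ) with hy
  have hy0 : 0 < y := Real.rpow_pos_of_pos hx0 _
  have hyx : y ^ 16 = x := by
    rw [hy, ← Real.rpow_natCast, ← Real.rpow_mul hx0.le]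
    norm_num
  have hyge : 200 * Real.log n ≤ y := by
    refine (pow_le_pow_iff_left₀ (by linarith) hy0.le (n := 16) (by norm_num)).1 ?_
    rw [hyx]
    exact hxge
  set B := 120 * alpha n with hB
  have hB1 : 4 ≤ B := by
    rw [hB, alpha]
    linarith
  have hlogB : 0 < Real.log B := Real.log_pos (by linarith)
  have hlogy : 1 / 16 * Real.logb B x = Real.log y / Real.log B := by
    rw [← hyx, Real.logb, Real.log_pow]
    push_cast
    ring
  have hτ : numPhases n S Δ = ⌈Real.log y / Real.log B⌉₊ := by
    rw [numPhases, ← hx, ← hB, hlogy]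
  have hlogy0 : 0 < Real.log y := Real.log_pos (by linarith)
  have hpow : B ^ numPhases n S Δ ≤ B * y := by
    rw [← Real.log_le_log_iff (by positivity) (by positivity), Real.log_pow,
      Real.log_mul (by positivity) hy0.ne']
    have h1 : (numPhases n S Δ : ℝ) < Real.log y / Real.log B + 1 := by
      rw [hτ]
      exact Nat.ceil_lt_add_one (by positivity)
    have h2 := mul_le_mul_of_nonneg_right h1.le hlogB.le
    have h3 : (Real.log y / Real.log B + 1) * Real.log B = Real.log B + Real.log y := by
      field_simp
      ring
    linarith
  have hτ1 : 1 ≤ numPhases n S Δ := by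
    rw [hτ]
    exact Nat.one_le_ceil_iff.2 (by positivity)
  refine ⟨y, hyge, hyx, hτ1, hpow, ?_⟩
  -- Since τ ≥ 1, a factor B/2 can be split off from Bᵗ = 2ᵗ (B/2)ᵗ ≤ By, where t = τ.
  have h1 : B / 2 ≤ (B / 2) ^ numPhases n S Δ := le_self_pow₀ (by linarith) (by omega)
  have h2 : 2 ^ numPhases n S Δ * (B / 2) ≤ B * y := by
    calc (2 : ℝ) ^ numPhases n S Δ * (B / 2) ≤ 2 ^ numPhases n S Δ * (B / 2) ^ numPhases n S Δ :=
          mul_le_mul_of_nonneg_left h1 (by positivity)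
      _ = B ^ numPhases n S Δ := by
          rw [← mul_pow]
          congr 1
          ring
      _ ≤ B * y := hpow
  nlinarith

theorem logb_bounds (hn : 2 ≤ n) (hb : b = 2 ∨ b = Real.exp 1) :
    Real.log n ≤ Real.logb b n ∧ Real.logb b n ≤ 2 * Real.log n := by
  have hL : 0 < Real.log n := Real.log_pos (by exact_mod_cast hn)
  rcases hb with rfl | rfl
  · have h1 := Real.log_two_gt_d9
    have h2 := Real.log_two_lt_d9
    rw [Real.logb]
    constructor
    · rw [le_div_iff₀ (by linarith)]
      nlinarith
    · rw [div_le_iff₀ (by linarith)]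
      nlinarith
  · rw [Real.logb, Real.log_exp, div_one]
    constructor <;> linarith

theorem muR_bounds (hn : 2 ≤ n) (hb : b = 2 ∨ b = Real.exp 1) :
    1 / (2 * 10 ^ 6 * Real.log n) ≤ muR b n ∧ muR b n ≤ 1 / (10 ^ 6 * Real.log n) := by
  have hL : 0 < Real.log n := Real.log_pos (by exact_mod_cast hn)
  obtain ⟨h1, h2⟩ := logb_bounds hn hb
  rw [muR, ← one_div]
  constructor
  · apply one_div_le_one_div_of_le
    · have : 0 < Real.logb b n := by linarith
      positivity
    · linarith
  · apply one_div_le_one_div_of_le (by positivity)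
    linarith

/-- By 2 ^ τ ≤ 2y ≤ y¹⁶ = Δ/m. It keeps the threshold at least 1 throughout, and so bounds the total
number of phases by log₂ n. -/
theorem two_pow_numPhases_le (h : LoopCond n S Δ) (hn : 2 ≤ n) (hS : 1 ≤ S) (hSn : S ≤ n)
    (hΔ : Δ ≤ n) : 2 ^ numPhases n S Δ ≤ Δ := by
  have hL := h.log_ge hn hS hSn hΔ
  have hΔ0 := h.pos hn hS hSn hΔ
  have hm : (1 : ℝ) ≤ numMachines n S Δ := by exact_mod_cast numMachines_pos h hn hS hSn hΔ
  obtain ⟨y, hy1, hy2, -, -, hy5⟩ := exists_root h hn hS hSn hΔ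
  have h1 : 2 * y ≤ y ^ 2 := by nlinarith
  have h2 : y ^ 2 ≤ y ^ 16 := pow_le_pow_right₀ (by linarith) (by norm_num)
  have h3 : Δ / numMachines n S Δ ≤ Δ := div_le_self hΔ0.le hm
  linarith

theorem numPhases_lt (h : LoopCond n S Δ) (hn : 2 ≤ n) (hS : 1 ≤ S) (hSn : S ≤ n)
    (hΔ : Δ ≤ n) : numPhases n S Δ < n := by
  have h1 := (two_pow_numPhases_le h hn hS hSn hΔ).trans hΔ
  have h2 : 2 ^ numPhases n S Δ ≤ n := by exact_mod_cast h1
  exact Nat.lt_two_pow_self.trans_le h2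

/-- The mean-field approximation exists in every iteration of the main loop. -/
theorem exists_meanField {V : Type*} [Fintype V] {G : SimpleGraph V} {U : Finset V}
    (h : LoopCond (Fintype.card V) S Δ) (hn : 2 ≤ Fintype.card V) (hS : 1 ≤ S)
    (hSn : S ≤ Fintype.card V) (hΔ : Δ ≤ Fintype.card V) (hb : b = 2 ∨ b = Real.exp 1)
    (hdeg : ∀ v ∈ U, ((nbrs G U v).card : ℝ) ≤ 7 / 4 * Δ) :
    ∃ P : MeanField V, P.G = G ∧ P.U = U ∧ P.μ = muR b (Fintype.card V) ∧ P.Δ = Δ ∧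
      P.m = numMachines (Fintype.card V) S Δ ∧ P.τ = numPhases (Fintype.card V) S Δ := by
  set n := Fintype.card V with hnV
  set μ := muR b n with hμ
  have hL := h.log_ge hn hS hSn hΔ
  obtain ⟨hμ1, hμ2⟩ := muR_bounds (b := b) hn hb
  obtain ⟨y, hy1, hy2, hτ1, hy4, hy5⟩ := exists_root h hn hS hSn hΔ
  have hy0 : 0 < y := by linarith
  have hα : alpha n = 96 * Real.log n := rfl
  -- In each phase h depends only on s, and f only on s and h, so a single recursion for s defines
  -- all three.
  let hh : ℕ → (V → ℝ) → V → ℝ := fun k s v =>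
    muH n ((∑ u ∈ nbrs G U v, s u) / (Δ / 2 ^ k))
  let ff : ℕ → (V → ℝ) → V → ℝ := fun k s v =>
    muF ((∑ u ∈ nbrs G U v, s u * hh k s u) / (Δ / 2 ^ k))
  let ss : ℕ → V → ℝ := fun k => Nat.rec (fun _ => 1)
    (fun k s v => s v * ((1 - μ) * (1 - hh k s v) * (1 - ff k s v))) k
  refine ⟨{ G := G, U := U, μ := μ, Δ := Δ, m := numMachines n S Δ, τ := numPhases n S Δ
            -- The exponent 6 balances two demands: the final error is at most 120αy · y⁻⁶ ≤ 60y⁻⁴,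
            -- while ε₀²μd remains of order at least y⁻¹² · y¹⁵ / log n, well above log n.
            ε := fun k => (120 * alpha n) ^ k * (y ^ 6)⁻¹
            s := ss, h := fun k => hh k (ss k), f := fun k => ff k (ss k)
            two_le := hn
            one_le_alpha := by rw [← hnV, hα]; linarith
            μ_pos := lt_of_lt_of_le (by positivity) hμ1
            μ_le_one := hμ2.trans (by
              rw [div_le_one (by positivity)]
              linarith)
            Δ_pos := h.pos hn hS hSn hΔ
            m_pos := numMachines_pos h hn hS hSn hΔ
            τ_lt := numPhases_lt h hn hS hSn hΔ
            deg_le := hdeg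
            s_zero := fun _ => rfl
            s_succ := fun _ _ => rfl
            h_eq := fun _ _ => rfl
            f_eq := fun _ _ => rfl
            ε_zero_pos := by positivity
            ε_succ := fun k => by rw [pow_succ]; ring
            ε_le := fun k hk => ?_
            concentrated := fun k hk => ?_ }, rfl, rfl, rfl, rfl, rfl, rfl⟩
  · have h1 : (120 * alpha n) ^ k ≤ 120 * alpha n * y :=
      (pow_le_pow_right₀ (by rw [hα]; linarith) hk).trans hy4
    have h2 : 120 * alpha n * y ≤ 60 * y ^ 2 := by
      rw [hα]
      nlinarith
    rw [← div_eq_mul_inv, div_le_div_iff₀ (by positivity) (by norm_num)]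
    have h3 : 60 * 64 ≤ y ^ 4 := by
      calc (60 * 64 : ℝ) ≤ 200 ^ 4 := by norm_num
        _ ≤ y ^ 4 := pow_le_pow_left₀ (by norm_num) (by linarith) 4
    have h4 := mul_le_mul_of_nonneg_left h3 (sq_nonneg y)
    have h5 : y ^ 2 * y ^ 4 = y ^ 6 := by ring
    linarith
  · have h1 : (2 : ℝ) ^ k ≤ 2 * y := (pow_le_pow_right₀ (by norm_num) hk).trans hy5
    have h2 : y ^ 15 / 2 ≤ Δ / (2 ^ k * numMachines n S Δ) := by
      rw [mul_comm, ← div_div, ← hy2, div_le_div_iff₀ (by norm_num) (by positivity)]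
      have := mul_le_mul_of_nonneg_left h1 (pow_nonneg hy0.le 15)
      linarith [pow_succ y 15]
    have hμ0 : 0 ≤ μ := le_trans (by positivity) hμ1
    rw [pow_zero, one_mul]
    have h3 : ((y ^ 6)⁻¹ / 4) ^ 2 * (2 * (1 / (2 * 10 ^ 6 * Real.log n) * (y ^ 15 / 2)))
        = y ^ 3 / (32 * 10 ^ 6 * Real.log n) := by
      field_simp
      norm_num
    calc 10 * Real.log n ≤ y ^ 3 / (32 * 10 ^ 6 * Real.log n) := by
          rw [le_div_iff₀ (by positivity)]
          have h4 : (200 * Real.log n) ^ 3 ≤ y ^ 3 := pow_le_pow_left₀ (by linarith) hy1 3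
          refine le_trans ?_ h4
          nlinarith [sq_nonneg (Real.log n)]
      _ = _ := h3.symm
      _ ≤ ((y ^ 6)⁻¹ / 4) ^ 2 * (2 * (μ * (Δ / (2 ^ k * numMachines n S Δ)))) := by
          gcongr
      _ = _ := by ring

theorem MeanField.δ_eq {V : Type*} [Fintype V] (P : MeanField V) :
    P.δ = 18 / (Fintype.card V : ℝ) ^ 8 := by
  have hn : (0 : ℝ) < Fintype.card V := by
    exact_mod_cast (by have := P.two_le; omega : 0 < Fintype.card V)
  have h : Real.exp (-(10 * Real.log (Fintype.card V))) = ((Fintype.card V : ℝ) ^ 10)⁻¹ := by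
    rw [Real.exp_neg, show (10 : ℝ) * Real.log (Fintype.card V)
      = ((10 : ℕ) : ℝ) * Real.log (Fintype.card V) by norm_num, Real.exp_nat_mul, Real.exp_log hn]
  rw [δ, q, h]
  field_simp
  norm_num

end Parameters

/-! ### The random partition -/

section Partition

theorem sizeCheck_subset {V : Type*} (G : SimpleGraph V) (S : ℕ) (W : Finset V) :
    sizeCheck G S W ⊆ W := by
  unfold sizeCheck
  split_ifs
  · exact Finset.empty_subset W
  · exact subset_rfl

theorem disjoint_parts {V : Type*} {m : ℕ} (φ : V → Fin m) (U : Finset V) (i j : Fin m)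
    (hij : i ≠ j) :
    Disjoint (U.filter fun v => φ v = i) (U.filter fun v => φ v = j) := by
  refine Finset.disjoint_left.2 fun v hv hv' => hij ?_
  rw [← (Finset.mem_filter.1 hv).2, (Finset.mem_filter.1 hv').2]

theorem ncard_edgeSet_inducedOn_le {V : Type*} {G : SimpleGraph V} {W : Finset V} {B : ℝ}
    (hB : ∀ v ∈ W, ((nbrs G W v).card : ℝ) ≤ B) :
    ((inducedOn G W).edgeSet.ncard : ℝ) ≤ W.card * B := by
  classical
  have h1 : (inducedOn G W).edgeSet
      ⊆ (((W.sigma fun v => nbrs G W v).image fun p => s(p.1, p.2) : Finset (Sym2 V)) :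
        Set (Sym2 V)) := by
    intro e he
    induction e with
    | _ u v =>
      rw [SimpleGraph.mem_edgeSet, inducedOn_adj] at he
      refine Finset.mem_coe.2 (Finset.mem_image.2 ⟨⟨u, v⟩, Finset.mem_sigma.2 ⟨he.2.1, ?_⟩, rfl⟩)
      exact mem_nbrs.2 ⟨he.2.2, he.1⟩
  have h2 : (inducedOn G W).edgeSet.ncard ≤ ∑ v ∈ W, (nbrs G W v).card := by
    refine (Set.ncard_le_ncard h1 (Finset.finite_toSet _)).trans ?_
    rw [Set.ncard_coe_finset, ← Finset.card_sigma]
    exact Finset.card_image_le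
  calc ((inducedOn G W).edgeSet.ncard : ℝ) ≤ ∑ v ∈ W, ((nbrs G W v).card : ℝ) := by
        exact_mod_cast h2
    _ ≤ ∑ _v ∈ W, B := Finset.sum_le_sum hB
    _ = W.card * B := by rw [Finset.sum_const, nsmul_eq_mul]

theorem pr_uniformOfFintype_eq {α : Type*} [Fintype α] [Nonempty α] (i : α) :
    pr (PMF.uniformOfFintype α) (fun x => x = i) = (Fintype.card α : ℝ)⁻¹ := by
  classical
  rw [pr_eq_ev, ev]
  simp

variable {V : Type*} [Fintype V] [DecidableEq V]

/-- Concentration of the weight of the part of `Y` that is assigned to machine `i`. -/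
theorem pr_partition {m : ℕ} [Nonempty (Fin m)] (i : Fin m) (Y : Finset V) {g : V → ℝ}
    (hg : ∀ v, 0 ≤ g v ∧ g v ≤ 1) {M l : ℝ} (hM : (∑ v ∈ Y, g v) / m ≤ M) (hl : 0 ≤ l)
    (hl1 : l ≤ 1) :
    pr (indep fun _ : V => PMF.uniformOfFintype (Fin m)) (fun φ =>
      ¬ |∑ v ∈ Y.filter (fun v => φ v = i), g v - (∑ v ∈ Y, g v) / m| ≤ 2 * l * M)
      ≤ 2 * Real.exp (-(l ^ 2 * M)) := by
  have hc : ∑ v ∈ Y, pr (PMF.uniformOfFintype (Fin m)) (fun x => x = i) * g v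
      = (∑ v ∈ Y, g v) / m := by
    rw [← Finset.mul_sum, pr_uniformOfFintype_eq, Fintype.card_fin, div_eq_inv_mul]
  have h := chernoff (fun _ : V => PMF.uniformOfFintype (Fin m)) (fun _ x => x = i) Y
    (fun v _ => hg v) (hc.trans_le hM) hl hl1
  rw [hc] at h
  refine le_trans (pr_mono _ fun φ hφ => ?_) h
  rw [Finset.sum_filter] at hφ
  convert hφ

/-- A random part of the vertex set is as expected at the start, and fits onto a machine. -/
theorem MeanField.pr_not_tracked_zero_le (P : MeanField V) {S : ℕ}
    (hS : (Fintype.card V : ℝ) * P.Δ ≤ 2 * P.m ^ 2 * S) (hΔ : P.Δ ≤ Fintype.card V)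
    [Nonempty (Fin P.m)] (i : Fin P.m) :
    pr (indep fun _ : V => PMF.uniformOfFintype (Fin P.m)) (fun φ =>
      ¬ (P.Tracked 0 (P.U.filter fun v => φ v = i) ∧
        sizeCheck P.G S (P.U.filter fun v => φ v = i) = P.U.filter fun v => φ v = i)) ≤ P.δ := by
  set n := Fintype.card V
  have hm := P.m_pos'
  have hΔ0 := P.Δ_pos
  obtain ⟨l0, l1⟩ := P.ε_div_mem
  have hd0 : P.d 0 = P.Δ / P.m := by simp [d]
  have hnm : P.d 0 ≤ n / P.m := by
    rw [hd0]
    exact div_le_div_of_nonneg_right hΔ hm.le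
  -- At j = 0 the weights are those of s itself, so each tracked sum is the part of a fixed sum that
  -- falls on machine i.
  have hA := pr_not_forall_le (indep fun _ : V => PMF.uniformOfFintype (Fin P.m))
    (fun x : Fin (P.τ + 1) × V × Bool => x.2.1 ∈ P.U)
    (fun x φ => |∑ u ∈ nbrs P.G (P.U.filter fun v => φ v = i) x.2.1,
        P.wt 0 x.1 u * P.test x.2.2 x.1 u
      - (∑ u ∈ nbrs P.G P.U x.2.1, P.s x.1 u * P.test x.2.2 x.1 u) / P.m| ≤ P.ε 0 * P.d 0)
    P.q_nonneg fun x hx => by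
      have hg : ∀ u, 0 ≤ P.wt 0 x.1 u * P.test x.2.2 x.1 u ∧
          P.wt 0 x.1 u * P.test x.2.2 x.1 u ≤ 1 :=
        fun u => mul_mem (P.wt_mem 0 x.1 u) (P.test_mem x.2.2 x.1 u)
      have hM : (∑ u ∈ nbrs P.G P.U x.2.1, P.wt 0 x.1 u * P.test x.2.2 x.1 u) / P.m
          ≤ 2 * P.d 0 := by
        rw [div_le_iff₀ hm, mul_assoc, d_mul, pow_zero, div_one]
        refine (Finset.sum_le_sum fun u _ => (hg u).2).trans ?_
        rw [Finset.sum_const, nsmul_eq_mul, mul_one]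
        linarith [P.deg_le x.2.1 hx]
      refine le_trans (pr_mono _ fun φ h => ?_)
        ((pr_partition i (nbrs P.G P.U x.2.1) hg hM l0 l1).trans (deviation_le' (Nat.zero_le _)))
      have hs : nbrs P.G (P.U.filter fun v => φ v = i) x.2.1
          = (nbrs P.G P.U x.2.1).filter fun v => φ v = i := by
        ext u
        simp only [mem_nbrs, Finset.mem_filter]
        tauto
      simp only [s_eq_wt, hs] at h
      convert h using 2
      ring
  have hB : pr (indep fun _ : V => PMF.uniformOfFintype (Fin P.m)) (fun φ =>
      ¬ |∑ v ∈ P.U.filter (fun v => φ v = i), (1 : ℝ) - (∑ v ∈ P.U, (1 : ℝ)) / P.m|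
        ≤ 2 * (P.ε 0 / 4) * (2 * (n / P.m))) ≤ P.q := by
    refine (pr_partition (g := fun _ => 1) i P.U (fun _ => by norm_num) (M := 2 * (n / P.m)) ?_
      l0 l1).trans (deviation_le (Nat.zero_le _) ?_)
    · have hU : (P.U.card : ℝ) ≤ n := by exact_mod_cast Finset.card_le_univ _
      have h0 : (0 : ℝ) ≤ n / P.m := by positivity
      have := div_le_div_of_nonneg_right hU hm.le
      rw [Finset.sum_const, nsmul_eq_mul, mul_one]
      linarith
    · have := mul_le_of_le_one_left (P.d_pos 0).le P.μ_le_one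
      linarith
  refine (pr_mono _ fun φ h => ?_).trans ((pr_not_and_le _ _ _).trans (add_le_add hA hB) |>.trans ?_)
  swap
  · have h1 := P.card_index_mul_le
    have h2 := P.card_mul_le
    have h3 := P.q_nonneg
    have h4 : (1 : ℝ) ≤ n := by exact_mod_cast (by have := P.two_le; omega : 1 ≤ n)
    have h5 : P.q ≤ n * P.q := le_mul_of_one_le_left h3 h4
    have h6 : 0 ≤ (n : ℝ) ^ 2 * P.q := by positivity
    unfold δ
    linarith
  rintro ⟨hclose, hsize⟩
  apply h
  have htr : P.Tracked 0 (P.U.filter fun v => φ v = i) := by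
    -- Eligibility up to phase 0 is vacuous.
    refine ⟨Finset.filter_subset _ _, fun v _ l h1 h2 => by omega, fun k _ hk v hv _ b => ?_⟩
    exact hclose (⟨k, Nat.lt_succ_of_le hk⟩, v, b) hv
  refine ⟨htr, ?_⟩
  set W := P.U.filter fun v => φ v = i with hW
  rw [sizeCheck, if_neg]
  rw [not_lt]
  have h1 : (W.card : ℝ) ≤ 2 * (n / P.m) := by
    have h2 := (abs_le.1 hsize).2
    simp only [Finset.sum_const, nsmul_eq_mul, mul_one] at h2
    have hU : (P.U.card : ℝ) ≤ n := by exact_mod_cast Finset.card_le_univ _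
    have h3 := div_le_div_of_nonneg_right hU hm.le
    have h4 : 2 * (P.ε 0 / 4) * (2 * (n / P.m)) ≤ (n : ℝ) / P.m := by
      have h0 : (0 : ℝ) ≤ n / P.m := by positivity
      have := mul_le_mul_of_nonneg_right (P.ε_le 0 (Nat.zero_le _)) h0
      linarith
    linarith
  have h2 := ncard_edgeSet_inducedOn_le (G := P.G) (W := W) (B := 2 * P.d 0) fun v hv =>
    htr.card_le (Nat.zero_le _) (htr.subset hv) (htr.eligible v hv)
  -- At most 2n/m vertices of degree at most 2Δ/m span at most 4nΔ/m² ≤ 8S edges.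
  have h3 : (W.card : ℝ) * (2 * P.d 0) ≤ 8 * S := by
    calc (W.card : ℝ) * (2 * P.d 0) ≤ 2 * (n / P.m) * (2 * P.d 0) :=
          mul_le_mul_of_nonneg_right h1 (by linarith [P.d_pos 0])
      _ = 4 * (n * P.Δ) / P.m ^ 2 := by
          rw [hd0]
          field_simp
          ring
      _ ≤ 8 * S := by
          rw [div_le_iff₀ (by positivity)]
          linarith
  exact_mod_cast h2.trans h3

end Partition

/-! ### One iteration of the main loop -/

section MainIteration

variable {V : Type*} [DecidableEq V]

/-- The degrees in `G[W]` are bounded in terms of the threshold `Δ`. -/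
def DegreeBound (G : SimpleGraph V) (Δ : ℝ) (W : Finset V) : Prop :=
  ∀ v ∈ W, ((nbrs G W v).card : ℝ) ≤ 7 / 4 * Δ

open Classical in
/-- The potential of a state: the size of the matching, plus a fraction of the number of the
remaining vertices of `T` if the degrees are bounded as expected. -/
noncomputable def potential (G : SimpleGraph V) (T : Finset V) (Δ : ℝ)
    (s : Finset V × Finset (Sym2 V)) : ℝ :=
  s.2.card + 1 / 200 * if DegreeBound G Δ s.1 then ((T ∩ s.1).card : ℝ) else 0

theorem card_le_potential (G : SimpleGraph V) (T : Finset V) (Δ : ℝ)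
    (s : Finset V × Finset (Sym2 V)) : (s.2.card : ℝ) ≤ potential G T Δ s := by
  unfold potential
  split_ifs
  · exact le_add_of_nonneg_right (by positivity)
  · simp

variable [Fintype V] {base : ℝ} {mm : Finset V → PMF (Finset (Sym2 V))} {G : SimpleGraph V}

theorem reachedFrom_parts
    (hmm : ∀ W, ∀ M ∈ (mm W).support, IsMaximalMatching (inducedOn G W) M) {S m τ : ℕ} {Δ : ℝ}
    {U : Finset V} {φ : V → Fin m} {r : Fin m → Finset V × Finset (Sym2 V)}
    (hr : r ∈ (indep fun i : Fin m => localRun base G mm m Δ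
      (sizeCheck G S (U.filter fun v => φ v = i)) τ).support) (i : Fin m) :
    ReachedFrom G (U.filter fun v => φ v = i) (r i) :=
  (localRun_support hmm τ (mem_support_of_mem_support_indep hr i)).mono (sizeCheck_subset _ _ _)

theorem mainIteration_eq {S m : ℕ} {Δ : ℝ} {s : Finset V × Finset (Sym2 V)}
    (hm : numMachines (Fintype.card V) S Δ = m) [h : Nonempty (Fin m)] :
    mainIteration base G mm S Δ s =
      (indep fun _ : V => PMF.uniformOfFintype (Fin m)).bind fun φ =>
      (indep fun i : Fin m => localRun base G mm m Δ
        (sizeCheck G S (s.1.filter fun v => φ v = i)) (numPhases (Fintype.card V) S Δ)).map fun r =>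
      (Finset.univ.biUnion fun i => (r i).1, s.2 ∪ Finset.univ.biUnion fun i => (r i).2) := by
  subst hm
  simp only [mainIteration]
  rw [dif_pos (Fin.pos_iff_nonempty.2 h)]

theorem mainIteration_support
    (hmm : ∀ W, ∀ M ∈ (mm W).support, IsMaximalMatching (inducedOn G W) M) {S : ℕ} {Δ : ℝ}
    {W : Finset V} {s t : Finset V × Finset (Sym2 V)} (hs : ReachedFrom G W s)
    (ht : t ∈ (mainIteration base G mm S Δ s).support) :
    ReachedFrom G W t ∧ s.2.card ≤ t.2.card := by
  by_cases hm : 0 < numMachines (Fintype.card V) S Δ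
  · simp only [mainIteration, dif_pos hm, PMF.mem_support_bind_iff, PMF.support_map,
      Set.mem_image] at ht
    obtain ⟨φ, -, r, hr, rfl⟩ := ht
    exact ⟨hs.trans (ReachedFrom.biUnion (disjoint_parts φ s.1) (fun i => Finset.filter_subset _ _)
      (reachedFrom_parts hmm hr)), Finset.card_le_card Finset.subset_union_left⟩
  · simp only [mainIteration, dif_neg hm, PMF.support_pure, Set.mem_singleton_iff] at ht
    subst ht
    exact ⟨hs, le_rfl⟩

/-- If all machines end as expected, then the degrees are bounded as expected. -/
theorem MeanField.degreeBound {P : MeanField V} (hτ : 1 ≤ P.τ)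
    {r : Fin P.m → Finset V × Finset (Sym2 V)} (hr : ∀ i, P.Tracked P.τ (r i).1) :
    DegreeBound P.G (P.Δ / 2 ^ P.τ) (Finset.univ.biUnion fun i => (r i).1) := by
  intro v hv
  obtain ⟨i, -, hi⟩ := Finset.mem_biUnion.1 hv
  have hv' := (hr i).subset hi
  have he := (hr i).eligible v hi
  have hm := P.m_pos'
  -- Eligibility does not refer to a machine, so the neighbours of v are controlled on every machine
  -- and not only on its own.
  have hcard : ∀ j, ((nbrs P.G (r j).1 v).card : ℝ)
      ≤ (∑ u ∈ nbrs P.G P.U v, P.s P.τ u) / P.m + P.ε P.τ * P.d P.τ := fun j => by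
    linarith [(abs_le.1 ((hr j).abs_card_sub_le le_rfl hv' he)).2]
  have hsub : nbrs P.G (Finset.univ.biUnion fun i => (r i).1) v
      ⊆ Finset.univ.biUnion fun i => nbrs P.G (r i).1 v := by
    intro u hu
    obtain ⟨hu1, hu2⟩ := mem_nbrs.1 hu
    obtain ⟨j, -, hj⟩ := Finset.mem_biUnion.1 hu1
    exact Finset.mem_biUnion.2 ⟨j, Finset.mem_univ j, mem_nbrs.2 ⟨hj, hu2⟩⟩
  calc ((nbrs P.G (Finset.univ.biUnion fun i => (r i).1) v).card : ℝ)
      ≤ ∑ j, ((nbrs P.G (r j).1 v).card : ℝ) := by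
        exact_mod_cast (Finset.card_le_card hsub).trans Finset.card_biUnion_le
    _ ≤ ∑ _j : Fin P.m, ((∑ u ∈ nbrs P.G P.U v, P.s P.τ u) / P.m + P.ε P.τ * P.d P.τ) :=
        Finset.sum_le_sum fun j _ => hcard j
    _ = ∑ u ∈ nbrs P.G P.U v, P.s P.τ u + P.ε P.τ * (P.d P.τ * P.m) := by
        rw [Finset.sum_const, Finset.card_univ, Fintype.card_fin, nsmul_eq_mul]
        field_simp
    _ ≤ 7 / 4 * (P.Δ / 2 ^ P.τ) := by
        rw [P.d_mul]
        have h1 := he P.τ hτ le_rfl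
        have h2 : 0 < P.Δ / 2 ^ P.τ := div_pos P.Δ_pos (by positivity)
        have h3 := mul_le_mul_of_nonneg_right (P.ε_le P.τ le_rfl) h2.le
        linarith

/-- The expected potential after the phases on all machines, for a good partition. -/
theorem MeanField.le_ev_machines {P : MeanField V} (hμ : P.μ = muR base (Fintype.card V))
    (hmm : ∀ W, ∀ M ∈ (mm W).support, IsMaximalMatching (inducedOn P.G W) M) (hτ : 1 ≤ P.τ)
    (hm : P.m ≤ Fintype.card V) {S : ℕ} {φ : V → Fin P.m}
    (hφ : ∀ i, P.Tracked 0 (P.U.filter fun v => φ v = i) ∧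
        sizeCheck P.G S (P.U.filter fun v => φ v = i) = P.U.filter fun v => φ v = i)
    (T : Finset V) :
    1 / 200 * (((T ∩ P.U).card : ℝ) - P.τ * P.μ * (T ∩ P.U).card
        - 2 * (Fintype.card V : ℝ) ^ 4 * P.δ)
      ≤ ev (indep fun i : Fin P.m => localRun base P.G mm P.m P.Δ
        (sizeCheck P.G S (P.U.filter fun v => φ v = i)) P.τ) fun r =>
        potential P.G T (P.Δ / 2 ^ P.τ)
          (Finset.univ.biUnion fun i => (r i).1, Finset.univ.biUnion fun i => (r i).2) := by
  classical
  set n := Fintype.card V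
  have hδ := P.δ_nonneg
  have hn1 : (1 : ℝ) ≤ n := by exact_mod_cast (by have := P.two_le; omega : 1 ≤ n)
  have hm' : (P.m : ℝ) ≤ n := by exact_mod_cast hm
  have hτ' : (P.τ : ℝ) ≤ n := by exact_mod_cast P.τ_lt.le
  set μr := indep fun i : Fin P.m => localRun base P.G mm P.m P.Δ
        (sizeCheck P.G S (P.U.filter fun v => φ v = i)) P.τ with hμr
  have hbad : pr μr (fun r => ∃ i, ¬ P.Tracked P.τ (r i).1) ≤ n * (n * P.δ) := by
    refine (pr_exists_fintype_le (ε := P.τ * P.δ) μr _ fun i => ?_).trans ?_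
    · rw [hμr, pr_indep_coord _ i fun s : Finset V × Finset (Sym2 V) => ¬ P.Tracked P.τ s.1, (hφ i).2]
      exact P.pr_localRun_le hμ (hφ i).1 le_rfl
    · rw [Fintype.card_fin]
      gcongr
  have hsum : ∑ i : Fin P.m, ((T ∩ P.U.filter fun v => φ v = i).card : ℝ) = (T ∩ P.U).card := by
    have h := ReachedFrom.card_inter_biUnion (G := P.G) (disjoint_parts φ P.U)
      (fun i => ReachedFrom.refl (P.U.filter fun v => φ v = i)) T
    rw [Finset.biUnion_filter_eq_of_maps_to fun v _ => Finset.mem_univ (φ v)] at h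
    exact_mod_cast h.symm
  have hmain : ∑ i : Fin P.m, 1 / 200 * (((T ∩ P.U.filter fun v => φ v = i).card : ℝ)
      - P.τ * (P.μ * (T ∩ P.U.filter fun v => φ v = i).card + (n : ℝ) ^ 2 * P.δ))
      ≤ ev μr fun r => ∑ i, (((r i).2.card : ℝ) + 1 / 200 * ((T ∩ (r i).1).card : ℝ)) := by
    rw [ev_sum]
    refine Finset.sum_le_sum fun i _ => ?_
    rw [hμr, ev_indep_coord _ i fun s : Finset V × Finset (Sym2 V) =>
      ((s.2.card : ℝ) + 1 / 200 * ((T ∩ s.1).card : ℝ)),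
      (hφ i).2]
    exact P.le_ev_localRun hμ hmm (hφ i).1 T le_rfl
  have hleft : ∑ i : Fin P.m, 1 / 200 * (((T ∩ P.U.filter fun v => φ v = i).card : ℝ)
      - P.τ * (P.μ * (T ∩ P.U.filter fun v => φ v = i).card + (n : ℝ) ^ 2 * P.δ))
      = 1 / 200 * (((T ∩ P.U).card : ℝ) - P.τ * P.μ * (T ∩ P.U).card
        - P.m * P.τ * (n : ℝ) ^ 2 * P.δ) := by
    rw [← Finset.mul_sum, Finset.sum_sub_distrib, ← Finset.mul_sum, Finset.sum_add_distrib,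
      ← Finset.mul_sum, hsum, Finset.sum_const, Finset.card_univ, Fintype.card_fin, nsmul_eq_mul]
    ring
  have hpot : ev μr (fun r => ∑ i, (((r i).2.card : ℝ) + 1 / 200 * ((T ∩ (r i).1).card : ℝ))
      + (-(1 / 200 * n)) * if ∃ i, ¬ P.Tracked P.τ (r i).1 then 1 else 0)
      ≤ ev μr fun r => potential P.G T (P.Δ / 2 ^ P.τ)
          (Finset.univ.biUnion fun i => (r i).1, Finset.univ.biUnion fun i => (r i).2) := by
    refine ev_mono_support _ fun r hr => ?_
    have h1 := ReachedFrom.card_biUnion (disjoint_parts φ P.U) (reachedFrom_parts hmm hr)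
    have h2 := ReachedFrom.card_inter_biUnion (disjoint_parts φ P.U) (reachedFrom_parts hmm hr) T
    have h3 : ∑ i, (((r i).2.card : ℝ) + 1 / 200 * ((T ∩ (r i).1).card : ℝ))
        = ((Finset.univ.biUnion fun i => (r i).2).card : ℝ)
          + 1 / 200 * ((T ∩ Finset.univ.biUnion fun i => (r i).1).card : ℝ) := by
      rw [h1, h2, Finset.sum_add_distrib, ← Finset.mul_sum]
      push_cast
      rfl
    rw [h3]
    by_cases hall : ∃ i, ¬ P.Tracked P.τ (r i).1
    · rw [if_pos hall]
      have h4 := card_le_potential P.G T (P.Δ / 2 ^ P.τ)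
        (Finset.univ.biUnion fun i => (r i).1, Finset.univ.biUnion fun i => (r i).2)
      have h5 : ((T ∩ Finset.univ.biUnion fun i => (r i).1).card : ℝ) ≤ n := by
        exact_mod_cast Finset.card_le_univ _
      dsimp only at h4
      linarith
    · rw [if_neg hall]
      push Not at hall
      rw [potential, if_pos (P.degreeBound hτ hall)]
      linarith
  rw [ev_add, ev_const_mul, ← pr_eq_ev] at hpot
  -- At most n machines with at most n phases lose n²δ each, and machines that end off track cost
  -- another n · n²δ; both are at most n⁴δ.
  have h5 : (P.m : ℝ) * P.τ * (n : ℝ) ^ 2 * P.δ ≤ n * n * (n : ℝ) ^ 2 * P.δ := by gcongr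
  have h6 := mul_le_mul_of_nonneg_left hbad (Nat.cast_nonneg (α := ℝ) n)
  have h7 : (n : ℝ) ^ 3 * P.δ ≤ (n : ℝ) ^ 4 * P.δ :=
    mul_le_mul_of_nonneg_right (pow_le_pow_right₀ hn1 (by norm_num)) hδ
  rw [hleft] at hmain
  nlinarith

/-- In an iteration of the main loop, the expected potential does not decrease by much. -/
theorem potential_sub_le_ev_mainIteration {S : ℕ} {Δ : ℝ}
    (hmm : ∀ W, ∀ M ∈ (mm W).support, IsMaximalMatching (inducedOn G W) M)
    (h : LoopCond (Fintype.card V) S Δ) (hn : 2 ≤ Fintype.card V) (hS : 1 ≤ S)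
    (hSn : S ≤ Fintype.card V) (hΔ : Δ ≤ Fintype.card V) (hb : base = 2 ∨ base = Real.exp 1)
    {W : Finset V} {s : Finset V × Finset (Sym2 V)} (hs : ReachedFrom G W s) (T : Finset V) :
    potential G T Δ s - 1 / 200 * (numPhases (Fintype.card V) S Δ * muR base (Fintype.card V)
        * T.card + 54 / (Fintype.card V : ℝ) ^ 4)
      ≤ ev (mainIteration base G mm S Δ s)
        (potential G T (Δ / 2 ^ numPhases (Fintype.card V) S Δ)) := by
  classical
  set n := Fintype.card V with hnV
  have hn0 : (0 : ℝ) < n := by exact_mod_cast (by omega : 0 < n)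
  have hμ0 : 0 ≤ muR base n := by
    have hL : 0 < Real.log n := Real.log_pos (by exact_mod_cast hn)
    exact le_trans (by positivity) (muR_bounds hn hb).1
  have herr : 0 ≤ 54 / (n : ℝ) ^ 4 := by positivity
  -- Without the degree bound the potential is just the size of the matching, which never decreases.
  by_cases hdeg : DegreeBound G Δ s.1
  swap
  · rw [potential, if_neg hdeg]
    have h1 : (s.2.card : ℝ) ≤ ev (mainIteration base G mm S Δ s)
        (potential G T (Δ / 2 ^ numPhases n S Δ)) := by
      rw [← ev_const (mainIteration base G mm S Δ s) (s.2.card : ℝ)]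
      refine ev_mono_support _ fun t ht => le_trans ?_ (card_le_potential _ _ _ _)
      exact_mod_cast (mainIteration_support hmm hs ht).2
    have h2 : 0 ≤ numPhases n S Δ * muR base n * (T.card : ℝ) := by positivity
    linarith
  obtain ⟨P, rfl, hU, hμ, rfl, hm, hτ⟩ := exists_meanField (b := base) h hn hS hSn hΔ hb hdeg
  obtain ⟨-, -, -, hτ1, -⟩ := exists_root h hn hS hSn hΔ
  have hmpos := numMachines_pos h hn hS hSn hΔ
  have hmle := numMachines_le h hn hS hSn hΔ
  have hsq : (n : ℝ) * P.Δ ≤ 2 * P.m ^ 2 * S := by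
    rw [hm, ← div_le_iff₀ (by exact_mod_cast hS)]
    exact le_two_mul_numMachines_sq h hn hS hSn hΔ
  have hδ := P.δ_nonneg
  rw [← hτ] at hτ1
  rw [potential, if_pos hdeg, ← hτ, ← hμ]
  rw [← hm] at hmpos hmle
  have : Nonempty (Fin P.m) := ⟨⟨0, hmpos⟩⟩
  rw [mainIteration_eq (m := P.m) hm.symm]
  set good : (V → Fin P.m) → Prop := fun φ => ∀ i, P.Tracked 0 (P.U.filter fun v => φ v = i) ∧
    sizeCheck P.G S (P.U.filter fun v => φ v = i) = P.U.filter fun v => φ v = i with hgood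
  set μφ := indep fun _ : V => PMF.uniformOfFintype (Fin P.m) with hμφ
  have hbad : pr μφ (fun φ => ¬ good φ) ≤ n * P.δ := by
    have h1 := pr_exists_fintype_le μφ (fun i φ => ¬ (P.Tracked 0 (P.U.filter fun v => φ v = i) ∧
      sizeCheck P.G S (P.U.filter fun v => φ v = i) = P.U.filter fun v => φ v = i))
      (P.pr_not_tracked_zero_le hsq hΔ)
    rw [Fintype.card_fin] at h1
    refine (pr_mono _ fun φ hφ => ?_).trans (h1.trans (mul_le_mul_of_nonneg_right
      (by exact_mod_cast hmle) hδ))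
    exact not_forall.1 hφ
  rw [ev_bind, ← hτ, ← hU]
  have hTU : ((T ∩ P.U).card : ℝ) ≤ T.card := by
    exact_mod_cast Finset.card_le_card Finset.inter_subset_left
  have hTn : ((T ∩ P.U).card : ℝ) ≤ n := by exact_mod_cast Finset.card_le_univ _
  set X : ℝ := ((T ∩ P.U).card : ℝ) - P.τ * P.μ * (T ∩ P.U).card - 2 * (n : ℝ) ^ 4 * P.δ with hX
  have hτμ : 0 ≤ P.τ * P.μ := mul_nonneg (Nat.cast_nonneg _) P.μ_pos.le
  have hXn : X ≤ n := by
    have h1 : 0 ≤ P.τ * P.μ * ((T ∩ P.U).card : ℝ) := by positivity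
    have h2 : 0 ≤ 2 * (n : ℝ) ^ 4 * P.δ := by positivity
    linarith
  have hinner : ev μφ (fun φ => ((s.2.card : ℝ) + 1 / 200 * X)
      + (-(1 / 200 * n)) * if ¬ good φ then 1 else 0) ≤ ev μφ fun φ =>
      ev ((indep fun i : Fin P.m => localRun base P.G mm P.m P.Δ
        (sizeCheck P.G S (P.U.filter fun v => φ v = i)) P.τ).map fun r =>
        (Finset.univ.biUnion fun i => (r i).1, s.2 ∪ Finset.univ.biUnion fun i => (r i).2))
        (potential P.G T (P.Δ / 2 ^ P.τ)) := by
    refine ev_mono _ fun φ => ?_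
    rw [ev_map]
    by_cases hφ : good φ
    · rw [if_neg (not_not.2 hφ)]
      have h1 := P.le_ev_machines hμ hmm hτ1 hmle hφ T
      have h3 := ev_const_add (indep fun i : Fin P.m => localRun base P.G mm P.m P.Δ
        (sizeCheck P.G S (P.U.filter fun v => φ v = i)) P.τ) (s.2.card : ℝ) fun r =>
          potential P.G T (P.Δ / 2 ^ P.τ)
            (Finset.univ.biUnion fun i => (r i).1, Finset.univ.biUnion fun i => (r i).2)
      refine le_trans (b := _) ?_ (h3.symm.trans_le (ev_mono_support _ fun r hr => ?_))
      · linarith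
      · have h2 := hs.card_union (ReachedFrom.biUnion (disjoint_parts φ s.1)
          (fun i => Finset.filter_subset _ _) fun i => hU ▸ reachedFrom_parts hmm hr i)
        dsimp only at h2
        unfold potential
        dsimp only
        rw [h2]
        push_cast
        linarith
    · rw [if_pos hφ]
      refine le_trans (b := (s.2.card : ℝ)) (by linarith) ?_
      rw [← ev_const (indep fun i : Fin P.m => localRun base P.G mm P.m P.Δ
        (sizeCheck P.G S (P.U.filter fun v => φ v = i)) P.τ) (s.2.card : ℝ)]
      refine ev_mono _ fun r => le_trans ?_ (card_le_potential _ _ _ _)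
      exact_mod_cast Finset.card_le_card Finset.subset_union_left
  refine le_trans ?_ hinner
  rw [ev_const_add, ev_const_mul, ← pr_eq_ev]
  have h1 := mul_le_mul_of_nonneg_left hbad hn0.le
  have h2 : P.τ * P.μ * ((T ∩ P.U).card : ℝ) ≤ P.τ * P.μ * T.card :=
    mul_le_mul_of_nonneg_left hTU hτμ
  have h3 : (n : ℝ) ^ 2 * P.δ ≤ (n : ℝ) ^ 4 * P.δ :=
    mul_le_mul_of_nonneg_right (pow_le_pow_right₀ (by exact_mod_cast (by omega : 1 ≤ n))
      (by norm_num)) hδ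
  -- Two of the three parts come from the machines, the third from bad partitions.
  have h4 : 3 * ((n : ℝ) ^ 4 * P.δ) = 54 / (n : ℝ) ^ 4 := by
    rw [P.δ_eq, ← hnV]
    field_simp
    norm_num
  rw [hX]
  linarith

end MainIteration

/-! ### The whole algorithm -/

section Thresholds

variable {n S : ℕ}

/-- The number of phases in the first `k` iterations of the main loop. -/
noncomputable def phasesBefore (n S k : ℕ) : ℕ :=
  ∑ i ∈ Finset.range k, numPhases n S (threshold n S i)

theorem phasesBefore_succ (n S k : ℕ) :
    phasesBefore n S (k + 1) = phasesBefore n S k + numPhases n S (threshold n S k) :=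
  Finset.sum_range_succ _ k

theorem threshold_eq (n S k : ℕ) : threshold n S k = n / 2 ^ phasesBefore n S k := by
  induction k with
  | zero => simp [threshold, phasesBefore]
  | succ k ih =>
    rw [phasesBefore_succ, pow_add, ← div_div, ← ih]
    rfl

theorem threshold_le (n S k : ℕ) : threshold n S k ≤ n := by
  rw [threshold_eq]
  exact div_le_self (Nat.cast_nonneg n) (one_le_pow₀ (by norm_num))

theorem loopCond_of_lt {k : ℕ} (hk : k < numIterations n S) : LoopCond n S (threshold n S k) :=
  not_not.1 (Nat.notMem_of_lt_sInf hk)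

theorem one_le_threshold (hn : 2 ≤ n) (hS : 1 ≤ S) (hSn : S ≤ n) {k : ℕ}
    (hk : k ≤ numIterations n S) : 1 ≤ threshold n S k := by
  cases k with
  | zero =>
    rw [threshold]
    exact_mod_cast (by omega : 1 ≤ n)
  | succ k =>
    have h := two_pow_numPhases_le (loopCond_of_lt hk) hn hS hSn (threshold_le n S k)
    exact (one_le_div (by positivity)).2 h

theorem le_phasesBefore (hn : 2 ≤ n) (hS : 1 ≤ S) (hSn : S ≤ n) {k : ℕ}
    (hk : k ≤ numIterations n S) : k ≤ phasesBefore n S k := by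
  induction k with
  | zero => exact Nat.zero_le _
  | succ k ih =>
    obtain ⟨-, -, -, h, -⟩ := exists_root (loopCond_of_lt hk) hn hS hSn (threshold_le n S k)
    rw [phasesBefore_succ]
    exact add_le_add (ih (Nat.le_of_succ_le hk)) h

theorem two_pow_phasesBefore_le (hn : 2 ≤ n) (hS : 1 ≤ S) (hSn : S ≤ n) :
    2 ^ phasesBefore n S (numIterations n S) ≤ n := by
  have h := one_le_threshold hn hS hSn le_rfl
  rw [threshold_eq, one_le_div (by positivity)] at h
  exact_mod_cast h

/-- There are at most log₂ n phases, because the threshold ends at 1 or above, and μ_R is at most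
10⁻⁶ / ln n. Hence the reference sets cost a small constant fraction in total. -/
theorem phasesBefore_mul_muR_le (hn : 2 ≤ n) (hS : 1 ≤ S) (hSn : S ≤ n) {b : ℝ}
    (hb : b = 2 ∨ b = Real.exp 1) :
    phasesBefore n S (numIterations n S) * muR b n ≤ 1 / 8 := by
  have hL : 0 < Real.log n := Real.log_pos (by exact_mod_cast hn)
  have h1 : phasesBefore n S (numIterations n S) * Real.log 2 ≤ Real.log n := by
    rw [← Real.log_pow]
    exact Real.log_le_log (by positivity) (by exact_mod_cast two_pow_phasesBefore_le hn hS hSn)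
  refine (mul_le_mul_of_nonneg_left (muR_bounds hn hb).2 (Nat.cast_nonneg _)).trans ?_
  rw [mul_one_div, div_le_iff₀ (by positivity)]
  have h2 := mul_le_mul_of_nonneg_left Real.log_two_gt_d9.le
    (Nat.cast_nonneg (α := ℝ) (phasesBefore n S (numIterations n S)))
  nlinarith

/-- Either the loop is never entered, or n ≥ 300 and the number of iterations is at most n. -/
theorem numIterations_mul_le (hn : 2 ≤ n) (hS : 1 ≤ S) (hSn : S ≤ n) :
    numIterations n S * (54 / (n : ℝ) ^ 4) ≤ 1 / 4 := by
  rcases Nat.eq_zero_or_pos (numIterations n S) with h0 | hpos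
  · rw [h0]
    norm_num
  have hn0 : (0 : ℝ) < n := by exact_mod_cast (by omega : 0 < n)
  have hL := (loopCond_of_lt hpos).log_ge hn hS hSn (threshold_le n S 0)
  have hn300 : (300 : ℝ) ≤ n := by linarith [Real.log_le_sub_one_of_pos hn0]
  have hK : (numIterations n S : ℝ) ≤ n := by
    exact_mod_cast (le_phasesBefore hn hS hSn le_rfl).trans
      (Nat.lt_two_pow_self.le.trans (two_pow_phasesBefore_le hn hS hSn))
  rw [mul_div_assoc', div_le_iff₀ (by positivity)]
  have h3 : (300 : ℝ) ^ 3 ≤ (n : ℝ) ^ 3 := pow_le_pow_left₀ (by norm_num) hn300 3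
  nlinarith

end Thresholds

/-! ### Expected size of the output -/

section ParallelAlg

variable {V : Type*} [Fintype V] [DecidableEq V] {G : SimpleGraph V} {base : ℝ} {S : ℕ}
  {mm : Finset V → PMF (Finset (Sym2 V))} {pick : (V → Finset V) → PMF (V → V)}

theorem mainState_support
    (hmm : ∀ W, ∀ M ∈ (mm W).support, IsMaximalMatching (inducedOn G W) M) (k : ℕ)
    {s : Finset V × Finset (Sym2 V)} (hs : s ∈ (mainState base G mm S k).support) :
    ReachedFrom G Finset.univ s := by
  induction k generalizing s with
  | zero =>
    rw [mainState, PMF.support_pure, Set.mem_singleton_iff] at hs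
    subst hs
    exact ReachedFrom.refl _
  | succ k ih =>
    rw [mainState, PMF.mem_support_bind_iff] at hs
    obtain ⟨t, ht, hs⟩ := hs
    exact (mainIteration_support hmm (ih ht) hs).1

theorem degreeBound_univ {V : Type*} [Fintype V] (G : SimpleGraph V) :
    DegreeBound G (Fintype.card V) Finset.univ := by
  intro v _
  have h : ((nbrs G Finset.univ v).card : ℝ) ≤ Fintype.card V := by
    exact_mod_cast Finset.card_le_univ _
  have h0 : (0 : ℝ) ≤ Fintype.card V := Nat.cast_nonneg _
  linarith

theorem le_ev_mainState
    (hmm : ∀ W, ∀ M ∈ (mm W).support, IsMaximalMatching (inducedOn G W) M)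
    (hn : 2 ≤ Fintype.card V) (hS : 1 ≤ S) (hSn : S ≤ Fintype.card V)
    (hb : base = 2 ∨ base = Real.exp 1) (T : Finset V) {k : ℕ}
    (hk : k ≤ numIterations (Fintype.card V) S) :
    1 / 200 * (T.card - (phasesBefore (Fintype.card V) S k * muR base (Fintype.card V) * T.card
        + k * (54 / (Fintype.card V : ℝ) ^ 4)))
      ≤ ev (mainState base G mm S k) (potential G T (threshold (Fintype.card V) S k)) := by
  induction k with
  | zero =>
    rw [mainState, ev_pure, potential, threshold, if_pos (degreeBound_univ G)]
    simp [phasesBefore]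
  | succ k ih =>
    rw [mainState, ev_bind]
    have h1 := ev_mono_support (mainState base G mm S k) fun s hs =>
      potential_sub_le_ev_mainIteration hmm (loopCond_of_lt hk) hn hS hSn (threshold_le _ S k) hb
        (mainState_support hmm k hs) T
    rw [ev_sub, ev_const] at h1
    refine le_trans ?_ h1
    have h2 := ih (Nat.le_of_succ_le hk)
    rw [phasesBefore_succ]
    push_cast
    linarith

theorem card_nbrs_filter_lt {V : Type*} {G : SimpleGraph V} {W : Finset V} {D : ℝ} :
    ∀ v ∈ W.filter fun v => ((nbrs G W v).card : ℝ) < D,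
      ((nbrs G (W.filter fun v => ((nbrs G W v).card : ℝ) < D) v).card : ℝ) < D := by
  intro v hv
  refine lt_of_le_of_lt ?_ (Finset.mem_filter.1 hv).2
  exact_mod_cast Finset.card_le_card (nbrs_mono (Finset.filter_subset _ _) v)

theorem parallelAlg_support
    (hmm : ∀ W, ∀ M ∈ (mm W).support, IsMaximalMatching (inducedOn G W) M)
    (hpick : ∀ A, ∀ f ∈ (pick A).support, ∀ w, (A w).Nonempty → f w ∈ A w)
    {M : Finset (Sym2 V)} (hM : M ∈ (parallelAlg base G mm pick S).support) : IsMatching G M := by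
  simp only [parallelAlg, PMF.mem_support_bind_iff, PMF.support_map, Set.mem_image] at hM
  obtain ⟨s, hs, M', hM', rfl⟩ := hM
  exact ((mainState_support hmm _ hs).trans
    ((globalAlg_support hpick card_nbrs_filter_lt hM').mono (Finset.filter_subset _ _))).2.1

/-- The expected size of the matching of `ParallelAlg` is at least a constant fraction of the size of
every matching. -/
theorem le_ev_parallelAlg
    (hmm : ∀ W, ∀ M ∈ (mm W).support, IsMaximalMatching (inducedOn G W) M)
    (hpick : ∀ A, ∀ f ∈ (pick A).support, ∀ w, (A w).Nonempty → f w ∈ A w)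
    (hn : 2 ≤ Fintype.card V) (hS : 1 ≤ S) (hSn : S ≤ Fintype.card V)
    (hb : base = 2 ∨ base = Real.exp 1) {N : Finset (Sym2 V)} (hN : IsMatching G N)
    (hN1 : 1 ≤ N.card) :
    (N.card : ℝ) / 400 ≤ ev (parallelAlg base G mm pick S) fun M => (M.card : ℝ) := by
  classical
  set T := N.biUnion Sym2.toFinset with hT
  have hTcard : (T.card : ℝ) = 2 * N.card := by exact_mod_cast hN.card_biUnion
  have hN1' : (1 : ℝ) ≤ N.card := by exact_mod_cast hN1
  have h1 := le_ev_mainState hmm hn hS hSn hb T le_rfl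
  have h2 := mul_le_mul_of_nonneg_right (phasesBefore_mul_muR_le hn hS hSn hb)
    (Nat.cast_nonneg (α := ℝ) T.card)
  have h3 := numIterations_mul_le hn hS hSn
  have hΔ := one_le_threshold hn hS hSn le_rfl
  rw [parallelAlg, ev_bind]
  set Δ := threshold (Fintype.card V) S (numIterations (Fintype.card V) S)
  set p := mainState base G mm S (numIterations (Fintype.card V) S) with hp
  have h4 : ev p (potential G T Δ) - 1 / 200 * N.card ≤ ev p fun s =>
      ev ((globalAlg G pick (2 * Δ) (s.1.filter fun v =>
        ((nbrs G s.1 v).card : ℝ) < 2 * Δ)).map fun M' => s.2 ∪ M') fun M => (M.card : ℝ) := by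
    rw [← ev_const p (1 / 200 * (N.card : ℝ)), ← ev_sub]
    refine ev_mono_support _ fun s hs => ?_
    rw [ev_map]
    set q := globalAlg G pick (2 * Δ) (s.1.filter fun v => ((nbrs G s.1 v).card : ℝ) < 2 * Δ)
      with hq
    have h5 : ev q (fun M' => (s.2.card : ℝ) + M'.card) ≤ ev q fun M' => ((s.2 ∪ M').card : ℝ) := by
      refine ev_mono_support _ fun M' hM' => ?_
      have h6 := (mainState_support hmm _ hs).card_union
        ((globalAlg_support hpick card_nbrs_filter_lt hM').mono (Finset.filter_subset _ _))
      dsimp only at h6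
      rw [h6]
      push_cast
      rfl
    rw [ev_const_add] at h5
    refine le_trans ?_ h5
    rw [potential]
    split_ifs with hdeg
    · have h6 := le_ev_globalAlg hpick (by linarith) (card_nbrs_filter_lt (D := 2 * Δ) (W := s.1)) hN
      -- Degrees are at most 7Δ/4 < 2Δ, so the deletion before the global algorithm removes nothing.
      have h7 : (s.1.filter fun v => ((nbrs G s.1 v).card : ℝ) < 2 * Δ) = s.1 :=
        Finset.filter_true_of_mem fun v hv => (hdeg v hv).trans_lt (by linarith)
      rw [← hq, h7, ← hT] at h6
      linarith
    · have h6 : 0 ≤ ev q fun M' => (M'.card : ℝ) := ev_nonneg _ fun _ => Nat.cast_nonneg _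
      linarith
  -- With |T| = 2|N|, what remains is (2|N| - |N|/4 - 1/4 - |N|) / 200, and this is at least |N|/400
  -- because |N| ≥ 1.
  refine le_trans ?_ h4
  linarith

end ParallelAlg

end RoundCompression

/-! ### From expectation to probability -/

theorem mainTheorem3 :
    ∃ c : ℝ, 0 < c ∧ ∃ p : ℝ, 0 < p ∧
      ∀ (V : Type*) [Fintype V] [DecidableEq V] (G : SimpleGraph V) (S : ℕ) (b : ℝ)
        (mm : Finset V → PMF (Finset (Sym2 V))) (pick : (V → Finset V) → PMF (V → V))
        (Mopt : Finset (Sym2 V)),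
        2 ≤ Fintype.card V → 1 ≤ S → S ≤ Fintype.card V →
        (b = 2 ∨ b = Real.exp 1) →
        (∀ W, ∀ M ∈ (mm W).support,
          RoundCompression.IsMaximalMatching (RoundCompression.inducedOn G W) M) →
        (∀ A, ∀ f ∈ (pick A).support, ∀ w, (A w).Nonempty → f w ∈ A w) →
        RoundCompression.IsMaximumMatching G Mopt →
        ENNReal.ofReal p ≤
          (RoundCompression.parallelAlg b G mm pick S).toOuterMeasure
            {M | RoundCompression.IsMatching G M ∧ c * (Mopt.card : ℝ) ≤ (M.card : ℝ)} := by
  refine ⟨1 / 800, by norm_num, 1 / 800, by norm_num, ?_⟩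
  intro V _ _ G S b mm pick Mopt hn hS hSn hb hmm hpick hopt
  classical
  rw [← RoundCompression.ofReal_pr]
  refine ENNReal.ofReal_le_ofReal ?_
  have hsupp := fun M => RoundCompression.parallelAlg_support (M := M) (base := b) (S := S) hmm hpick
  rcases Nat.eq_zero_or_pos Mopt.card with h0 | hpos
  · have h1 := RoundCompression.le_pr_of_le_ev (RoundCompression.parallelAlg b G mm pick S)
      (f := fun _ => 1) (a := 0) (B := 1)
      (P := fun M => RoundCompression.IsMatching G M ∧ 1 / 800 * (Mopt.card : ℝ) ≤ (M.card : ℝ))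
      le_rfl (fun _ _ => le_rfl) fun M hM _ => ⟨hsupp M hM, by simp [h0]⟩
    rw [RoundCompression.ev_const] at h1
    linarith
  · have hpos' : (0 : ℝ) < Mopt.card := by exact_mod_cast hpos
    -- The output never exceeds the optimum and its mean is at least 1/400 of it, so cutting at
    -- 1/800 leaves probability at least 1/400 - 1/800.
    have h1 := RoundCompression.le_pr_of_le_ev (RoundCompression.parallelAlg b G mm pick S)
      (f := fun M => (M.card : ℝ)) (a := 1 / 800 * (Mopt.card : ℝ)) (B := Mopt.card)
      (P := fun M => RoundCompression.IsMatching G M ∧ 1 / 800 * (Mopt.card : ℝ) ≤ (M.card : ℝ))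
      (by positivity) (fun M hM => by exact_mod_cast hopt.2 M (hsupp M hM))
      fun M hM h => ⟨hsupp M hM, h⟩
    have h2 := RoundCompression.le_ev_parallelAlg hmm hpick hn hS hSn hb hopt.1 hpos
    refine le_of_mul_le_mul_left ?_ hpos'
    linarith
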